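/- **Setting.** Let $(\Omega,\mathcal F,\mathbb P)$ be a probability space and $\alpha\in(0,1)$. Let $Y\in\mathbb R^d$ and $Z\in\mathbb R^q$ be independent random variables, $\varphi:\mathbb R^d\times\mathbb R^q\to\mathbb R$ measurable with $\mathbb E[|\varphi(Y,Z)|^{2+\delta}]<\infty$ for some $\delta>0$, and $X_0=\mathbb E[\varphi(Y,Z)\mid Y]$. Let $\mathcal H=\{1/K: K\in\mathbb N,\ K\ge 1\}$ and, for $h=1/K\in\mathcal H$, let $X_h=\frac1K\sum_{k=1}^K\varphi(Y,Z^{(k)})$, where $Z^{(1)},Z^{(2)},\dots$ are i.i.d. copies of $Z$, independent of $Y$. For $h\in\mathcal H\cup\{0\}$ let $F_{X_h}$ be the distribution function of $X_h$ and $V_h(\xi)=\xi+\frac1{1-\alpha}\mathbb E[(X_h-\xi)^+]$, $\xi\in\mathbb R$. Let $\xi^0_\star=\inf\{\xi\in\mathbb R:\mathbb P(X_0\le\xi)\ge\alpha\}$ be the value-at-risk of $X_0$ and, for $h\in\mathcal H$, $\xi^h_\star=\operatorname{arg\,min}V_h$ (unique under the assumptions below) and $\chi^h_\star=\min V_h$.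 **Algorithm.** Let $\gamma_n=\gamma_1n^{-\beta}$, $n\ge1$, with $\gamma_1>0$ and $\beta\in(\frac12,1)$. For each $h\in\mathcal H$ let $X_h^{(1)},X_h^{(2)},\dots$ be i.i.d. copies of $X_h$, let $\xi^h_0$ be a real random variable independent of them, let $\chi^h_0=0$, and for $n\ge0$ $$\xi^h_{n+1}=\xi^h_n-\gamma_{n+1}\Big(1-\tfrac1{1-\alpha}\mathbf 1_{X_h^{(n+1)}\ge\xi^h_n}\Big),\qquad \chi^h_{n+1}=\chi^h_n-\tfrac1{n+1}\Big(\chi^h_n-\xi^h_n-\tfrac1{1-\alpha}(X_h^{(n+1)}-\xi^h_n)^+\Big),$$ and let $\overline\xi^h_n=\frac1n\sum_{k=1}^n\xi^h_k$, $n\ge1$. **Assumptions.** 1. There are functions $v,w(\cdot,h):\mathbb R\to\mathbb R$ with $F_{X_h}(\xi)-F_{X_0}(\xi)=v(\xi)h+w(\xi,h)h$ for all $\xi\in\mathbb R$, $h\in\mathcal H$, such that for every minimizer $\xi_\star$ of $V_0$ the function $v$ is integrable on $(\xi_\star,\infty)$ and $\lim_{\mathcal H\ni h\downarrow0}w(\xi_\star,h)=\lim_{\mathcal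 H\ni h\downarrow0}\int_{\xi_\star}^\infty w(\xi,h)\,\mathrm d\xi=0$. 2. For every $h\in\mathcal H\cup\{0\}$ the law of $X_h$ has a continuous density $f_{X_h}$ with respect to Lebesgue measure, and $f_{X_h}\to f_{X_0}$ locally uniformly as $\mathcal H\ni h\downarrow0$. 3. For every $R>0$, $\inf\{f_{X_h}(\xi): h\in\mathcal H\cup\{0\},\ |\xi-\xi^0_\star|<R\}>0$. 4. The densities $f_{X_h}$, $h\in\mathcal H\cup\{0\}$, are bounded and Lipschitz, uniformly in $h$. 5. With $c_\alpha=\max\big(1,\frac{\alpha}{1-\alpha}\big)$, $\ \sup_{h\in\mathcal H}\mathbb E\Big[|\xi^h_0|^2\exp\Big(\frac{4}{1-\alpha}c_\alpha\sup_{h'\in\mathcal H}\|f_{X_{h'}}\|_\infty\,|\xi^h_0|\Big)\Big]<\infty$. **Theorem.** Under these assumptions (and with no further constraint on $\gamma_1$), as $\mathcal H\ni h\downarrow0$, $$h^{-1}\begin{pmatrix}\overline\xi^h_{\lceil h^{-2}\rceil}-\xi^h_\star\\ \chi^h_{\lceil h^{-2}\rceil}-\chi^h_\star\end{pmatrix}\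 \text{converges in law to}\ \mathcal N(0,\overline\Sigma),$$ where $$\overline\Sigma=\begin{pmatrix}\dfrac{\alpha(1-\alpha)}{f_{X_0}(\xi^0_\star)^2}&\dfrac{\alpha}{1-\alpha}\dfrac{\mathbb E[(X_0-\xi^0_\star)^+]}{f_{X_0}(\xi^0_\star)}\\[2ex]\dfrac{\alpha}{1-\alpha}\dfrac{\mathbb E[(X_0-\xi^0_\star)^+]}{f_{X_0}(\xi^0_\star)}&\dfrac{\operatorname{Var}((X_0-\xi^0_\star)^+)}{(1-\alpha)^2}\end{pmatrix}.$$ -/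

import Mathlib

open MeasureTheory ProbabilityTheory Filter Topology
open scoped ENNReal NNReal

noncomputable section

namespace NestedSA

/-- The bias parameter `h = 1 / K`; the set of all bias parameters is indexed by the integers
`K ≥ 1`, and `h ↓ 0` along it means `K → ∞`. -/
def bias (K : ℕ+) : ℝ := 1 / ((K : ℕ) : ℝ)

section Risk

variable {Ω : Type*} [MeasurableSpace Ω]

/-- The cumulative distribution function of `X`. -/
def cdfOf (P : Measure Ω) (X : Ω → ℝ) (ξ : ℝ) : ℝ := P.real {ω | X ω ≤ ξ}

/-- The value-at-risk `inf {ξ | P (X ≤ ξ) ≥ α}`. -/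
def valueAtRisk (P : Measure Ω) (α : ℝ) (X : Ω → ℝ) : ℝ := sInf {ξ | α ≤ cdfOf P X ξ}

/-- The objective `V (ξ) = ξ + (1 - α)⁻¹ 𝔼[(X - ξ)⁺]`. -/
def objective (P : Measure Ω) (α : ℝ) (X : Ω → ℝ) (ξ : ℝ) : ℝ :=
  ξ + 1 / (1 - α) * ∫ ω, max (X ω - ξ) 0 ∂P

/-- The set of minimizers of the objective. -/
def argminSet (P : Measure Ω) (α : ℝ) (X : Ω → ℝ) : Set ℝ :=
  {ξ | ∀ η, objective P α X ξ ≤ objective P α X η}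

/-- The minimizer of the objective (the element of `argminSet`, when that is a singleton). -/
def minimizer (P : Measure Ω) (α : ℝ) (X : Ω → ℝ) : ℝ := sInf (argminSet P α X)

/-- The minimum of the objective. -/
def minValue (P : Measure Ω) (α : ℝ) (X : Ω → ℝ) : ℝ := ⨅ ξ, objective P α X ξ

/-- `f` is a continuous probability density of the law of `X` with respect to Lebesgue measure. -/
structure IsContinuousPdf (P : Measure Ω) (X : Ω → ℝ) (f : ℝ → ℝ) : Prop where
  continuous : Continuous f
  nonneg : ∀ x, 0 ≤ f x
  law : P.map X = (volume : Measure ℝ).withDensity (fun x => ENNReal.ofReal (f x))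

end Risk

section Loss

variable {Ω : Type*} [MeasurableSpace Ω] {d q : ℕ}

/-- The loss `X₀ = 𝔼[φ(Y, Z) | Y]`. -/
def exactLoss (P : Measure Ω) (φ : EuclideanSpace ℝ (Fin d) → EuclideanSpace ℝ (Fin q) → ℝ)
    (Y : Ω → EuclideanSpace ℝ (Fin d)) (Z : Ω → EuclideanSpace ℝ (Fin q)) : Ω → ℝ :=
  P[fun ω => φ (Y ω) (Z ω) | MeasurableSpace.comap Y inferInstance]

/-- The nested approximation `X_h = K⁻¹ ∑_{k = 1}^K φ(Y, Z^{(k)})`, `h = 1 / K`, where `Zs k` stands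
for `Z^{(k + 1)}`. -/
def nestedLoss (φ : EuclideanSpace ℝ (Fin d) → EuclideanSpace ℝ (Fin q) → ℝ)
    (Y : Ω → EuclideanSpace ℝ (Fin d)) (Zs : ℕ → Ω → EuclideanSpace ℝ (Fin q))
    (K : ℕ+) (ω : Ω) : ℝ :=
  1 / ((K : ℕ) : ℝ) * ∑ k ∈ Finset.range (K : ℕ), φ (Y ω) (Zs k ω)

end Loss

section Assumptions

variable {Ω : Type*} [MeasurableSpace Ω]

/-- The assumptions on the laws of `X₀` and of `X_h`, `h = 1 / K`; here `f₀` and `f K` are their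
densities, and `ξ⁰⋆` is the value-at-risk of `X₀`. -/
structure RegularLaws (P : Measure Ω) (α : ℝ) (X₀ : Ω → ℝ) (X : ℕ+ → Ω → ℝ)
    (f₀ : ℝ → ℝ) (f : ℕ+ → ℝ → ℝ) : Prop where
  /-- First order expansion of the distribution functions in the bias parameter. -/
  expansion : ∃ (v : ℝ → ℝ) (w : ℝ → ℕ+ → ℝ),
    (∀ (K : ℕ+) (ξ : ℝ),
      cdfOf P (X K) ξ - cdfOf P X₀ ξ = v ξ * bias K + w ξ K * bias K) ∧
    ∀ ξs ∈ argminSet P α X₀,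
      IntegrableOn v (Set.Ioi ξs) ∧
      Tendsto (fun K => w ξs K) atTop (𝓝 0) ∧
      Tendsto (fun K => ∫ ξ in Set.Ioi ξs, w ξ K) atTop (𝓝 0)
  /-- Continuous densities, converging locally uniformly. -/
  pdf_exact : IsContinuousPdf P X₀ f₀
  pdf_nested : ∀ K, IsContinuousPdf P (X K) (f K)
  pdf_tendsto : TendstoLocallyUniformly f f₀ atTop
  /-- Lower bound on every ball around the value-at-risk, uniformly in the bias parameter. -/
  pdf_lower : ∀ R : ℝ, 0 < R → ∃ c : ℝ, 0 < c ∧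
    ∀ ξ ∈ Metric.ball (valueAtRisk P α X₀) R, c ≤ f₀ ξ ∧ ∀ K, c ≤ f K ξ
  /-- Uniform boundedness. -/
  pdf_upper : ∃ C : ℝ, ∀ ξ, f₀ ξ ≤ C ∧ ∀ K, f K ξ ≤ C
  /-- Uniform Lipschitz continuity. -/
  pdf_lipschitz : ∃ L : ℝ≥0, LipschitzWith L f₀ ∧ ∀ K, LipschitzWith L (f K)

/-- The integrability assumption on the initial values `ξ^h_0` (`ξ₀ K` with `h = 1 / K`):
`sup_h 𝔼[|ξ^h_0|² exp (4 / (1 - α) c_α (sup_h ‖f_h‖_∞) |ξ^h_0|)] < ∞`, where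
`c_α = max 1 (α / (1 - α))`. -/
def InitialMoments (P : Measure Ω) (α : ℝ) (f : ℕ+ → ℝ → ℝ) (ξ₀ : ℕ+ → Ω → ℝ) : Prop :=
  (⨆ K : ℕ+, ∫⁻ ω, ENNReal.ofReal (|ξ₀ K ω| ^ 2 *
    Real.exp (4 / (1 - α) * max 1 (α / (1 - α)) * (⨆ (K' : ℕ+), ⨆ (x : ℝ), |f K' x|)
      * |ξ₀ K ω|)) ∂P) < ∞

end Assumptions

section Algorithm

variable {Ω : Type*}

/-- `H₁(ξ, x) = 1 - (1 - α)⁻¹ 1_{x ≥ ξ}`. -/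
def H₁ (α ξ x : ℝ) : ℝ := 1 - 1 / (1 - α) * (if ξ ≤ x then 1 else 0)

/-- `H₂(ξ, χ, x) = χ - (ξ + (1 - α)⁻¹ (x - ξ)⁺)`. -/
def H₂ (α ξ χ x : ℝ) : ℝ := χ - (ξ + 1 / (1 - α) * max (x - ξ) 0)

/-- The value-at-risk iterates `ξ_{n+1} = ξ_n - γ_{n+1} H₁(ξ_n, X^{(n+1)})`, where `X n` stands for
the innovation `X^{(n+1)}`. -/
def varIterate (α : ℝ) (γ : ℕ → ℝ) (ξ₀ : Ω → ℝ) (X : ℕ → Ω → ℝ) : ℕ → Ω → ℝ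
  | 0 => ξ₀
  | n + 1 => fun ω => varIterate α γ ξ₀ X n ω
      - γ (n + 1) * H₁ α (varIterate α γ ξ₀ X n ω) (X n ω)

/-- The expected shortfall iterates `χ_0 = 0`,
`χ_{n+1} = χ_n - (n + 1)⁻¹ H₂(ξ_n, χ_n, X^{(n+1)})`. -/
def esIterate (α : ℝ) (γ : ℕ → ℝ) (ξ₀ : Ω → ℝ) (X : ℕ → Ω → ℝ) : ℕ → Ω → ℝ
  | 0 => fun _ => 0
  | n + 1 => fun ω => esIterate α γ ξ₀ X n ω
      - 1 / ((n : ℝ) + 1) * H₂ α (varIterate α γ ξ₀ X n ω) (esIterate α γ ξ₀ X n ω) (X n ω)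

/-- The averaged value-at-risk estimator `n⁻¹ ∑_{k = 1}^n ξ_k`. -/
def avgVarIterate (α : ℝ) (γ : ℕ → ℝ) (ξ₀ : Ω → ℝ) (X : ℕ → Ω → ℝ) (n : ℕ) (ω : Ω) : ℝ :=
  1 / (n : ℝ) * ∑ k ∈ Finset.Icc 1 n, varIterate α γ ξ₀ X k ω

end Algorithm

section Limit

variable {Ω : Type*} [MeasurableSpace Ω]

/-- The asymptotic covariance matrix, where `ξs` is the value-at-risk of `X₀` and `f₀` the density
of `X₀`. -/
def limitCov (P : Measure Ω) (α : ℝ) (X₀ : Ω → ℝ) (f₀ : ℝ → ℝ) (ξs : ℝ) :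
    Matrix (Fin 2) (Fin 2) ℝ :=
  !![α * (1 - α) / f₀ ξs ^ 2,
      α / (1 - α) * ((∫ ω, max (X₀ ω - ξs) 0 ∂P) / f₀ ξs);
    α / (1 - α) * ((∫ ω, max (X₀ ω - ξs) 0 ∂P) / f₀ ξs),
      Var[fun ω => max (X₀ ω - ξs) 0; P] / (1 - α) ^ 2]

end Limit

end NestedSA

end

open NestedSA

noncomputable section

namespace NestedSA

/-! ### Hyperbolic inequalities for the Lyapunov function. -/

section Elementary

/-! This is Polyak–Ruppert averaging, carried out with constants that are uniform in the bias
parameter for all large `K`. Write `θ` for the quantile of `X_h`, `D_n = ξ_n - θ`, `N = K²`, and let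
`a = f_h(θ) / (1 - α)` be the derivative at `θ` of the mean field `drift`.

Rate. Since `H₁` is bounded, so is the mean field, and no restoring force linear in `D_n` can hold
globally. A lower bound on the density near `θ` gives only a force of Huber type, at least `c
min(|d|, 1)`. The Lyapunov function `cosh (lam * D) - 1` is adapted to this: its derivative,
multiplied by such a force, dominates the function itself (`mul_cosh_sub_one_le_sinh_mul`), and its
second-order remainder under bounded increments is a multiple of `cosh (lam * D)`. One step thus
contracts the expectation by `1 - lam c γ_n` up to `O(γ_n²)` (`integral_cosh_sub_one_succ_le`), so
that `𝔼 D_n² = O(n^{-β})` without any condition on `γ₁` (`exists_integral_sq_varIterate_le`). The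
exponential moment of the initial value makes the Lyapunov function integrable.

Linearization. Dividing the recursion by its step size and summing gives `a ∑ D_{n+1} + ∑ H₁(θ,
X_n)` as the sum of a boundary term, a term treated by summation by parts, a martingale, and a
quadratic Taylor error. With the rate above each of them is `o(√N)` in `L¹`
(`integral_abs_varError_le`); the Taylor error has size `∑ n^{-β} = o(√N)` because `β > 1/2`. For
the expected shortfall, the step `1/(n+1)` makes `N χ_N` a plain sum of losses at `ξ_n`. Replacing
`ξ_n` by `θ` costs a martingale with small increments and a mean that is quadratic in `D_n`, because
`θ` minimizes the convex objective (`integral_abs_esError_le`).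

Limit. What remains is `K⁻¹` times a sum of `K²` i.i.d. centered vectors whose law depends on `K`.
These vectors converge in mean square along a coupling: `X_h → X₀` in `L²` at squared rate `1/K` by
conditional independence, the quantiles converge by the expansion of the distribution functions, and
the indicator in `H₁` is harmless because `X₀` has a bounded density. For centered variables,
characteristic functions at argument `s` differ by `O(s²)` times the `L²` distance, so at `s = 1/K`
their `K²`-th powers merge and the classical central limit theorem for the limiting vector applies
(`tendsto_charFun_row`, `tendstoInDistribution_row_sums`). A covariance computation and Slutsky's
lemma finish the proof. -/

lemma exp_le_one_add_add_sq_mul (x : ℝ) : Real.exp x ≤ 1 + x + x ^ 2 * Real.exp |x| := by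
  have h := Complex.norm_exp_sub_sum_le_norm_mul_exp (x : ℂ) 2
  rw [Finset.sum_range_succ, Finset.sum_range_one] at h
  have e : Complex.exp (x : ℂ) - ((x : ℂ) ^ 0 / (Nat.factorial 0 : ℂ)
      + (x : ℂ) ^ 1 / (Nat.factorial 1 : ℂ)) = ((Real.exp x - (1 + x) : ℝ) : ℂ) := by
    simp
  rw [e, Complex.norm_real, Complex.norm_real, Real.norm_eq_abs, Real.norm_eq_abs, sq_abs] at h
  linarith [le_abs_self (Real.exp x - (1 + x))]

/-- The exponential expansion applied to `b` and to `-b`, weighted by `exp (-a)` and `exp a`. The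
remainder is proportional to `cosh a`, which is what lets the Lyapunov recursion close on itself. -/
lemma cosh_sub_le (a b : ℝ) :
    Real.cosh (a - b) ≤ Real.cosh a - b * Real.sinh a + b ^ 2 * Real.exp |b| * Real.cosh a := by
  have h1 := exp_le_one_add_add_sq_mul b
  have h2 := exp_le_one_add_add_sq_mul (-b)
  rw [abs_neg] at h2
  have h3 := mul_le_mul_of_nonneg_left h2 (Real.exp_pos a).le
  have h4 := mul_le_mul_of_nonneg_left h1 (Real.exp_pos (-a)).le
  rw [Real.cosh_eq, Real.cosh_eq, Real.sinh_eq, neg_sub, sub_eq_add_neg, Real.exp_add,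
    sub_eq_add_neg b a, add_comm b (-a), Real.exp_add]
  nlinarith

lemma cosh_add_le_mul_exp (a b : ℝ) : Real.cosh (a + b) ≤ Real.cosh a * Real.exp |b| := by
  rw [Real.cosh_eq, Real.cosh_eq, neg_add, Real.exp_add, Real.exp_add]
  have h1 : Real.exp b ≤ Real.exp |b| := Real.exp_le_exp.2 (le_abs_self b)
  have h2 : Real.exp (-b) ≤ Real.exp |b| := Real.exp_le_exp.2 (neg_le_abs b)
  nlinarith [Real.exp_pos a, Real.exp_pos (-a)]

/-- The tangent lines at `x` of `exp` and of its reflection lie below the graphs at `0`; average the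
two inequalities. -/
lemma cosh_sub_one_le_mul_sinh (x : ℝ) : Real.cosh x - 1 ≤ x * Real.sinh x := by
  have h1 := mul_le_mul_of_nonneg_left (Real.add_one_le_exp (-x)) (Real.exp_pos x).le
  have h2 := mul_le_mul_of_nonneg_left (Real.add_one_le_exp x) (Real.exp_pos (-x)).le
  rw [← Real.exp_add, add_neg_cancel, Real.exp_zero] at h1
  rw [← Real.exp_add, neg_add_cancel, Real.exp_zero] at h2
  rw [Real.cosh_eq, Real.sinh_eq]
  nlinarith

lemma cosh_sub_one_le_abs_sinh (x : ℝ) : Real.cosh x - 1 ≤ |Real.sinh x| := by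
  have h1 := Real.exp_pos (-|x|)
  have h2 : Real.exp (-|x|) ≤ 1 := Real.exp_le_one_iff.2 (by simp)
  rw [← Real.cosh_abs, Real.abs_sinh, Real.cosh_eq, Real.sinh_eq]
  linarith

/-- The half-angle identity `cosh x - 1 = 2 sinh² (x / 2)`. It turns bounds on the Lyapunov function
into second moments. -/
lemma sq_div_two_le_cosh_sub_one (x : ℝ) : x ^ 2 / 2 ≤ Real.cosh x - 1 := by
  have h : |x / 2| ≤ Real.sinh |x / 2| := Real.self_le_sinh_iff.2 (abs_nonneg _)
  have h2 := pow_le_pow_left₀ (abs_nonneg _) h 2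
  rw [← Real.abs_sinh, sq_abs, sq_abs] at h2
  have h3 := Real.cosh_two_mul (x / 2)
  rw [mul_div_cancel₀ x two_ne_zero, Real.cosh_sq] at h3
  linarith

/-- A restoring force of Huber type dominates `cosh - 1` after multiplication by `sinh`. -/
lemma mul_cosh_sub_one_le_sinh_mul {lam c d g : ℝ} (h0 : 0 < lam) (h1 : lam ≤ 1) (hc : 0 ≤ c)
    (hg : c * min |d| 1 * |d| ≤ d * g) :
    c * (Real.cosh (lam * d) - 1) ≤ Real.sinh (lam * d) * g := by
  rcases eq_or_ne d 0 with rfl | hd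
  · simp
  have hd' : 0 < |d| := abs_pos.2 hd
  have key : Real.cosh (lam * d) - 1 ≤ |Real.sinh (lam * d)| * min |d| 1 := by
    -- In the linear range of the force, `cosh x - 1 ≤ x sinh x` together with `lam ≤ 1` suffices;
    -- in the flat range, `cosh x - 1 ≤ |sinh x|` does.
    rcases le_total |d| 1 with h | h
    · rw [min_eq_left h]
      refine (cosh_sub_one_le_mul_sinh _).trans ((le_abs_self _).trans ?_)
      rw [abs_mul, abs_mul, abs_of_pos h0, mul_comm]
      gcongr
      nlinarith
    · rw [min_eq_right h, mul_one]
      exact cosh_sub_one_le_abs_sinh _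
  -- `sinh (lam * d)` has the sign of `d`, so the hypothesis may be divided by `|d|` on either side
  -- of the origin.
  have hsg : |Real.sinh (lam * d)| * (c * min |d| 1) ≤ Real.sinh (lam * d) * g := by
    rcases lt_or_gt_of_ne hd with h | h
    · have hs : Real.sinh (lam * d) ≤ 0 := Real.sinh_nonpos_iff.2 (by nlinarith)
      rw [abs_of_nonpos hs]
      rw [abs_of_neg h] at hg ⊢
      have : c * min (-d) 1 ≤ -g := by nlinarith
      nlinarith
    · have hs : 0 ≤ Real.sinh (lam * d) := Real.sinh_nonneg_iff.2 (by nlinarith)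
      rw [abs_of_nonneg hs]
      rw [abs_of_pos h] at hg ⊢
      have : c * min d 1 ≤ g := by nlinarith
      nlinarith
  nlinarith

end Elementary

/-! ### Deterministic recursions and sums of powers. -/

section Sequences

variable {β : ℝ}

/-- The ratio `r = (n+1)/(n+2)` is at most `1`, so `r ≤ r ^ β` and `1 - r ^ β ≤ 1 - r`. Because `β <
1`, the resulting decrement of order `n^{-β-1}` is negligible against `n^{-2β}`, the order of the
squared step size. -/
lemma rpow_neg_sub_rpow_neg_succ_le (hβ0 : 0 < β) (hβ1 : β < 1) (n : ℕ) :
    ((n : ℝ) + 1) ^ (-β) - ((n : ℝ) + 2) ^ (-β) ≤ ((n : ℝ) + 1) ^ (-β) * ((n : ℝ) + 1)⁻¹ := by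
  have p1 : (0 : ℝ) < (n : ℝ) + 1 := by positivity
  have p2 : (0 : ℝ) < (n : ℝ) + 2 := by positivity
  have hx0 : 0 < ((n : ℝ) + 1) / (n + 2) := by positivity
  have hx1 : ((n : ℝ) + 1) / (n + 2) ≤ 1 := by rw [div_le_one p2]; linarith
  have h := Real.rpow_le_rpow_of_exponent_ge hx0 hx1 hβ1.le
  rw [Real.rpow_one, Real.div_rpow p1.le p2.le] at h
  have e : ((n : ℝ) + 2) ^ (-β) = ((n : ℝ) + 1) ^ (-β) *
      (((n : ℝ) + 1) ^ β / ((n : ℝ) + 2) ^ β) := by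
    rw [Real.rpow_neg p1.le, Real.rpow_neg p2.le]
    have := (Real.rpow_pos_of_pos p1 β).ne'
    field_simp
  rw [e]
  have hr := Real.rpow_pos_of_pos p1 (-β)
  have h3 : 1 - ((n : ℝ) + 1) / (n + 2) ≤ ((n : ℝ) + 1)⁻¹ := by
    rw [← sub_nonneg]
    have : ((n : ℝ) + 1)⁻¹ - (1 - ((n : ℝ) + 1) / (n + 2)) = 1 / ((n + 1) * (n + 2)) := by
      field_simp; ring
    rw [this]; positivity
  nlinarith

lemma tendsto_succ_rpow_neg {p : ℝ} (hp : 0 < p) :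
    Tendsto (fun n : ℕ => ((n : ℝ) + 1) ^ (-p)) atTop (𝓝 0) := by
  have := (tendsto_rpow_neg_atTop hp).comp
    (tendsto_atTop_add_const_right atTop (1 : ℝ) tendsto_natCast_atTop_atTop)
  exact this

/-- A sequence driven by the contraction `1 - κ γ_n` with perturbation `γ_n²` is `O(γ_n)`, with a
constant depending only on the parameters of the recursion. -/
lemma exists_rate_of_recursion (hβ0 : 0 < β) (hβ1 : β < 1) {κ L γ₁ M₀ : ℝ} (hκ : 0 < κ)
    (hL : 0 ≤ L) (hγ : 0 < γ₁) :
    ∃ M : ℝ, 0 ≤ M ∧ ∀ u : ℕ → ℝ, (∀ n, 0 ≤ u n) → u 0 ≤ M₀ →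
      (∀ n, u (n + 1) ≤ u n - κ * (γ₁ * ((n : ℝ) + 1) ^ (-β)) * u n
        + L * (γ₁ * ((n : ℝ) + 1) ^ (-β)) ^ 2 * (1 + u n)) →
      ∀ n, u n ≤ M * ((n : ℝ) + 1) ^ (-β) := by
  set r : ℕ → ℝ := fun n => ((n : ℝ) + 1) ^ (-β) with hr
  have rpos : ∀ n, 0 < r n := fun n => Real.rpow_pos_of_pos (by positivity) _
  have rle : ∀ n, r n ≤ 1 := fun n =>
    Real.rpow_le_one_of_one_le_of_nonpos (by simp) (by linarith)
  -- The final constant must not depend on `u`, so the first `N` terms are bounded crudely by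
  -- dropping the contraction, with a bound chosen before `u`.
  have hbd : ∀ N : ℕ, ∃ B : ℝ, 0 ≤ B ∧ ∀ u : ℕ → ℝ, (∀ n, 0 ≤ u n) → u 0 ≤ M₀ →
      (∀ n, u (n + 1) ≤ u n - κ * (γ₁ * r n) * u n + L * (γ₁ * r n) ^ 2 * (1 + u n)) →
      ∀ n ≤ N, u n ≤ B := by
    intro N
    induction N with
    | zero => exact ⟨max M₀ 0, le_max_right _ _, fun u _ h0 _ n hn => by
        obtain rfl : n = 0 := by omega
        exact h0.trans (le_max_left _ _)⟩
    | succ N ih =>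
      obtain ⟨B, hB, h⟩ := ih
      have hLg : 0 ≤ L * γ₁ ^ 2 * (1 + B) := by positivity
      refine ⟨B + L * γ₁ ^ 2 * (1 + B), by positivity, fun u hu h0 hrec n hn => ?_⟩
      rcases Nat.lt_or_ge n (N + 1) with hlt | hge
      · linarith [h u hu h0 hrec n (by omega)]
      · obtain rfl : n = N + 1 := by omega
        have hN := h u hu h0 hrec N le_rfl
        have h1 : 0 ≤ κ * (γ₁ * r N) * u N := by
          have := rpos N; have := hu N; positivity
        have h2 : L * (γ₁ * r N) ^ 2 * (1 + u N) ≤ L * γ₁ ^ 2 * (1 + B) := by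
          have := rpos N
          have : γ₁ * r N ≤ γ₁ := by nlinarith [rle N]
          have := hu N
          gcongr
        linarith [hrec N]
  have r0 : Tendsto r atTop (𝓝 0) := tendsto_succ_rpow_neg hβ0
  have r1 : Tendsto (fun n : ℕ => ((n : ℝ) + 1) ^ (-(1 - β))) atTop (𝓝 0) :=
    tendsto_succ_rpow_neg (by linarith)
  have e1 : ∀ᶠ n in atTop, L * γ₁ ^ 2 * r n ≤ κ * γ₁ / 4 := by
    have : Tendsto (fun n => L * γ₁ ^ 2 * r n) atTop (𝓝 (L * γ₁ ^ 2 * 0)) := r0.const_mul _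
    rw [mul_zero] at this
    exact this.eventually_le_const (by positivity)
  have e2 : ∀ᶠ n in atTop, κ * γ₁ * r n ≤ 1 := by
    have : Tendsto (fun n => κ * γ₁ * r n) atTop (𝓝 (κ * γ₁ * 0)) := r0.const_mul _
    rw [mul_zero] at this
    exact this.eventually_le_const (by positivity)
  have e3 : ∀ᶠ n : ℕ in atTop, ((n : ℝ) + 1) ^ (-(1 - β)) ≤ κ * γ₁ / 4 :=
    r1.eventually_le_const (by positivity)
  obtain ⟨N, hN⟩ := eventually_atTop.1 (e1.and (e2.and e3))
  obtain ⟨B, hB, hb⟩ := hbd N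
  -- The first entry covers the indices up to `N`; the second makes the noise `L γ₁² r²` at most
  -- half of the contraction `κ γ₁ M r²`. A quarter absorbs the part of the noise proportional to
  -- `u`, and the last quarter absorbs the decrease of `r`.
  set M : ℝ := max (B / r N) (2 * L * γ₁ / κ) with hM
  have hM0 : 0 ≤ M := le_max_of_le_left (by have := rpos N; positivity)
  refine ⟨M, hM0, fun u hu h0 hrec n => ?_⟩
  change u n ≤ M * r n
  rcases le_total n N with hn | hn
  · have : r N ≤ r n := Real.rpow_le_rpow_of_nonpos (by positivity) (by gcongr) (by linarith)
    calc u n ≤ B := hb u hu h0 hrec n hn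
      _ = B / r N * r N := by field_simp [(rpos N).ne']
      _ ≤ M * r n := by
        have := (rpos N).le
        gcongr
        exact le_max_left _ _
  · induction n, hn using Nat.le_induction with
    | base =>
      calc u N ≤ B := hb u hu h0 hrec N le_rfl
        _ = B / r N * r N := by field_simp [(rpos N).ne']
        _ ≤ M * r N := by
          have := (rpos N).le
          gcongr
          exact le_max_left _ _
    | succ n hn ih =>
      obtain ⟨a1, a2, a3⟩ := hN n hn
      have hrn := rpos n
      have hstep : r n - r (n + 1) ≤ κ * γ₁ / 4 * r n ^ 2 := by
        have h := rpow_neg_sub_rpow_neg_succ_le hβ0 hβ1 n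
        have e : ((n : ℝ) + 1) ^ (-β) * ((n : ℝ) + 1)⁻¹
            = r n * (r n * ((n : ℝ) + 1) ^ (-(1 - β))) := by
          simp only [hr]
          have p1 : (0 : ℝ) < (n : ℝ) + 1 := by positivity
          rw [← Real.rpow_add p1, ← Real.rpow_neg_one]
          ring_nf
        have e' : r (n + 1) = ((n : ℝ) + 2) ^ (-β) := by
          simp only [hr]; push_cast; ring_nf
        rw [e']
        refine (h.trans e.le).trans ?_
        have := mul_le_mul_of_nonneg_left a3 (mul_pos hrn hrn).le
        nlinarith
      have hML : L * γ₁ ^ 2 ≤ κ * γ₁ / 2 * M := by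
        have : 2 * L * γ₁ / κ ≤ M := le_max_right _ _
        rw [div_le_iff₀ hκ] at this
        nlinarith
      have hun := hu n
      have h1 : L * (γ₁ * r n) ^ 2 * u n ≤ κ * γ₁ / 4 * r n * u n := by
        have := mul_le_mul_of_nonneg_right a1 (mul_nonneg hrn.le hun)
        nlinarith
      have h2 : u (n + 1) ≤ (1 - 3 / 4 * (κ * γ₁ * r n)) * u n + L * γ₁ ^ 2 * r n ^ 2 := by
        have := hrec n
        nlinarith
      have h3 : (1 - 3 / 4 * (κ * γ₁ * r n)) * u n
          ≤ (1 - 3 / 4 * (κ * γ₁ * r n)) * (M * r n) :=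
        mul_le_mul_of_nonneg_left ih (by linarith)
      have h4 : L * γ₁ ^ 2 * r n ^ 2 ≤ κ * γ₁ / 2 * M * r n ^ 2 :=
        mul_le_mul_of_nonneg_right hML (sq_nonneg _)
      have h5 : M * (r n - r (n + 1)) ≤ M * (κ * γ₁ / 4 * r n ^ 2) :=
        mul_le_mul_of_nonneg_left hstep hM0
      nlinarith

/-- Since `β > 1/2`, the terms are negligible against `n^{-1/2}`, whose partial sums lie between
`√N` and `2 √N`. Their divergence is what allows the comparison of terms to be summed. -/
lemma sum_range_rpow_neg_isLittleO (hβ : 1 / 2 < β) :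
    Tendsto (fun N : ℕ => (∑ n ∈ Finset.range N, ((n : ℝ) + 1) ^ (-β)) / √(N : ℝ))
      atTop (𝓝 0) := by
  have hg0 : ∀ n : ℕ, (0 : ℝ) ≤ ((n : ℝ) + 1) ^ (-(1 / 2 : ℝ)) := fun n => by positivity
  have hsum_le : ∀ N : ℕ, ∑ n ∈ Finset.range N, ((n : ℝ) + 1) ^ (-(1 / 2 : ℝ)) ≤ 2 * √(N : ℝ) := by
    intro N
    induction N with
    | zero => simp
    | succ N ih =>
      rw [Finset.sum_range_succ, Real.rpow_neg (by positivity), ← Real.sqrt_eq_rpow]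
      push_cast
      have p : 0 < √((N : ℝ) + 1) := Real.sqrt_pos.2 (by positivity)
      have hs1 := Real.sq_sqrt (show (0 : ℝ) ≤ (N : ℝ) + 1 by positivity)
      have hs0 := Real.sq_sqrt (show (0 : ℝ) ≤ (N : ℝ) by positivity)
      have : (√((N : ℝ) + 1))⁻¹ ≤ 2 * (√((N : ℝ) + 1) - √(N : ℝ)) := by
        rw [inv_le_iff_one_le_mul₀ p]
        nlinarith [sq_nonneg (√((N : ℝ) + 1) - √(N : ℝ))]
      linarith
  have hsum_ge : ∀ N : ℕ, √(N : ℝ) ≤ ∑ n ∈ Finset.range N, ((n : ℝ) + 1) ^ (-(1 / 2 : ℝ)) := by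
    intro N
    induction N with
    | zero => simp
    | succ N ih =>
      rw [Finset.sum_range_succ, Real.rpow_neg (by positivity), ← Real.sqrt_eq_rpow]
      push_cast
      have p : 0 < √((N : ℝ) + 1) := Real.sqrt_pos.2 (by positivity)
      have hs1 := Real.sq_sqrt (show (0 : ℝ) ≤ (N : ℝ) + 1 by positivity)
      have hs0 := Real.sq_sqrt (show (0 : ℝ) ≤ (N : ℝ) by positivity)
      have hle : √(N : ℝ) ≤ √((N : ℝ) + 1) := Real.sqrt_le_sqrt (by linarith)
      have : √((N : ℝ) + 1) - √(N : ℝ) ≤ (√((N : ℝ) + 1))⁻¹ := by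
        rw [← one_div, le_div_iff₀ p]
        nlinarith [Real.sqrt_nonneg (N : ℝ)]
      linarith
  have hinf : Tendsto (fun N : ℕ => ∑ n ∈ Finset.range N, ((n : ℝ) + 1) ^ (-(1 / 2 : ℝ)))
      atTop atTop :=
    tendsto_atTop_mono hsum_ge (Real.tendsto_sqrt_atTop.comp tendsto_natCast_atTop_atTop)
  have hlo : (fun n : ℕ => ((n : ℝ) + 1) ^ (-β)) =o[atTop]
      fun n : ℕ => ((n : ℝ) + 1) ^ (-(1 / 2 : ℝ)) := by
    rw [Asymptotics.isLittleO_iff_tendsto' (Eventually.of_forall fun n h =>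
      absurd h (Real.rpow_pos_of_pos (by positivity) _).ne')]
    refine (tendsto_succ_rpow_neg (p := β - 1 / 2) (by linarith)).congr fun n => ?_
    rw [← Real.rpow_sub (by positivity)]
    ring_nf
  have h := hlo.sum_range hg0 hinf
  have hO : (fun N : ℕ => ∑ n ∈ Finset.range N, ((n : ℝ) + 1) ^ (-(1 / 2 : ℝ))) =O[atTop]
      fun N : ℕ => √(N : ℝ) :=
    Asymptotics.IsBigO.of_bound 2 (Eventually.of_forall fun N => by
      rw [Real.norm_of_nonneg (Finset.sum_nonneg fun n _ => hg0 n),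
        Real.norm_of_nonneg (Real.sqrt_nonneg _)]
      exact hsum_le N)
  exact (h.trans_isBigO hO).tendsto_div_nhds_zero

end Sequences

/-! ### Adaptedness, independence from the past, and orthogonality of increments. -/

section Independence

variable {Ω E F S : Type*} [MeasurableSpace E] [MeasurableSpace F] [MeasurableSpace S]

/-- The initial value together with the first `n` terms of a sequence. -/
def past (Y : Ω → E) (Z : ℕ → Ω → F) (n : ℕ) (ω : Ω) : E × (Fin n → F) :=
  (Y ω, fun i => Z i ω)

lemma comap_past_mono (Y : Ω → E) (Z : ℕ → Ω → F) (n : ℕ) :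
    MeasurableSpace.comap (past Y Z n) inferInstance
      ≤ MeasurableSpace.comap (past Y Z (n + 1)) inferInstance := by
  have : past Y Z n = (fun p : E × (Fin (n + 1) → F) => (p.1, fun i : Fin n => p.2 i.castSucc)) ∘
      past Y Z (n + 1) := rfl
  rw [this, ← MeasurableSpace.comap_comp]
  refine MeasurableSpace.comap_mono (Measurable.comap_le ?_)
  fun_prop

lemma measurable_comap_past_init (Y : Ω → E) (Z : ℕ → Ω → F) (n : ℕ) :
    Measurable[MeasurableSpace.comap (past Y Z n) inferInstance] Y :=
  measurable_fst.comp (comap_measurable (past Y Z n))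

lemma measurable_comap_past_succ (Y : Ω → E) (Z : ℕ → Ω → F) (n : ℕ) :
    Measurable[MeasurableSpace.comap (past Y Z (n + 1)) inferInstance] (Z n) := by
  have h : Measurable fun p : E × (Fin (n + 1) → F) => p.2 (Fin.last n) := by fun_prop
  exact h.comp (comap_measurable (past Y Z (n + 1)))

variable [MeasurableSpace Ω] {P : Measure Ω}

lemma measurable_past {Y : Ω → E} {Z : ℕ → Ω → F} (hY : Measurable Y)
    (hZ : ∀ k, Measurable (Z k)) (n : ℕ) : Measurable (past Y Z n) :=
  hY.prodMk (measurable_pi_lambda _ fun i => hZ i)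

/-- The three-fold independence of `Y`, the earlier terms and the current term is assembled from two
pairwise ones by writing the laws as product measures and reassociating the product. -/
lemma indepFun_past [IsProbabilityMeasure P] {Y : Ω → E} {Z : ℕ → Ω → F} (hY : Measurable Y)
    (hZ : ∀ k, Measurable (Z k)) (hind : iIndepFun Z P)
    (hYZ : IndepFun Y (fun ω k => Z k ω) P) (n : ℕ) : IndepFun (past Y Z n) (Z n) P := by
  set A : Ω → Fin n → F := fun ω i => Z i ω with hA
  have hAm : Measurable A := measurable_pi_lambda _ fun i => hZ i
  have hAB : IndepFun A (Z n) P := by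
    have h := hind.indepFun_finset (Finset.range n) {n} (by simp) hZ
    have hlast : Measurable fun g : ({n} : Finset ℕ) → F => g ⟨n, Finset.mem_singleton_self n⟩ :=
      measurable_pi_apply _
    exact h.comp
      (φ := fun g (i : Fin n) => g ⟨i, Finset.mem_range.2 i.2⟩) (by fun_prop) hlast
  have hYAB : IndepFun Y (fun ω => (A ω, Z n ω)) P :=
    hYZ.comp (φ := id) (ψ := fun g : ℕ → F => ((fun i : Fin n => g i), g n)) measurable_id
      (by fun_prop)
  have hYA : IndepFun Y A P := hYAB.comp measurable_id measurable_fst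
  have e1 := (indepFun_iff_map_prod_eq_prod_map_map hY.aemeasurable
    (hAm.prodMk (hZ n)).aemeasurable).1 hYAB
  have e2 := (indepFun_iff_map_prod_eq_prod_map_map hAm.aemeasurable (hZ n).aemeasurable).1 hAB
  have e3 := (indepFun_iff_map_prod_eq_prod_map_map hY.aemeasurable hAm.aemeasurable).1 hYA
  rw [indepFun_iff_map_prod_eq_prod_map_map (measurable_past hY hZ n).aemeasurable
    (hZ n).aemeasurable]
  have := Measure.isProbabilityMeasure_map hY.aemeasurable (μ := P)
  have := Measure.isProbabilityMeasure_map hAm.aemeasurable (μ := P)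
  have := Measure.isProbabilityMeasure_map (hZ n).aemeasurable (μ := P)
  have e4 : P.map (past Y Z n) = (P.map Y).prod (P.map A) := e3
  have hm : Measurable fun ω => (past Y Z n ω, Z n ω) := (measurable_past hY hZ n).prodMk (hZ n)
  apply (MeasurableEquiv.prodAssoc (α := E) (β := Fin n → F) (γ := F)).map_measurableEquiv_injective
  rw [e4, Measure.prodAssoc_prod, Measure.map_map (MeasurableEquiv.measurable _) hm, ← e2, ← e1]
  rfl

lemma indepFun_of_past {Y : Ω → E} {Z : ℕ → Ω → F} {n : ℕ} (h : IndepFun (past Y Z n) (Z n) P)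
    {T : Ω → S} (hT : Measurable[MeasurableSpace.comap (past Y Z n) inferInstance] T) :
    IndepFun T (Z n) P := by
  rw [IndepFun_iff_Indep] at h ⊢
  exact indep_of_indep_of_le_left h hT.comap_le

lemma integrable_prod_of_indepFun [IsProbabilityMeasure P] {T : Ω → E} {X : Ω → F}
    (hT : Measurable T) (hX : Measurable X) (h : IndepFun T X P) {G : E × F → ℝ}
    (hG : Measurable G) (hint : Integrable (fun ω => G (T ω, X ω)) P) :
    Integrable G ((P.map T).prod (P.map X)) := by
  rw [← (indepFun_iff_map_prod_eq_prod_map_map hT.aemeasurable hX.aemeasurable).1 h]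
  exact (integrable_map_measure hG.aestronglyMeasurable (hT.prodMk hX).aemeasurable).2 hint

/-- Integration of a function of two independent variables, one variable after the other. -/
lemma integral_eq_integral_integral_of_indepFun [IsProbabilityMeasure P] {T : Ω → E} {X : Ω → F}
    (hT : Measurable T) (hX : Measurable X) (h : IndepFun T X P) {G : E × F → ℝ}
    (hG : Measurable G) (hint : Integrable (fun ω => G (T ω, X ω)) P) :
    ∫ ω, G (T ω, X ω) ∂P = ∫ ω, ∫ x, G (T ω, x) ∂(P.map X) ∂P := by
  have := Measure.isProbabilityMeasure_map hT.aemeasurable (μ := P)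
  have := Measure.isProbabilityMeasure_map hX.aemeasurable (μ := P)
  have hi := integrable_prod_of_indepFun hT hX h hG hint
  have e : ∫ ω, G (T ω, X ω) ∂P = ∫ p, G p ∂(P.map fun ω => (T ω, X ω)) :=
    (integral_map (hT.prodMk hX).aemeasurable hG.aestronglyMeasurable).symm
  rw [e, (indepFun_iff_map_prod_eq_prod_map_map hT.aemeasurable hX.aemeasurable).1 h,
    integral_prod G hi, integral_map hT.aemeasurable]
  exact hi.integral_prod_left.aestronglyMeasurable

lemma integrable_integral_of_indepFun [IsProbabilityMeasure P] {T : Ω → E} {X : Ω → F}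
    (hT : Measurable T) (hX : Measurable X) (h : IndepFun T X P) {G : E × F → ℝ}
    (hG : Measurable G) (hint : Integrable (fun ω => G (T ω, X ω)) P) :
    Integrable (fun ω => ∫ x, G (T ω, x) ∂(P.map X)) P := by
  have := Measure.isProbabilityMeasure_map hT.aemeasurable (μ := P)
  have := Measure.isProbabilityMeasure_map hX.aemeasurable (μ := P)
  have hi := (integrable_prod_of_indepFun hT hX h hG hint).integral_prod_left
  exact (integrable_map_measure hi.aestronglyMeasurable hT.aemeasurable).1 hi

/-- Nonnegativity of the variance of `|f|`. -/
lemma integral_abs_le_sqrt [IsProbabilityMeasure P] {f : Ω → ℝ} (hf : MemLp f 2 P) :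
    ∫ ω, |f ω| ∂P ≤ √(∫ ω, f ω ^ 2 ∂P) := by
  have hv := variance_nonneg (fun ω => |f ω|) P
  have hf' : MemLp (fun ω => |f ω|) 2 P := hf.abs
  rw [variance_eq_sub hf'] at hv
  have e : ∫ ω, ((fun ω => |f ω|) ^ 2) ω ∂P = ∫ ω, f ω ^ 2 ∂P := by simp
  rw [e] at hv
  exact Real.le_sqrt_of_sq_le (by linarith)

/-- The square of a sum of martingale increments `ψ (T n, Z n)`, where `T n` depends only on the
past and `ψ (t, ·)` is centered for all `t`. -/
lemma integral_sq_sum_range [IsProbabilityMeasure P] {Y : Ω → E} {Z : ℕ → Ω → F}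
    (hY : Measurable Y) (hZ : ∀ k, Measurable (Z k)) (hind : ∀ n, IndepFun (past Y Z n) (Z n) P)
    {T : ℕ → Ω → S} (hT : ∀ n, Measurable[MeasurableSpace.comap (past Y Z n) inferInstance] (T n))
    {ψ : S × F → ℝ} (hψ : Measurable ψ) (hψ0 : ∀ n t, ∫ z, ψ (t, z) ∂(P.map (Z n)) = 0)
    (hψ2 : ∀ n, MemLp (fun ω => ψ (T n ω, Z n ω)) 2 P) (N : ℕ) :
    ∫ ω, (∑ n ∈ Finset.range N, ψ (T n ω, Z n ω)) ^ 2 ∂P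
      = ∑ n ∈ Finset.range N, ∫ ω, ψ (T n ω, Z n ω) ^ 2 ∂P := by
  have hTm : ∀ n, Measurable (T n) := fun n => (hT n).mono (measurable_past hY hZ n).comap_le le_rfl
  have hS : ∀ N, Measurable[MeasurableSpace.comap (past Y Z N) inferInstance]
      fun ω => ∑ n ∈ Finset.range N, ψ (T n ω, Z n ω) := by
    intro N
    induction N with
    | zero => simp
    | succ N ih =>
      simp_rw [Finset.sum_range_succ]
      refine (ih.mono (comap_past_mono Y Z N) le_rfl).add (hψ.comp ?_)
      exact ((hT N).mono (comap_past_mono Y Z N) le_rfl).prodMk (measurable_comap_past_succ Y Z N)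
  have hS2 : ∀ N, MemLp (fun ω => ∑ n ∈ Finset.range N, ψ (T n ω, Z n ω)) 2 P := fun N =>
    memLp_finsetSum _ fun n _ => hψ2 n
  induction N with
  | zero => simp
  | succ N ih =>
    set s : Ω → ℝ := fun ω => ∑ n ∈ Finset.range N, ψ (T n ω, Z n ω) with hs
    have hcross_int : Integrable (fun ω => s ω * ψ (T N ω, Z N ω)) P :=
      (hS2 N).integrable_mul (hψ2 N)
    -- The partial sum and `T N` are both functions of the past. With the pair frozen, integrating
    -- out `Z N` kills the cross term.
    have hcross : ∫ ω, s ω * ψ (T N ω, Z N ω) ∂P = 0 := by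
      have hm : Measurable[MeasurableSpace.comap (past Y Z N) inferInstance]
          fun ω => (s ω, T N ω) := (hS N).prodMk (hT N)
      have h := integral_eq_integral_integral_of_indepFun
        (hm.mono (measurable_past hY hZ N).comap_le le_rfl) (hZ N)
        (indepFun_of_past (hind N) hm) (G := fun p : (ℝ × S) × F => p.1.1 * ψ (p.1.2, p.2))
        (by fun_prop) hcross_int
      rw [h]
      simp [integral_const_mul, hψ0]
    have e : ∀ ω, (∑ n ∈ Finset.range (N + 1), ψ (T n ω, Z n ω)) ^ 2
        = s ω ^ 2 + 2 * (s ω * ψ (T N ω, Z N ω)) + ψ (T N ω, Z N ω) ^ 2 := by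
      intro ω
      rw [Finset.sum_range_succ]
      ring
    simp_rw [e]
    have hI : Integrable (fun ω => s ω ^ 2 + 2 * (s ω * ψ (T N ω, Z N ω))) P :=
      (hS2 N).integrable_sq.add (hcross_int.const_mul 2)
    rw [integral_add hI (hψ2 N).integrable_sq,
      integral_add (hS2 N).integrable_sq (hcross_int.const_mul 2), integral_const_mul, hcross,
      Finset.sum_range_succ, ih]
    ring

end Independence

/-! ### Conditionally centered sums in `L¹`. -/

section Centered

variable {Ω E F S : Type*} [MeasurableSpace Ω] [MeasurableSpace E] [MeasurableSpace F]
  [MeasurableSpace S] {P : Measure Ω}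

lemma integral_sub_add {f g h : Ω → ℝ} (hf : Integrable f P) (hg : Integrable g P)
    (hh : Integrable h P) :
    ∫ ω, (f ω - g ω + h ω) ∂P = ∫ ω, f ω ∂P - ∫ ω, g ω ∂P + ∫ ω, h ω ∂P := by
  have hfg : Integrable (fun ω => f ω - g ω) P := hf.sub hg
  rw [integral_add hfg hh, integral_sub hf hg]

/-- `L¹` bound for a sum of martingale increments obtained by centering `k (T n, Z n)`
conditionally on the past. -/
lemma integral_abs_sum_centered_le [IsProbabilityMeasure P] {Y : Ω → E} {Z : ℕ → Ω → F}
    {μ : Measure F} [IsProbabilityMeasure μ]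
    (hY : Measurable Y) (hZ : ∀ k, Measurable (Z k)) (hind : ∀ n, IndepFun (past Y Z n) (Z n) P)
    (hlaw : ∀ n, P.map (Z n) = μ)
    {T : ℕ → Ω → S} (hT : ∀ n, Measurable[MeasurableSpace.comap (past Y Z n) inferInstance] (T n))
    {k : S × F → ℝ} (hk : Measurable k) {b v : S → ℝ} (hb : ∀ t z, |k (t, z)| ≤ b t)
    (hb2 : ∀ n, MemLp (fun ω => b (T n ω)) 2 P) (hv : ∀ t, ∫ z, k (t, z) ^ 2 ∂μ ≤ v t)
    (hvi : ∀ n, Integrable (fun ω => v (T n ω)) P) (N : ℕ) :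
    ∫ ω, |∑ n ∈ Finset.range N, (k (T n ω, Z n ω) - ∫ z, k (T n ω, z) ∂μ)| ∂P
      ≤ √(∑ n ∈ Finset.range N, ∫ ω, v (T n ω) ∂P) := by
  have hTm : ∀ n, Measurable (T n) := fun n => (hT n).mono (measurable_past hY hZ n).comap_le le_rfl
  set m : S → ℝ := fun t => ∫ z, k (t, z) ∂μ with hm
  have hmm : Measurable m := (hk.stronglyMeasurable.integral_prod_right' (ν := μ)).measurable
  have hkt : ∀ t, Measurable fun z => k (t, z) := fun t => hk.comp measurable_prodMk_left
  have hkt2 : ∀ t, MemLp (fun z => k (t, z)) 2 μ := fun t =>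
    MemLp.of_bound (hkt t).aestronglyMeasurable (b t)
      (Eventually.of_forall fun z => by simpa using hb t z)
  have hmb : ∀ t, |m t| ≤ b t := fun t => by
    have h := norm_integral_le_of_norm_le_const (μ := μ) (f := fun z => k (t, z)) (C := b t)
      (Eventually.of_forall fun z => by simpa using hb t z)
    simpa using h
  set ψ : S × F → ℝ := fun p => k p - m p.1 with hψ
  have hψm : Measurable ψ := hk.sub (hmm.comp measurable_fst)
  have hψ0 : ∀ n t, ∫ z, ψ (t, z) ∂(P.map (Z n)) = 0 := fun n t => by
    rw [hlaw n]
    simp only [hψ]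
    rw [integral_sub ((hkt2 t).integrable one_le_two) (integrable_const _)]
    simp [hm]
  have hψ2 : ∀ n, MemLp (fun ω => ψ (T n ω, Z n ω)) 2 P := fun n => by
    refine ((hb2 n).const_mul 2).mono
      (hψm.comp ((hTm n).prodMk (hZ n))).aestronglyMeasurable (Eventually.of_forall fun ω => ?_)
    have h1 := hb (T n ω) (Z n ω)
    have h2 := hmb (T n ω)
    rw [Real.norm_eq_abs, Real.norm_eq_abs]
    calc |ψ (T n ω, Z n ω)| ≤ |k (T n ω, Z n ω)| + |m (T n ω)| := abs_sub _ _
      _ ≤ 2 * b (T n ω) := by linarith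
      _ ≤ _ := le_abs_self _
  have hS2 : MemLp (fun ω => ∑ n ∈ Finset.range N, ψ (T n ω, Z n ω)) 2 P :=
    memLp_finsetSum _ fun n _ => hψ2 n
  refine (integral_abs_le_sqrt hS2).trans (Real.sqrt_le_sqrt ?_)
  rw [integral_sq_sum_range hY hZ hind hT hψm hψ0 hψ2 N]
  refine Finset.sum_le_sum fun n _ => ?_
  have hi : Integrable (fun ω => ψ (T n ω, Z n ω) ^ 2) P := (hψ2 n).integrable_sq
  have hindT := indepFun_of_past (hind n) (hT n)
  rw [integral_eq_integral_integral_of_indepFun (hTm n) (hZ n) hindT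
    (G := fun p => ψ p ^ 2) (hψm.pow_const 2) hi]
  refine integral_mono (integrable_integral_of_indepFun (hTm n) (hZ n) hindT
    (G := fun p => ψ p ^ 2) (hψm.pow_const 2) hi) (hvi n) fun ω => ?_
  -- For frozen `T n`, the increment is centered under `μ`, so its second moment is a variance and
  -- is at most the uncentered second moment.
  refine le_trans ?_ (hv (T n ω))
  have h := variance_le_expectation_sq (μ := μ) (X := fun z => k (T n ω, z))
    (hkt _).aestronglyMeasurable
  rw [variance_eq_integral (hkt _).aemeasurable] at h
  simpa [hlaw n, hψ, hm] using h

end Centered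

/-! ### Convexity of the shortfall loss and the mean field. -/

section Innovation

variable {α : ℝ}

/-- The convex function of `ξ` whose expectation is the objective. -/
def shortfallLoss (α ξ x : ℝ) : ℝ := ξ + 1 / (1 - α) * max (x - ξ) 0

/-- The mean field of the value-at-risk recursion. -/
def drift (μ : Measure ℝ) (α ξ : ℝ) : ℝ := ∫ x, H₁ α ξ x ∂μ

lemma measurable_H₁ (α : ℝ) : Measurable fun p : ℝ × ℝ => H₁ α p.1 p.2 := by
  unfold H₁
  refine measurable_const.sub (measurable_const.mul ?_)
  exact Measurable.ite (measurableSet_le measurable_fst measurable_snd) measurable_const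
    measurable_const

lemma measurable_H₁_right (α ξ : ℝ) : Measurable (H₁ α ξ) :=
  (measurable_H₁ α).comp measurable_prodMk_left

lemma measurable_shortfallLoss (α : ℝ) :
    Measurable fun p : ℝ × ℝ => shortfallLoss α p.1 p.2 := by
  unfold shortfallLoss
  fun_prop

lemma abs_H₁_le (hα : α ∈ Set.Ioo (0 : ℝ) 1) (ξ x : ℝ) : |H₁ α ξ x| ≤ 1 / (1 - α) := by
  have h1 : 0 < 1 - α := by linarith [hα.2]
  have h2 : 1 ≤ 1 / (1 - α) := by rw [le_div_iff₀ h1]; linarith [hα.1]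
  unfold H₁
  split_ifs <;> rw [abs_le] <;> constructor <;> linarith

lemma integrable_H₁ (hα : α ∈ Set.Ioo (0 : ℝ) 1) (μ : Measure ℝ) [IsFiniteMeasure μ] (ξ : ℝ) :
    Integrable (H₁ α ξ) μ :=
  Integrable.of_bound (measurable_H₁_right α ξ).aestronglyMeasurable (1 / (1 - α))
    (Eventually.of_forall fun x => by simpa using abs_H₁_le hα ξ x)

/-- `H₁ (ξ, x)` is a subgradient of `shortfallLoss (·, x)` at `ξ`. -/
lemma H₁_mul_le_shortfallLoss_sub (hα : α ∈ Set.Ioo (0 : ℝ) 1) (θ ξ x : ℝ) :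
    H₁ α θ x * (ξ - θ) ≤ shortfallLoss α ξ x - shortfallLoss α θ x := by
  have h1 : 0 < 1 / (1 - α) := one_div_pos.2 (by linarith [hα.2])
  unfold H₁ shortfallLoss
  split_ifs with h
  · rw [max_eq_left (a := x - θ) (by linarith)]
    nlinarith [le_max_left (x - ξ) 0]
  · rw [max_eq_right (a := x - θ) (by linarith)]
    nlinarith [le_max_right (x - ξ) 0]

/-- The subgradient inequality taken at each of the two points bounds the increment from below and
from above, and subgradients are bounded by `1 / (1 - α)`. -/
lemma abs_shortfallLoss_sub_le (hα : α ∈ Set.Ioo (0 : ℝ) 1) (ξ θ x : ℝ) :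
    |shortfallLoss α ξ x - shortfallLoss α θ x| ≤ 1 / (1 - α) * |ξ - θ| := by
  have h1 := H₁_mul_le_shortfallLoss_sub hα θ ξ x
  have h2 := H₁_mul_le_shortfallLoss_sub hα ξ θ x
  have b1 : |H₁ α θ x * (ξ - θ)| ≤ 1 / (1 - α) * |ξ - θ| := by
    rw [abs_mul]; gcongr; exact abs_H₁_le hα θ x
  have b2 : |H₁ α ξ x * (θ - ξ)| ≤ 1 / (1 - α) * |ξ - θ| := by
    rw [abs_mul, abs_sub_comm θ ξ]; gcongr; exact abs_H₁_le hα ξ x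
  rw [abs_le] at b1 b2 ⊢
  constructor <;> linarith [b1.1, b2.1]

lemma integrable_shortfallLoss {μ : Measure ℝ} [IsFiniteMeasure μ] (hμ : Integrable id μ)
    (ξ : ℝ) : Integrable (shortfallLoss α ξ) μ := by
  have h : Integrable (fun x : ℝ => max (x - ξ) 0) μ := (hμ.sub (integrable_const ξ)).pos_part
  exact (integrable_const ξ).add (h.const_mul _)

/-- The mean field is a subgradient of the objective. A zero of it is therefore a minimizer, and
using the inequality at both points bounds the excess of the objective over its minimum
quadratically. -/
lemma drift_mul_le (hα : α ∈ Set.Ioo (0 : ℝ) 1) {μ : Measure ℝ} [IsProbabilityMeasure μ]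
    (hμ : Integrable id μ) (θ ξ : ℝ) :
    drift μ α θ * (ξ - θ) ≤ ∫ x, shortfallLoss α ξ x ∂μ - ∫ x, shortfallLoss α θ x ∂μ := by
  rw [← integral_sub (integrable_shortfallLoss hμ ξ) (integrable_shortfallLoss hμ θ), drift,
    ← integral_mul_const]
  exact integral_mono ((integrable_H₁ hα μ θ).mul_const _)
    ((integrable_shortfallLoss hμ ξ).sub (integrable_shortfallLoss hμ θ))
    fun x => H₁_mul_le_shortfallLoss_sub hα θ ξ x

/-- Quantitative regularity of the law `μ` near its quantile `θ`; `a` is the derivative of the mean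
field at `θ`. -/
structure RegularQuantile (μ : Measure ℝ) (α θ a c C L : ℝ) : Prop where
  integrable_id : Integrable id μ
  restoring : ∀ d, c * min |d| 1 * |d| ≤ d * drift μ α (θ + d)
  linearization : ∀ ξ, |drift μ α ξ - a * (ξ - θ)| ≤ L * (ξ - θ) ^ 2
  integral_sq_sub_le : ∀ ξ, ∫ x, (H₁ α ξ x - H₁ α θ x) ^ 2 ∂μ ≤ C * |ξ - θ|
  abs_drift_le : ∀ ξ, |drift μ α ξ| ≤ C * |ξ - θ|

lemma RegularQuantile.drift_eq_zero {μ : Measure ℝ} {θ a c C L : ℝ}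
    (h : RegularQuantile μ α θ a c C L) : drift μ α θ = 0 := by
  have := h.abs_drift_le θ
  simpa using this

end Innovation

/-! ### The Lyapunov recursion at a fixed bias level. -/

section Level

variable {Ω : Type*} [MeasurableSpace Ω] {P : Measure Ω} {α θ a c C L : ℝ}
  {μ : Measure ℝ} {γ : ℕ → ℝ} {ξ₀ : Ω → ℝ} {X : ℕ → Ω → ℝ}

omit [MeasurableSpace Ω] in
lemma measurable_comap_varIterate (α : ℝ) (γ : ℕ → ℝ) (ξ₀ : Ω → ℝ) (X : ℕ → Ω → ℝ) (n : ℕ) :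
    Measurable[MeasurableSpace.comap (past ξ₀ X n) inferInstance] (varIterate α γ ξ₀ X n) := by
  induction n with
  | zero => exact measurable_comap_past_init ξ₀ X 0
  | succ n ih =>
    have h := ih.mono (comap_past_mono ξ₀ X n) le_rfl
    have hH := (measurable_H₁ α).comp (h.prodMk (measurable_comap_past_succ ξ₀ X n))
    exact h.sub (measurable_const.mul hH)

lemma measurable_varIterate (hξ₀ : Measurable ξ₀) (hX : ∀ n, Measurable (X n)) (n : ℕ) :
    Measurable (varIterate α γ ξ₀ X n) :=
  (measurable_comap_varIterate α γ ξ₀ X n).mono (measurable_past hξ₀ hX n).comap_le le_rfl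

/-- The increments of the iterates are bounded, so each step multiplies the hyperbolic cosine by at
most a deterministic constant. -/
lemma integrable_cosh_varIterate [IsProbabilityMeasure P] (hα : α ∈ Set.Ioo (0 : ℝ) 1)
    (hξ₀ : Measurable ξ₀) (hX : ∀ n, Measurable (X n)) {lam : ℝ}
    (h0 : Integrable (fun ω => Real.cosh (lam * (ξ₀ ω - θ))) P) (n : ℕ) :
    Integrable (fun ω => Real.cosh (lam * (varIterate α γ ξ₀ X n ω - θ))) P := by
  induction n with
  | zero => exact h0
  | succ n ih =>
    refine (ih.mul_const (Real.exp (|lam * γ (n + 1)| * (1 / (1 - α))))).mono'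
      (Real.measurable_cosh.comp
        (((measurable_varIterate hξ₀ hX (n + 1)).sub_const θ).const_mul lam)).aestronglyMeasurable
      (Eventually.of_forall fun ω => ?_)
    rw [Real.norm_of_nonneg (Real.cosh_pos _).le]
    have e : lam * (varIterate α γ ξ₀ X (n + 1) ω - θ)
        = lam * (varIterate α γ ξ₀ X n ω - θ)
          + -(lam * γ (n + 1) * H₁ α (varIterate α γ ξ₀ X n ω) (X n ω)) := by
      simp only [varIterate]; ring
    rw [e]
    refine (cosh_add_le_mul_exp _ _).trans ?_
    have := Real.cosh_pos (lam * (varIterate α γ ξ₀ X n ω - θ))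
    gcongr
    rw [abs_neg, abs_mul]
    gcongr
    exact abs_H₁_le hα _ _

/-- One step of the Lyapunov recursion for the function `cosh (lam (ξ - θ)) - 1`. -/
lemma integral_cosh_sub_one_succ_le [IsProbabilityMeasure P] [IsProbabilityMeasure μ]
    (hα : α ∈ Set.Ioo (0 : ℝ) 1) (hμ : RegularQuantile μ α θ a c C L) (hc : 0 ≤ c)
    (hξ₀ : Measurable ξ₀) (hX : ∀ n, Measurable (X n)) (hlaw : ∀ n, P.map (X n) = μ)
    (hind : ∀ n, IndepFun (past ξ₀ X n) (X n) P) {lam γmax : ℝ} (hlam0 : 0 < lam) (hlam1 : lam ≤ 1)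
    (hγ0 : ∀ n, 0 ≤ γ (n + 1)) (hγ1 : ∀ n, γ (n + 1) ≤ γmax)
    (h0 : Integrable (fun ω => Real.cosh (lam * (ξ₀ ω - θ))) P) (n : ℕ) :
    ∫ ω, (Real.cosh (lam * (varIterate α γ ξ₀ X (n + 1) ω - θ)) - 1) ∂P
      ≤ ∫ ω, (Real.cosh (lam * (varIterate α γ ξ₀ X n ω - θ)) - 1) ∂P
        - lam * c * γ (n + 1) *
          ∫ ω, (Real.cosh (lam * (varIterate α γ ξ₀ X n ω - θ)) - 1) ∂P
        + (lam * (1 / (1 - α))) ^ 2 * Real.exp (lam * γmax * (1 / (1 - α))) * γ (n + 1) ^ 2 *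
          (1 + ∫ ω, (Real.cosh (lam * (varIterate α γ ξ₀ X n ω - θ)) - 1) ∂P) := by
  set B : ℝ := 1 / (1 - α) with hB
  have hB0 : 0 < B := one_div_pos.2 (by linarith [hα.2])
  set g := γ (n + 1) with hg
  have hg0 : 0 ≤ g := hγ0 n
  set K : ℝ := (lam * B) ^ 2 * Real.exp (lam * γmax * B) with hK
  set ξ := varIterate α γ ξ₀ X n with hξ
  have hξm : Measurable ξ := measurable_varIterate hξ₀ hX n
  have hcn : Integrable (fun ω => Real.cosh (lam * (ξ ω - θ))) P :=
    integrable_cosh_varIterate hα hξ₀ hX h0 n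
  have hcn1 : Integrable (fun ω => Real.cosh (lam * (varIterate α γ ξ₀ X (n + 1) ω - θ))) P :=
    integrable_cosh_varIterate hα hξ₀ hX h0 (n + 1)
  set G : ℝ × ℝ → ℝ := fun p => Real.cosh (lam * (p.1 - θ) - lam * g * H₁ α p.1 p.2) with hG
  have hGm : Measurable G := Real.measurable_cosh.comp
    ((((measurable_fst.sub_const θ).const_mul lam)).sub ((measurable_H₁ α).const_mul (lam * g)))
  have e1 : ∀ ω, Real.cosh (lam * (varIterate α γ ξ₀ X (n + 1) ω - θ)) = G (ξ ω, X n ω) := by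
    intro ω
    simp only [hG, varIterate, ← hg, ← hξ]
    ring_nf
  simp_rw [e1] at hcn1 ⊢
  have hindξ : IndepFun ξ (X n) P :=
    indepFun_of_past (hind n) (measurable_comap_varIterate α γ ξ₀ X n)
  -- Second-order expansion in the step. Bounding the exponential factor with `γmax` in place of the
  -- current step makes the constant `K` independent of `n`.
  have hpt : ∀ x y, G (x, y) ≤ Real.cosh (lam * (x - θ))
      - lam * g * Real.sinh (lam * (x - θ)) * H₁ α x y + K * g ^ 2 * Real.cosh (lam * (x - θ)) := by
    intro x y
    have h := cosh_sub_le (lam * (x - θ)) (lam * g * H₁ α x y)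
    have hH := abs_H₁_le hα x y
    have habs : |lam * g * H₁ α x y| ≤ lam * g * B := by
      rw [abs_mul, abs_of_nonneg (by positivity : 0 ≤ lam * g)]
      gcongr
    have h1 : (lam * g * H₁ α x y) ^ 2 ≤ (lam * g * B) ^ 2 :=
      sq_le_sq' (by linarith [(abs_le.1 habs).1]) (abs_le.1 habs).2
    have h2 : Real.exp |lam * g * H₁ α x y| ≤ Real.exp (lam * γmax * B) := by
      refine Real.exp_le_exp.2 (habs.trans ?_)
      have := hγ1 n
      gcongr
    have h3 : (lam * g * H₁ α x y) ^ 2 * Real.exp |lam * g * H₁ α x y|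
        * Real.cosh (lam * (x - θ)) ≤ K * g ^ 2 * Real.cosh (lam * (x - θ)) := by
      have := (Real.cosh_pos (lam * (x - θ))).le
      have e : K * g ^ 2 = (lam * g * B) ^ 2 * Real.exp (lam * γmax * B) := by rw [hK]; ring
      rw [e]
      gcongr
    simp only [hG]
    linarith
  have hinner : ∀ x, ∫ y, G (x, y) ∂μ ≤ Real.cosh (lam * (x - θ))
      - lam * c * g * (Real.cosh (lam * (x - θ)) - 1) + K * g ^ 2 * Real.cosh (lam * (x - θ)) := by
    intro x
    have hHi := integrable_H₁ hα μ x
    have hi : Integrable (fun y => Real.cosh (lam * (x - θ))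
        - lam * g * Real.sinh (lam * (x - θ)) * H₁ α x y
        + K * g ^ 2 * Real.cosh (lam * (x - θ))) μ :=
      ((integrable_const _).sub (hHi.const_mul _)).add (integrable_const _)
    have hle := integral_mono_of_nonneg (μ := μ) (f := fun y => G (x, y))
      (Eventually.of_forall fun y => (Real.cosh_pos _).le) hi (Eventually.of_forall (hpt x))
    refine hle.trans ?_
    rw [integral_sub_add (integrable_const _) (hHi.const_mul _) (integrable_const _),
      integral_const_mul]
    simp only [integral_const, probReal_univ, one_smul]
    -- Averaging over the innovation turns the first-order term into `sinh` times the mean field,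
    -- and the restoring force converts this into a multiple of the Lyapunov function.
    have hr := hμ.restoring (x - θ)
    rw [add_sub_cancel] at hr
    have hm := mul_cosh_sub_one_le_sinh_mul hlam0 hlam1 hc hr
    have hm' := mul_le_mul_of_nonneg_left hm (mul_nonneg hlam0.le hg0)
    simp only [drift] at hm'
    linarith
  have hGint := integral_eq_integral_integral_of_indepFun hξm (hX n) hindξ hGm hcn1
  have hGii := integrable_integral_of_indepFun hξm (hX n) hindξ hGm hcn1
  rw [hlaw n] at hGint hGii
  have hfin : ∫ ω, G (ξ ω, X n ω) ∂P ≤ ∫ ω, (Real.cosh (lam * (ξ ω - θ))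
      - lam * c * g * (Real.cosh (lam * (ξ ω - θ)) - 1)
      + K * g ^ 2 * Real.cosh (lam * (ξ ω - θ))) ∂P := by
    rw [hGint]
    refine integral_mono hGii ?_ fun ω => hinner (ξ ω)
    exact (hcn.sub ((hcn.sub (integrable_const 1)).const_mul _)).add (hcn.const_mul _)
  have hcn' : Integrable (fun ω => Real.cosh (lam * (ξ ω - θ)) - 1) P :=
    hcn.sub (integrable_const 1)
  rw [integral_sub_add hcn (hcn'.const_mul _) (hcn.const_mul _), integral_const_mul,
    integral_const_mul, integral_sub hcn (integrable_const 1)] at hfin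
  rw [integral_sub hcn1 (integrable_const 1), integral_sub hcn (integrable_const 1)]
  simp only [integral_const, probReal_univ, one_smul] at hfin ⊢
  linarith

lemma integrable_sq_of_integrable_cosh {lam : ℝ} (hlam : 0 < lam) {f : Ω → ℝ} (hf : Measurable f)
    (h : Integrable (fun ω => Real.cosh (lam * f ω)) P) [IsProbabilityMeasure P] :
    MemLp f 2 P ∧ ∫ ω, f ω ^ 2 ∂P ≤ 2 / lam ^ 2 * ∫ ω, (Real.cosh (lam * f ω) - 1) ∂P := by
  have hi : Integrable (fun ω => 2 / lam ^ 2 * (Real.cosh (lam * f ω) - 1)) P :=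
    (h.sub (integrable_const 1)).const_mul _
  have hle : ∀ ω, f ω ^ 2 ≤ 2 / lam ^ 2 * (Real.cosh (lam * f ω) - 1) := fun ω => by
    have := sq_div_two_le_cosh_sub_one (lam * f ω)
    have h2 := mul_le_mul_of_nonneg_left this (by positivity : 0 ≤ 2 / lam ^ 2)
    refine le_trans (le_of_eq ?_) h2
    field_simp
  have hsq : Integrable (fun ω => f ω ^ 2) P :=
    hi.mono' (hf.pow_const 2).aestronglyMeasurable
      (Eventually.of_forall fun ω => by rw [Real.norm_of_nonneg (sq_nonneg _)]; exact hle ω)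
  refine ⟨(memLp_two_iff_integrable_sq hf.aestronglyMeasurable).2 hsq, ?_⟩
  rw [← integral_const_mul]
  exact integral_mono hsq hi hle

end Level

/-! ### Error bounds and their size relative to `√N`. -/

/-- Bound for the error of the linearization of the averaged value-at-risk recursion. -/
def varErrorBound (A C L M γ₁ β : ℝ) (N : ℕ) : ℝ :=
  2 * A * √M + √M / γ₁ * (1 + 3 * ((N : ℝ) + 1) ^ (β / 2))
    + √(C * √M * ∑ n ∈ Finset.range N, ((n : ℝ) + 1) ^ (-(β / 2)))
    + L * M * ∑ n ∈ Finset.range N, ((n : ℝ) + 1) ^ (-β)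

/-- Bound for the error of replacing the value-at-risk iterates by the value-at-risk in the
expected shortfall recursion. -/
def esErrorBound (B C M β : ℝ) (N : ℕ) : ℝ :=
  √(B ^ 2 * M * ∑ n ∈ Finset.range N, ((n : ℝ) + 1) ^ (-β))
    + C * M * ∑ n ∈ Finset.range N, ((n : ℝ) + 1) ^ (-β)

section Bounds

variable {β : ℝ}

lemma tendsto_sqrt_div_sqrt_of_tendsto_div {s : ℕ → ℝ}
    (h : Tendsto (fun N : ℕ => s N / (N : ℝ)) atTop (𝓝 0)) :
    Tendsto (fun N : ℕ => √(s N) / √(N : ℝ)) atTop (𝓝 0) := by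
  have h2 := (Real.continuous_sqrt.tendsto 0).comp h
  rw [Real.sqrt_zero] at h2
  refine h2.congr fun N => ?_
  exact Real.sqrt_div' _ (Nat.cast_nonneg N)

/-- The four terms have orders `1`, `N^{β/2}`, `N^{1/2-β/4}` and `N^{1-β}`. The second requires `β <
1` and the last requires `β > 1/2`. -/
lemma tendsto_varErrorBound_div_sqrt (hβ : β ∈ Set.Ioo (1 / 2 : ℝ) 1) (A C L M γ₁ : ℝ) :
    Tendsto (fun N : ℕ => varErrorBound A C L M γ₁ β N / √(N : ℝ)) atTop (𝓝 0) := by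
  have hs : Tendsto (fun N : ℕ => (√(N : ℝ))⁻¹) atTop (𝓝 0) :=
    tendsto_inv_atTop_zero.comp (Real.tendsto_sqrt_atTop.comp tendsto_natCast_atTop_atTop)
  have h1 : Tendsto (fun N : ℕ => ((N : ℝ) + 1) ^ (β / 2) / √(N : ℝ)) atTop (𝓝 0) := by
    have h := (tendsto_succ_rpow_neg (p := 1 / 2 - β / 2) (by linarith [hβ.2])).const_mul 2
    rw [mul_zero] at h
    refine squeeze_zero' (Eventually.of_forall fun N => by positivity) ?_ h
    filter_upwards [eventually_ge_atTop 1] with N hN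
    have hN' : (1 : ℝ) ≤ N := by exact_mod_cast hN
    have p1 : (0 : ℝ) < (N : ℝ) + 1 := by positivity
    rw [div_le_iff₀ (Real.sqrt_pos.2 (by linarith))]
    have e : ((N : ℝ) + 1) ^ (-(1 / 2 - β / 2)) * √((N : ℝ) + 1) = ((N : ℝ) + 1) ^ (β / 2) := by
      rw [Real.sqrt_eq_rpow, ← Real.rpow_add p1]; ring_nf
    have hle : √((N : ℝ) + 1) ≤ 2 * √(N : ℝ) := by
      rw [Real.sqrt_le_left (by positivity), mul_pow, Real.sq_sqrt (by linarith)]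
      linarith
    have hr := Real.rpow_nonneg p1.le (-(1 / 2 - β / 2))
    nlinarith [mul_le_mul_of_nonneg_left hle hr]
  have h2 : Tendsto (fun N : ℕ => √(C * √M * ∑ n ∈ Finset.range N, ((n : ℝ) + 1) ^ (-(β / 2)))
      / √(N : ℝ)) atTop (𝓝 0) := by
    apply tendsto_sqrt_div_sqrt_of_tendsto_div
    have h := ((tendsto_succ_rpow_neg (p := β / 2) (by linarith [hβ.1])).cesaro).const_mul (C * √M)
    rw [mul_zero] at h
    refine h.congr fun N => ?_
    ring
  have h3 := (sum_range_rpow_neg_isLittleO hβ.1).const_mul (L * M)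
  have h4 := ((hs.const_mul (2 * A * √M + √M / γ₁)).add (h1.const_mul (3 * (√M / γ₁)))).add
    (h2.add h3)
  simp only [mul_zero, add_zero] at h4
  refine h4.congr fun N => ?_
  unfold varErrorBound
  ring

lemma tendsto_esErrorBound_div_sqrt (hβ : β ∈ Set.Ioo (1 / 2 : ℝ) 1) (B C M : ℝ) :
    Tendsto (fun N : ℕ => esErrorBound B C M β N / √(N : ℝ)) atTop (𝓝 0) := by
  have h2 : Tendsto (fun N : ℕ => √(B ^ 2 * M * ∑ n ∈ Finset.range N, ((n : ℝ) + 1) ^ (-β))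
      / √(N : ℝ)) atTop (𝓝 0) := by
    apply tendsto_sqrt_div_sqrt_of_tendsto_div
    have h := ((tendsto_succ_rpow_neg (p := β) (by linarith [hβ.1])).cesaro).const_mul (B ^ 2 * M)
    rw [mul_zero] at h
    refine h.congr fun N => ?_
    ring
  have h4 := h2.add ((sum_range_rpow_neg_isLittleO hβ.1).const_mul (C * M))
  simp only [mul_zero, add_zero] at h4
  refine h4.congr fun N => ?_
  unfold esErrorBound
  ring

/-- With `x` and `y` the powers `β/2` of consecutive integers, `(y² - x²) / y ≤ 2 (y - x)`, which
telescopes. This pays for the increments of the inverse step sizes in the summation by parts, where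
the first absolute moment of the deviation decays like `n^{-β/2}`. -/
lemma sum_range_rpow_sub_mul_le (hβ : 0 < β) (N : ℕ) :
    ∑ n ∈ Finset.range N, (((n : ℝ) + 2) ^ β - ((n : ℝ) + 1) ^ β) * ((n : ℝ) + 2) ^ (-(β / 2))
      ≤ 2 * ((N : ℝ) + 1) ^ (β / 2) := by
  induction N with
  | zero => simp
  | succ N ih =>
    rw [Finset.sum_range_succ]
    push_cast
    have p1 : (0 : ℝ) < (N : ℝ) + 1 := by positivity
    have p2 : (0 : ℝ) < (N : ℝ) + 2 := by positivity
    have e1 : ((N : ℝ) + 1) ^ β = (((N : ℝ) + 1) ^ (β / 2)) ^ 2 := by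
      rw [← Real.rpow_natCast, ← Real.rpow_mul p1.le]; norm_num
    have e2 : ((N : ℝ) + 2) ^ β = (((N : ℝ) + 2) ^ (β / 2)) ^ 2 := by
      rw [← Real.rpow_natCast, ← Real.rpow_mul p2.le]; norm_num
    have hle : ((N : ℝ) + 1) ^ (β / 2) ≤ ((N : ℝ) + 2) ^ (β / 2) :=
      Real.rpow_le_rpow p1.le (by linarith) (by linarith)
    have hx := Real.rpow_pos_of_pos p1 (β / 2)
    have hy := Real.rpow_pos_of_pos p2 (β / 2)
    rw [e1, e2, Real.rpow_neg p2.le, show (N : ℝ) + 1 + 1 = N + 2 by ring]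
    set x := ((N : ℝ) + 1) ^ (β / 2)
    set y := ((N : ℝ) + 2) ^ (β / 2)
    have : (y ^ 2 - x ^ 2) * y⁻¹ ≤ 2 * (y - x) := by
      rw [← div_eq_mul_inv, div_le_iff₀ hy]
      nlinarith
    linarith

end Bounds

section L1

variable {Ω : Type*} [MeasurableSpace Ω] {P : Measure Ω}

lemma integral_abs_add_le {f g : Ω → ℝ} (hf : Integrable f P) (hg : Integrable g P) :
    ∫ ω, |f ω + g ω| ∂P ≤ ∫ ω, |f ω| ∂P + ∫ ω, |g ω| ∂P := by
  rw [← integral_add hf.abs hg.abs]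
  exact integral_mono (hf.add hg).abs (hf.abs.add hg.abs) fun ω => abs_add_le _ _

lemma integral_abs_sub_le {f g : Ω → ℝ} (hf : Integrable f P) (hg : Integrable g P) :
    ∫ ω, |f ω - g ω| ∂P ≤ ∫ ω, |f ω| ∂P + ∫ ω, |g ω| ∂P := by
  rw [← integral_add hf.abs hg.abs]
  exact integral_mono (hf.sub hg).abs (hf.abs.add hg.abs) fun ω => abs_sub _ _

lemma integral_abs_sum_le {ι : Type*} (s : Finset ι) {f : ι → Ω → ℝ}
    (hf : ∀ i ∈ s, Integrable (f i) P) :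
    ∫ ω, |∑ i ∈ s, f i ω| ∂P ≤ ∑ i ∈ s, ∫ ω, |f i ω| ∂P := by
  rw [← integral_finsetSum s fun i hi => (hf i hi).abs]
  exact integral_mono (integrable_finsetSum s hf).abs
    (integrable_finsetSum s fun i hi => (hf i hi).abs) fun ω => Finset.abs_sum_le_sum_abs _ _

end L1

/-! ### Linearization of the two recursions. -/

section Errors

variable {Ω : Type*} [MeasurableSpace Ω] {P : Measure Ω} {α θ a c C L : ℝ}
  {μ : Measure ℝ} {γ : ℕ → ℝ} {ξ₀ : Ω → ℝ} {X : ℕ → Ω → ℝ} {γ₁ β M : ℝ}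

lemma integral_abs_le_of_integral_sq_le [IsProbabilityMeasure P] {f : Ω → ℝ} (hf : MemLp f 2 P)
    (hM : 0 ≤ M) {n : ℕ} (h : ∫ ω, f ω ^ 2 ∂P ≤ M * ((n : ℝ) + 1) ^ (-β)) :
    ∫ ω, |f ω| ∂P ≤ √M * ((n : ℝ) + 1) ^ (-(β / 2)) := by
  refine (integral_abs_le_sqrt hf).trans ((Real.sqrt_le_sqrt h).trans_eq ?_)
  rw [Real.sqrt_mul hM, Real.sqrt_eq_rpow (_ ^ _), ← Real.rpow_mul (by positivity)]
  ring_nf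

/-- Summation by parts in `L¹` for the weights `(n + 1)^β`. -/
lemma integral_abs_sum_weight_sub_le {D : ℕ → Ω → ℝ} (hD : ∀ n, Integrable (D n) P) (hβ : 0 < β)
    (hM : ∀ n : ℕ, ∫ ω, |D n ω| ∂P ≤ √M * ((n : ℝ) + 1) ^ (-(β / 2))) (N : ℕ) :
    ∫ ω, |∑ n ∈ Finset.range N, ((n : ℝ) + 1) ^ β * (D n ω - D (n + 1) ω)| ∂P
      ≤ √M * (1 + 3 * ((N : ℝ) + 1) ^ (β / 2)) := by
  -- Abel summation. The boundary terms contribute `1` and `(N+1)^{β/2}`, the increments of the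
  -- weights contribute `2 (N+1)^{β/2}`; this is the origin of the factor `3`.
  have hid : ∀ ω, ∑ n ∈ Finset.range N, ((n : ℝ) + 1) ^ β * (D n ω - D (n + 1) ω)
      = (D 0 ω - ((N : ℝ) + 1) ^ β * D N ω)
        + ∑ n ∈ Finset.range N, (((n : ℝ) + 2) ^ β - ((n : ℝ) + 1) ^ β) * D (n + 1) ω := by
    intro ω
    induction N with
    | zero => simp
    | succ N ih =>
      rw [Finset.sum_range_succ, Finset.sum_range_succ, ih]
      push_cast
      rw [show (N : ℝ) + 1 + 1 = N + 2 by ring]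
      ring
  simp_rw [hid]
  have pN : (0 : ℝ) < (N : ℝ) + 1 := by positivity
  have i1 : Integrable (fun ω => ((N : ℝ) + 1) ^ β * D N ω) P := (hD N).const_mul _
  have i2 : ∀ n ∈ Finset.range N, Integrable
      (fun ω => (((n : ℝ) + 2) ^ β - ((n : ℝ) + 1) ^ β) * D (n + 1) ω) P :=
    fun n _ => (hD (n + 1)).const_mul _
  have b0 : ∫ ω, |D 0 ω| ∂P ≤ √M := by simpa using hM 0
  have b1 : ∫ ω, |((N : ℝ) + 1) ^ β * D N ω| ∂P ≤ √M * ((N : ℝ) + 1) ^ (β / 2) := by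
    simp_rw [abs_mul]
    rw [integral_const_mul, abs_of_pos (Real.rpow_pos_of_pos pN _)]
    refine (mul_le_mul_of_nonneg_left (hM N) (Real.rpow_nonneg pN.le _)).trans_eq ?_
    rw [mul_left_comm, ← Real.rpow_add pN]
    ring_nf
  have b2 : ∫ ω, |∑ n ∈ Finset.range N, (((n : ℝ) + 2) ^ β - ((n : ℝ) + 1) ^ β) * D (n + 1) ω| ∂P
      ≤ √M * (2 * ((N : ℝ) + 1) ^ (β / 2)) := by
    refine (integral_abs_sum_le _ i2).trans (le_trans ?_
      (mul_le_mul_of_nonneg_left (sum_range_rpow_sub_mul_le hβ N) (Real.sqrt_nonneg M)))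
    rw [Finset.mul_sum]
    refine Finset.sum_le_sum fun n _ => ?_
    have hw : 0 ≤ ((n : ℝ) + 2) ^ β - ((n : ℝ) + 1) ^ β :=
      sub_nonneg.2 (Real.rpow_le_rpow (by positivity) (by linarith) hβ.le)
    simp_rw [abs_mul]
    rw [integral_const_mul, abs_of_nonneg hw, mul_left_comm]
    refine mul_le_mul_of_nonneg_left ((hM (n + 1)).trans_eq ?_) hw
    push_cast
    ring_nf
  have h1 := integral_abs_add_le ((hD 0).sub i1) (integrable_finsetSum _ i2)
  have h2 := integral_abs_sub_le (hD 0) i1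
  simp only [Pi.sub_apply] at h1
  linarith

lemma integral_sum_le_sum_of_integral_sq_le {D : ℕ → Ω → ℝ} {N : ℕ}
    (hM : ∀ n : ℕ, ∫ ω, D n ω ^ 2 ∂P ≤ M * ((n : ℝ) + 1) ^ (-β)) :
    ∑ n ∈ Finset.range N, ∫ ω, D n ω ^ 2 ∂P
      ≤ M * ∑ n ∈ Finset.range N, ((n : ℝ) + 1) ^ (-β) := by
  rw [Finset.mul_sum]
  exact Finset.sum_le_sum fun n _ => hM n

/-- Linearization of the averaged value-at-risk recursion. -/
lemma integral_abs_varError_le [IsProbabilityMeasure P] [IsProbabilityMeasure μ]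
    (hα : α ∈ Set.Ioo (0 : ℝ) 1) (hμ : RegularQuantile μ α θ a c C L)
    (hC : 0 ≤ C) (hL : 0 ≤ L)
    (hξ₀ : Measurable ξ₀) (hX : ∀ n, Measurable (X n)) (hlaw : ∀ n, P.map (X n) = μ)
    (hind : ∀ n, IndepFun (past ξ₀ X n) (X n) P) (hγ₁ : 0 < γ₁) (hβ : 0 < β)
    (hγ : ∀ n : ℕ, γ (n + 1) = γ₁ * ((n : ℝ) + 1) ^ (-β)) (hM0 : 0 ≤ M)
    (hD : ∀ n, MemLp (fun ω => varIterate α γ ξ₀ X n ω - θ) 2 P)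
    (hM : ∀ n : ℕ, ∫ ω, (varIterate α γ ξ₀ X n ω - θ) ^ 2 ∂P ≤ M * ((n : ℝ) + 1) ^ (-β))
    {A : ℝ} (hA : |a| ≤ A) (N : ℕ) :
    ∫ ω, |a * ∑ n ∈ Finset.range N, (varIterate α γ ξ₀ X (n + 1) ω - θ)
        + ∑ n ∈ Finset.range N, H₁ α θ (X n ω)| ∂P ≤ varErrorBound A C L M γ₁ β N := by
  set D : ℕ → Ω → ℝ := fun n ω => varIterate α γ ξ₀ X n ω - θ with hDdef
  have hD1 : ∀ n, Integrable (D n) P := fun n => (hD n).integrable one_le_two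
  have hM1 : ∀ n : ℕ, ∫ ω, |D n ω| ∂P ≤ √M * ((n : ℝ) + 1) ^ (-(β / 2)) := fun n =>
    integral_abs_le_of_integral_sq_le (hD n) hM0 (hM n)
  have hM1' : ∀ n : ℕ, ∫ ω, |D n ω| ∂P ≤ √M := fun n => (hM1 n).trans
    (mul_le_of_le_one_right (Real.sqrt_nonneg M)
      (Real.rpow_le_one_of_one_le_of_nonpos (by simp) (by linarith)))
  -- Only the difference from the innovation at `θ` is centered. Its mean is the whole mean field
  -- because the latter vanishes at `θ`, and its variance is small near `θ`.
  set k : ℝ × ℝ → ℝ := fun p => H₁ α p.1 p.2 - H₁ α θ p.2 with hk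
  have hkm : Measurable k :=
    (measurable_H₁ α).sub ((measurable_H₁_right α θ).comp measurable_snd)
  have hkint : ∀ ξ, ∫ x, k (ξ, x) ∂μ = drift μ α ξ := fun ξ => by
    simp only [hk]
    rw [integral_sub (integrable_H₁ hα μ ξ) (integrable_H₁ hα μ θ)]
    have := hμ.drift_eq_zero
    simp only [drift] at this ⊢
    rw [this, sub_zero]
  have hkb : ∀ ξ x, |k (ξ, x)| ≤ 2 * (1 / (1 - α)) := fun ξ x => by
    refine (abs_sub _ _).trans ?_
    have h1 := abs_H₁_le hα ξ x
    have h2 := abs_H₁_le hα θ x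
    simp only at h1 h2 ⊢
    linarith
  have hvm : ∀ n, Measurable (varIterate α γ ξ₀ X n) := measurable_varIterate hξ₀ hX
  have hdm : Measurable (drift μ α) :=
    ((measurable_H₁ α).stronglyMeasurable.integral_prod_right' (ν := μ)).measurable
  have hdi : ∀ n, Integrable (fun ω => drift μ α (varIterate α γ ξ₀ X n ω)) P := fun n =>
    Integrable.of_bound (hdm.comp (hvm n)).aestronglyMeasurable (1 / (1 - α))
      (Eventually.of_forall fun ω => by
        have h := norm_integral_le_of_norm_le_const (μ := μ) (C := 1 / (1 - α))
          (f := H₁ α (varIterate α γ ξ₀ X n ω))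
          (Eventually.of_forall fun x => abs_H₁_le hα (varIterate α γ ξ₀ X n ω) x)
        simpa only [drift, probReal_univ, mul_one] using h)
  -- The recursion multiplied by the inverse step expresses `H₁` at the current iterate as a
  -- weighted increment of `D`. Splitting `H₁` into its value at `θ`, a martingale increment, and
  -- the mean field `a D_n` plus a quadratic error gives a sum of `D_n`; passing to the average,
  -- which uses `D_{n+1}`, costs `a (D_N - D_0)`.
  have hid : ∀ ω, a * ∑ n ∈ Finset.range N, D (n + 1) ω + ∑ n ∈ Finset.range N, H₁ α θ (X n ω)
      = ((a * (D N ω - D 0 ω)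
          + 1 / γ₁ * ∑ n ∈ Finset.range N, ((n : ℝ) + 1) ^ β * (D n ω - D (n + 1) ω))
        - ∑ n ∈ Finset.range N, (k (varIterate α γ ξ₀ X n ω, X n ω)
            - ∫ x, k (varIterate α γ ξ₀ X n ω, x) ∂μ))
        - ∑ n ∈ Finset.range N, (drift μ α (varIterate α γ ξ₀ X n ω) - a * D n ω) := by
    intro ω
    simp_rw [hkint]
    induction N with
    | zero => simp
    | succ N ih =>
      have hstep : ((N : ℝ) + 1) ^ β * (D N ω - D (N + 1) ω)
          = γ₁ * H₁ α (varIterate α γ ξ₀ X N ω) (X N ω) := by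
        simp only [hDdef, varIterate, hγ N]
        have p : (0 : ℝ) < (N : ℝ) + 1 := by positivity
        rw [Real.rpow_neg p.le]
        have := (Real.rpow_pos_of_pos p β).ne'
        field_simp
        ring
      have e : 1 / γ₁ * (γ₁ * H₁ α (varIterate α γ ξ₀ X N ω) (X N ω))
          = H₁ α (varIterate α γ ξ₀ X N ω) (X N ω) := by
        field_simp
      simp only [Finset.sum_range_succ, mul_add, hstep, e]
      have ih' := ih
      simp only [hk] at ih' ⊢
      linarith
  change ∫ ω, |a * ∑ n ∈ Finset.range N, D (n + 1) ω + ∑ n ∈ Finset.range N, H₁ α θ (X n ω)| ∂P ≤ _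
  simp_rw [hid]
  have i1 : Integrable (fun ω => a * (D N ω - D 0 ω)) P := ((hD1 N).sub (hD1 0)).const_mul a
  have i2 : Integrable (fun ω => 1 / γ₁ *
      ∑ n ∈ Finset.range N, ((n : ℝ) + 1) ^ β * (D n ω - D (n + 1) ω)) P :=
    (integrable_finsetSum _ fun n _ => ((hD1 n).sub (hD1 (n + 1))).const_mul _).const_mul _
  have i3 : Integrable (fun ω => ∑ n ∈ Finset.range N, (k (varIterate α γ ξ₀ X n ω, X n ω)
      - ∫ x, k (varIterate α γ ξ₀ X n ω, x) ∂μ)) P := by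
    refine integrable_finsetSum _ fun n _ => Integrable.sub ?_ ?_
    · exact Integrable.of_bound (hkm.comp ((hvm n).prodMk (hX n))).aestronglyMeasurable
        (2 * (1 / (1 - α))) (Eventually.of_forall fun ω => hkb _ _)
    · simp_rw [hkint]
      exact hdi n
  have i4' : ∀ n ∈ Finset.range N,
      Integrable (fun ω => drift μ α (varIterate α γ ξ₀ X n ω) - a * D n ω) P :=
    fun n _ => (hdi n).sub ((hD1 n).const_mul a)
  have i4 := integrable_finsetSum _ i4'
  have b1 : ∫ ω, |a * (D N ω - D 0 ω)| ∂P ≤ 2 * A * √M := by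
    simp_rw [abs_mul]
    rw [integral_const_mul]
    have h := integral_abs_sub_le (hD1 N) (hD1 0)
    have h' : ∫ ω, |D N ω - D 0 ω| ∂P ≤ 2 * √M := by linarith [hM1' N, hM1' 0]
    have hn : 0 ≤ ∫ ω, |D N ω - D 0 ω| ∂P := integral_nonneg fun ω => abs_nonneg _
    calc |a| * ∫ ω, |D N ω - D 0 ω| ∂P ≤ A * (2 * √M) := by
          have := (abs_nonneg a).trans hA
          gcongr
      _ = _ := by ring
  have b2 : ∫ ω, |1 / γ₁ * ∑ n ∈ Finset.range N, ((n : ℝ) + 1) ^ β * (D n ω - D (n + 1) ω)| ∂P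
      ≤ √M / γ₁ * (1 + 3 * ((N : ℝ) + 1) ^ (β / 2)) := by
    simp_rw [abs_mul (1 / γ₁)]
    rw [integral_const_mul, abs_of_pos (by positivity)]
    refine (mul_le_mul_of_nonneg_left (integral_abs_sum_weight_sub_le hD1 hβ hM1 N)
      (by positivity)).trans_eq ?_
    ring
  -- The variance of the increment is linear, not quadratic, in the distance to `θ`: the indicators
  -- differ with a probability of that order.
  have b3 := integral_abs_sum_centered_le hξ₀ hX hind hlaw
    (measurable_comap_varIterate α γ ξ₀ X) hkm (b := fun _ => 2 * (1 / (1 - α)))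
    (v := fun ξ => C * |ξ - θ|) hkb (fun n => memLp_const _) hμ.integral_sq_sub_le
    (fun n => (hD1 n).abs.const_mul C) N
  have b3' : √(∑ n ∈ Finset.range N, ∫ ω, C * |varIterate α γ ξ₀ X n ω - θ| ∂P)
      ≤ √(C * √M * ∑ n ∈ Finset.range N, ((n : ℝ) + 1) ^ (-(β / 2))) := by
    refine Real.sqrt_le_sqrt ?_
    rw [Finset.mul_sum]
    refine Finset.sum_le_sum fun n _ => ?_
    rw [integral_const_mul, mul_assoc]
    exact mul_le_mul_of_nonneg_left (hM1 n) hC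
  have b4 : ∫ ω, |∑ n ∈ Finset.range N, (drift μ α (varIterate α γ ξ₀ X n ω) - a * D n ω)| ∂P
      ≤ L * M * ∑ n ∈ Finset.range N, ((n : ℝ) + 1) ^ (-β) := by
    refine (integral_abs_sum_le _ i4').trans ?_
    rw [mul_assoc]
    refine le_trans ?_ (mul_le_mul_of_nonneg_left
      (integral_sum_le_sum_of_integral_sq_le (D := D) (N := N) hM) hL)
    rw [Finset.mul_sum]
    refine Finset.sum_le_sum fun n hn => ?_
    rw [← integral_const_mul]
    exact integral_mono (i4' n hn).abs ((hD n).integrable_sq.const_mul L)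
      fun ω => hμ.linearization _
  have t1 := integral_abs_sub_le ((i1.add i2).sub i3) i4
  have t2 := integral_abs_sub_le (i1.add i2) i3
  have t3 := integral_abs_add_le i1 i2
  simp only [Pi.add_apply, Pi.sub_apply] at t1 t2
  unfold varErrorBound
  linarith

/-- Effect of the value-at-risk iterates on the expected shortfall recursion. -/
lemma integral_abs_esError_le [IsProbabilityMeasure P] [IsProbabilityMeasure μ]
    (hα : α ∈ Set.Ioo (0 : ℝ) 1) (hμ : RegularQuantile μ α θ a c C L) (hC : 0 ≤ C)
    (hξ₀ : Measurable ξ₀) (hX : ∀ n, Measurable (X n)) (hlaw : ∀ n, P.map (X n) = μ)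
    (hind : ∀ n, IndepFun (past ξ₀ X n) (X n) P)
    (hD : ∀ n, MemLp (fun ω => varIterate α γ ξ₀ X n ω - θ) 2 P)
    (hM : ∀ n : ℕ, ∫ ω, (varIterate α γ ξ₀ X n ω - θ) ^ 2 ∂P ≤ M * ((n : ℝ) + 1) ^ (-β))
    (N : ℕ) :
    ∫ ω, |∑ n ∈ Finset.range N, (shortfallLoss α (varIterate α γ ξ₀ X n ω) (X n ω)
        - shortfallLoss α θ (X n ω))| ∂P ≤ esErrorBound (1 / (1 - α)) C M β N := by
  set k : ℝ × ℝ → ℝ := fun p => shortfallLoss α p.1 p.2 - shortfallLoss α θ p.2 with hk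
  have hkm : Measurable k := (measurable_shortfallLoss α).sub
    ((measurable_shortfallLoss α).comp (measurable_const.prodMk measurable_snd))
  have hkb : ∀ ξ x, |k (ξ, x)| ≤ 1 / (1 - α) * |ξ - θ| := fun ξ x =>
    abs_shortfallLoss_sub_le hα ξ θ x
  have hvm : ∀ n, Measurable (varIterate α γ ξ₀ X n) := measurable_varIterate hξ₀ hX
  have hki : ∀ n, Integrable (fun ω => k (varIterate α γ ξ₀ X n ω, X n ω)) P := fun n =>
    (((hD n).integrable one_le_two).abs.const_mul (1 / (1 - α))).mono'
      (hkm.comp ((hvm n).prodMk (hX n))).aestronglyMeasurable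
      (Eventually.of_forall fun ω => hkb _ _)
  have hmm : ∀ n, Integrable (fun ω => ∫ x, k (varIterate α γ ξ₀ X n ω, x) ∂μ) P := fun n => by
    have := integrable_integral_of_indepFun (hvm n) (hX n)
      (indepFun_of_past (hind n) (measurable_comap_varIterate α γ ξ₀ X n)) hkm (hki n)
    rwa [hlaw n] at this
  -- This mean is the excess of the objective over its minimum. By convexity it lies between `0` and
  -- `drift μ α ξ * (ξ - θ)`, hence it is quadratic.
  have hmb : ∀ ξ, |∫ x, k (ξ, x) ∂μ| ≤ C * (ξ - θ) ^ 2 := fun ξ => by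
    have e : ∫ x, k (ξ, x) ∂μ
        = ∫ x, shortfallLoss α ξ x ∂μ - ∫ x, shortfallLoss α θ x ∂μ :=
      integral_sub (integrable_shortfallLoss hμ.integrable_id ξ)
        (integrable_shortfallLoss hμ.integrable_id θ)
    have h1 := drift_mul_le hα hμ.integrable_id θ ξ
    have h2 := drift_mul_le hα hμ.integrable_id ξ θ
    rw [hμ.drift_eq_zero, zero_mul] at h1
    rw [e, abs_of_nonneg h1, ← sq_abs]
    calc ∫ x, shortfallLoss α ξ x ∂μ - ∫ x, shortfallLoss α θ x ∂μ ≤ drift μ α ξ * (ξ - θ) := by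
          linarith
      _ ≤ |drift μ α ξ * (ξ - θ)| := le_abs_self _
      _ = |drift μ α ξ| * |ξ - θ| := abs_mul _ _
      _ ≤ C * |ξ - θ| * |ξ - θ| := by gcongr; exact hμ.abs_drift_le ξ
      _ = _ := by ring
  have hid : ∀ ω, ∑ n ∈ Finset.range N, (shortfallLoss α (varIterate α γ ξ₀ X n ω) (X n ω)
        - shortfallLoss α θ (X n ω))
      = ∑ n ∈ Finset.range N, (k (varIterate α γ ξ₀ X n ω, X n ω)
            - ∫ x, k (varIterate α γ ξ₀ X n ω, x) ∂μ)
        + ∑ n ∈ Finset.range N, ∫ x, k (varIterate α γ ξ₀ X n ω, x) ∂μ := by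
    intro ω
    rw [← Finset.sum_add_distrib]
    refine Finset.sum_congr rfl fun n _ => ?_
    simp [hk]
  simp_rw [hid]
  have hsum := integral_sum_le_sum_of_integral_sq_le
    (D := fun n ω => varIterate α γ ξ₀ X n ω - θ) (N := N) hM
  have i1 := integrable_finsetSum (Finset.range N) fun n _ => (hki n).sub (hmm n)
  have b1 := integral_abs_sum_centered_le hξ₀ hX hind hlaw
    (measurable_comap_varIterate α γ ξ₀ X) hkm (b := fun ξ => 1 / (1 - α) * |ξ - θ|)
    (v := fun ξ => (1 / (1 - α)) ^ 2 * (ξ - θ) ^ 2) hkb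
    (fun n => (hD n).abs.const_mul _) (fun ξ => by
      have hle : ∀ x, k (ξ, x) ^ 2 ≤ (1 / (1 - α)) ^ 2 * (ξ - θ) ^ 2 := fun x => by
        rw [← sq_abs (k (ξ, x)), ← sq_abs (ξ - θ), ← mul_pow]
        gcongr
        exact hkb ξ x
      have := integral_mono_of_nonneg (μ := μ) (Eventually.of_forall fun x => sq_nonneg (k (ξ, x)))
        (integrable_const ((1 / (1 - α)) ^ 2 * (ξ - θ) ^ 2)) (Eventually.of_forall hle)
      simpa using this)
    (fun n => (hD n).integrable_sq.const_mul _) N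
  have b1' : √(∑ n ∈ Finset.range N, ∫ ω, (1 / (1 - α)) ^ 2 * (varIterate α γ ξ₀ X n ω - θ) ^ 2 ∂P)
      ≤ √((1 / (1 - α)) ^ 2 * M * ∑ n ∈ Finset.range N, ((n : ℝ) + 1) ^ (-β)) := by
    refine Real.sqrt_le_sqrt ?_
    simp_rw [integral_const_mul]
    rw [← Finset.mul_sum, mul_assoc]
    exact mul_le_mul_of_nonneg_left hsum (sq_nonneg _)
  have b2 : ∫ ω, |∑ n ∈ Finset.range N, ∫ x, k (varIterate α γ ξ₀ X n ω, x) ∂μ| ∂P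
      ≤ C * M * ∑ n ∈ Finset.range N, ((n : ℝ) + 1) ^ (-β) := by
    refine (integral_abs_sum_le _ fun n _ => hmm n).trans ?_
    rw [mul_assoc]
    refine le_trans ?_ (mul_le_mul_of_nonneg_left hsum hC)
    rw [Finset.mul_sum]
    refine Finset.sum_le_sum fun n hn => ?_
    rw [← integral_const_mul]
    exact integral_mono (hmm n).abs ((hD n).integrable_sq.const_mul C) fun ω => hmb _
  have t1 := integral_abs_add_le i1 (integrable_finsetSum (Finset.range N) fun n _ => hmm n)
  simp only [Pi.sub_apply] at t1
  unfold esErrorBound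
  linarith

omit [MeasurableSpace Ω] in
/-- The expected shortfall iterate is an average of losses at the value-at-risk iterates. -/
lemma mul_esIterate (α : ℝ) (γ : ℕ → ℝ) (ξ₀ : Ω → ℝ) (X : ℕ → Ω → ℝ) (N : ℕ) (ω : Ω) :
    (N : ℝ) * esIterate α γ ξ₀ X N ω
      = ∑ n ∈ Finset.range N, shortfallLoss α (varIterate α γ ξ₀ X n ω) (X n ω) := by
  induction N with
  | zero => simp
  | succ N ih =>
    rw [Finset.sum_range_succ, ← ih]
    simp only [esIterate, H₂, shortfallLoss]
    have : ((N : ℝ) + 1) ≠ 0 := by positivity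
    push_cast
    field_simp
    ring

end Errors

/-! ### The nested model: conditional expectation and mean square error. -/

section Model

variable {Ω : Type*} [MeasurableSpace Ω] {P : Measure Ω} [IsProbabilityMeasure P]

lemma memLp_two_of_integrable_rpow {f : Ω → ℝ} (hf : Measurable f) {δ : ℝ} (hδ : 0 < δ)
    (h : Integrable (fun ω => |f ω| ^ (2 + δ)) P) : MemLp f 2 P := by
  rw [memLp_two_iff_integrable_sq hf.aestronglyMeasurable]
  refine ((integrable_const (1 : ℝ)).add h).mono' (hf.pow_const 2).aestronglyMeasurable
    (Eventually.of_forall fun ω => ?_)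
  rw [Real.norm_of_nonneg (sq_nonneg _), ← sq_abs]
  simp only [Pi.add_apply]
  rcases le_total |f ω| 1 with h1 | h1
  · have : 0 ≤ |f ω| ^ (2 + δ) := by positivity
    nlinarith [abs_nonneg (f ω)]
  · have := Real.rpow_le_rpow_of_exponent_le h1 (by linarith : (2 : ℝ) ≤ 2 + δ)
    rw [Real.rpow_two] at this
    linarith

variable {d q : ℕ} {φ : EuclideanSpace ℝ (Fin d) → EuclideanSpace ℝ (Fin q) → ℝ}
  {Y : Ω → EuclideanSpace ℝ (Fin d)} {Z : Ω → EuclideanSpace ℝ (Fin q)}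
  {Zs : ℕ → Ω → EuclideanSpace ℝ (Fin q)}

/-- The exact loss is obtained by integrating out the second risk factor. -/
lemma exactLoss_ae_eq
    (hφ : Measurable (fun p : EuclideanSpace ℝ (Fin d) × EuclideanSpace ℝ (Fin q) => φ p.1 p.2))
    (hY : Measurable Y) (hZ : Measurable Z) (hYZ : IndepFun Y Z P)
    (hint : Integrable (fun ω => φ (Y ω) (Z ω)) P) :
    exactLoss P φ Y Z =ᵐ[P] fun ω => ∫ z, φ (Y ω) z ∂(P.map Z) := by
  have := Measure.isProbabilityMeasure_map hZ.aemeasurable (μ := P)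
  have hg : Measurable fun y => ∫ z, φ y z ∂(P.map Z) :=
    (hφ.stronglyMeasurable.integral_prod_right' (ν := P.map Z)).measurable
  have hgi : Integrable (fun ω => ∫ z, φ (Y ω) z ∂(P.map Z)) P :=
    integrable_integral_of_indepFun hY hZ hYZ hφ hint
  refine (ae_eq_condExp_of_forall_setIntegral_eq hY.comap_le hint
    (fun s _ _ => hgi.integrableOn) ?_ ?_).symm
  -- The indicator of a test event in the σ-algebra of `Y` is a function of `Y`, so it can be
  -- absorbed into the integrand before integrating out `Z`.
  · rintro s ⟨t, ht, rfl⟩ -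
    have hs : MeasurableSet (Y ⁻¹' t) := hY ht
    rw [← integral_indicator hs, ← integral_indicator hs]
    set G : EuclideanSpace ℝ (Fin d) × EuclideanSpace ℝ (Fin q) → ℝ :=
      fun p => t.indicator (fun _ => 1) p.1 * φ p.1 p.2 with hG
    have hGm : Measurable G :=
      ((measurable_const.indicator ht).comp measurable_fst).mul hφ
    have e1 : (Y ⁻¹' t).indicator (fun ω => φ (Y ω) (Z ω)) = fun ω => G (Y ω, Z ω) := by
      ext ω
      by_cases hω : Y ω ∈ t <;> simp [hG, Set.indicator, hω]
    have e2 : (Y ⁻¹' t).indicator (fun ω => ∫ z, φ (Y ω) z ∂(P.map Z))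
        = fun ω => ∫ z, G (Y ω, z) ∂(P.map Z) := by
      ext ω
      by_cases hω : Y ω ∈ t <;> simp [hG, Set.indicator, hω]
    have hGi : Integrable (fun ω => G (Y ω, Z ω)) P := e1 ▸ hint.indicator hs
    rw [e1, e2]
    exact (integral_eq_integral_integral_of_indepFun hY hZ hYZ hGm hGi).symm
  · exact (hg.comp (comap_measurable Y)).aestronglyMeasurable

lemma measurable_nestedLoss
    (hφ : Measurable (fun p : EuclideanSpace ℝ (Fin d) × EuclideanSpace ℝ (Fin q) => φ p.1 p.2))
    (hY : Measurable Y) (hZs : ∀ k, Measurable (Zs k)) (K : ℕ+) :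
    Measurable (nestedLoss φ Y Zs K) :=
  (Finset.measurable_sum _ fun k _ => hφ.comp (hY.prodMk (hZs k))).const_mul _

omit [IsProbabilityMeasure P] in
lemma measurable_exactLoss (hY : Measurable Y) : Measurable (exactLoss P φ Y Z) :=
  stronglyMeasurable_condExp.measurable.mono hY.comap_le le_rfl

/-- Mean square convergence of the nested losses to the exact loss. -/
lemma tendsto_integral_sq_nestedLoss_sub
    (hφ : Measurable (fun p : EuclideanSpace ℝ (Fin d) × EuclideanSpace ℝ (Fin q) => φ p.1 p.2))
    (hY : Measurable Y) (hZ : Measurable Z) (hYZ : IndepFun Y Z P) (hZs : ∀ k, Measurable (Zs k))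
    (hZs_indep : iIndepFun Zs P) (hZs_law : ∀ k, IdentDistrib (Zs k) Z P P)
    (hYZs : IndepFun Y (fun ω k => Zs k ω) P) (h2 : MemLp (fun ω => φ (Y ω) (Z ω)) 2 P) :
    MemLp (exactLoss P φ Y Z) 2 P ∧ (∀ K, MemLp (nestedLoss φ Y Zs K) 2 P) ∧
    Tendsto (fun K : ℕ+ => ∫ ω, (nestedLoss φ Y Zs K ω - exactLoss P φ Y Z ω) ^ 2 ∂P)
      atTop (𝓝 0) := by
  set g : EuclideanSpace ℝ (Fin d) → ℝ := fun y => ∫ z, φ y z ∂(P.map Z) with hg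
  have := Measure.isProbabilityMeasure_map hZ.aemeasurable (μ := P)
  have hgm : Measurable g := (hφ.stronglyMeasurable.integral_prod_right' (ν := P.map Z)).measurable
  have hae := exactLoss_ae_eq hφ hY hZ hYZ (h2.integrable one_le_two)
  have hX0 : MemLp (exactLoss P φ Y Z) 2 P := MemLp.condExp one_le_two h2
  have hg2 : MemLp (fun ω => g (Y ω)) 2 P := hX0.ae_eq hae
  have hYZk : ∀ k, IndepFun Y (Zs k) P := fun k =>
    hYZs.comp (φ := id) (ψ := fun z : ℕ → EuclideanSpace ℝ (Fin q) => z k) measurable_id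
      (measurable_pi_apply k)
  have hid : ∀ k, IdentDistrib (fun ω => (Y ω, Zs k ω)) (fun ω => (Y ω, Z ω)) P P := fun k =>
    ⟨(hY.prodMk (hZs k)).aemeasurable, (hY.prodMk hZ).aemeasurable, by
      rw [(indepFun_iff_map_prod_eq_prod_map_map hY.aemeasurable (hZs k).aemeasurable).1 (hYZk k),
        (indepFun_iff_map_prod_eq_prod_map_map hY.aemeasurable hZ.aemeasurable).1 hYZ,
        (hZs_law k).map_eq]⟩
  have hA2 : ∀ k, MemLp (fun ω => φ (Y ω) (Zs k ω)) 2 P := fun k =>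
    ((hid k).comp hφ).memLp_iff.2 h2
  set ψ : EuclideanSpace ℝ (Fin d) × EuclideanSpace ℝ (Fin q) → ℝ :=
    fun p => φ p.1 p.2 - g p.1 with hψ
  have hψm : Measurable ψ := hφ.sub (hgm.comp measurable_fst)
  -- For exceptional `y` at which `φ y` is not integrable, `g y` is `0` by the convention for the
  -- integral, and the integral of `ψ` vanishes by the same convention. Thus centering holds for
  -- every `y`.
  have hψ0 : ∀ (n : ℕ) y, ∫ z, ψ (y, z) ∂(P.map (Zs n)) = 0 := fun n y => by
    rw [(hZs_law n).map_eq]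
    by_cases hi : Integrable (fun z => φ y z) (P.map Z)
    · simp only [hψ]
      rw [integral_sub hi (integrable_const _)]
      simp [hg]
    · have h0 : g y = 0 := integral_undef hi
      simp only [hψ, h0, sub_zero]
      exact integral_undef hi
  have hψ2 : ∀ n, MemLp (fun ω => ψ (Y ω, Zs n ω)) 2 P := fun n => (hA2 n).sub hg2
  -- Conditionally on `Y` the summands are independent and centered: this is the martingale identity
  -- with the constant choice `T = Y`. It yields a squared error of exactly `M / K`.
  have hsq := integral_sq_sum_range hY hZs (indepFun_past hY hZs hZs_indep hYZs)
    (T := fun _ => Y) (measurable_comap_past_init Y Zs) hψm hψ0 hψ2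
  have hconst : ∀ n, ∫ ω, ψ (Y ω, Zs n ω) ^ 2 ∂P = ∫ ω, ψ (Y ω, Z ω) ^ 2 ∂P := fun n =>
    ((hid n).comp (hψm.pow_const 2)).integral_eq
  refine ⟨hX0, fun K => ?_, ?_⟩
  · exact (memLp_finsetSum _ fun k _ => hA2 k).const_mul _
  set M := ∫ ω, ψ (Y ω, Z ω) ^ 2 ∂P
  have hval : ∀ K : ℕ+, ∫ ω, (nestedLoss φ Y Zs K ω - exactLoss P φ Y Z ω) ^ 2 ∂P
      = M / ((K : ℕ) : ℝ) := by
    intro K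
    have hK : ((K : ℕ) : ℝ) ≠ 0 := by exact_mod_cast K.pos.ne'
    have e : ∫ ω, (nestedLoss φ Y Zs K ω - exactLoss P φ Y Z ω) ^ 2 ∂P
        = ∫ ω, (1 / ((K : ℕ) : ℝ)) ^ 2 * (∑ k ∈ Finset.range K, ψ (Y ω, Zs k ω)) ^ 2 ∂P := by
      refine integral_congr_ae ?_
      filter_upwards [hae] with ω hω
      rw [hω, ← mul_pow]
      congr 1
      simp only [hψ, nestedLoss, Finset.sum_sub_distrib, Finset.sum_const, Finset.card_range,
        nsmul_eq_mul, mul_sub]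
      field_simp
      rfl
    rw [e, integral_const_mul, hsq, Finset.sum_congr rfl fun n _ => hconst n]
    simp only [Finset.sum_const, Finset.card_range, nsmul_eq_mul]
    field_simp
  simp_rw [hval]
  have hK : Tendsto (fun K : ℕ+ => (K : ℕ)) atTop atTop := tendsto_PNat_val_atTop_atTop
  exact tendsto_const_nhds.div_atTop (tendsto_natCast_atTop_atTop.comp hK)

end Model

/-- The integral from `p` to `p + d` has the sign of `d`, and its modulus is at least the mass
collected within distance `1` of `p`, the rest being nonnegative. It provides both the restoring
force of the mean field and the convergence of the quantiles. -/
lemma mul_min_abs_le_mul_integral {f : ℝ → ℝ} (hf : Continuous f) (h0 : ∀ x, 0 ≤ f x) {c p : ℝ}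
    (hc : ∀ x, |x - p| ≤ 1 → c ≤ f x) (d : ℝ) :
    c * min |d| 1 * |d| ≤ d * ∫ x in p..(p + d), f x := by
  have hi : ∀ a b, IntervalIntegrable f volume a b := fun a b => hf.intervalIntegrable a b
  have hconst : ∀ a b, a ≤ b → (∀ x ∈ Set.Icc a b, |x - p| ≤ 1) →
      c * (b - a) ≤ ∫ x in a..b, f x := fun a b hab h => by
    have := intervalIntegral.integral_mono_on hab intervalIntegrable_const (hi a b)
      fun x hx => hc x (h x hx)
    rwa [intervalIntegral.integral_const, smul_eq_mul, mul_comm] at this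
  have hnn : ∀ a b, a ≤ b → 0 ≤ ∫ x in a..b, f x := fun a b hab =>
    intervalIntegral.integral_nonneg hab fun x _ => h0 x
  rcases le_total 0 d with hd | hd
  · rw [abs_of_nonneg hd, mul_comm]
    refine mul_le_mul_of_nonneg_left ?_ hd
    rcases le_total d 1 with h1 | h1
    · rw [min_eq_left h1]
      have := hconst p (p + d) (by linarith) fun x hx => by
        rw [abs_le]; constructor <;> linarith [hx.1, hx.2]
      linarith
    · rw [min_eq_right h1]
      have e := intervalIntegral.integral_add_adjacent_intervals (hi p (p + 1)) (hi (p + 1) (p + d))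
      have := hconst p (p + 1) (by linarith) fun x hx => by
        rw [abs_le]; constructor <;> linarith [hx.1, hx.2]
      have := hnn (p + 1) (p + d) (by linarith)
      linarith
  · rw [abs_of_nonpos hd, mul_comm, intervalIntegral.integral_symm, mul_neg, ← neg_mul]
    refine mul_le_mul_of_nonneg_left ?_ (by linarith)
    rcases le_total (-d) 1 with h1 | h1
    · rw [min_eq_left h1]
      have := hconst (p + d) p (by linarith) fun x hx => by
        rw [abs_le]; constructor <;> linarith [hx.1, hx.2]
      linarith
    · rw [min_eq_right h1]
      have e := intervalIntegral.integral_add_adjacent_intervals (hi (p + d) (p - 1)) (hi (p - 1) p)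
      have := hconst (p - 1) p (by linarith) fun x hx => by
        rw [abs_le]; constructor <;> linarith [hx.1, hx.2]
      have := hnn (p + d) (p - 1) (by linarith)
      linarith

/-! ### From a density to a regular quantile and to the minimizer of the objective. -/

section Pdf

variable {Ω : Type*} [MeasurableSpace Ω] {P : Measure Ω} [IsProbabilityMeasure P] {X : Ω → ℝ}
  {f : ℝ → ℝ} {α : ℝ}

omit [IsProbabilityMeasure P] in
lemma cdfOf_eq_map (hX : Measurable X) (ξ : ℝ) : cdfOf P X ξ = (P.map X).real (Set.Iic ξ) := by
  rw [map_measureReal_apply hX measurableSet_Iic]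
  rfl

lemma IsContinuousPdf.cdfOf_sub (hX : Measurable X) (hf : IsContinuousPdf P X f) (a b : ℝ) :
    cdfOf P X b - cdfOf P X a = ∫ x in a..b, f x := by
  have := Measure.isProbabilityMeasure_map hX.aemeasurable (μ := P)
  have key : ∀ a b, a ≤ b → cdfOf P X b - cdfOf P X a = ∫ x in a..b, f x := by
    intro a b hab
    have hi : IntegrableOn f (Set.Ioc a b) volume := (hf.continuous.integrableOn_Icc).mono_set
      Set.Ioc_subset_Icc_self
    have e : (P.map X).real (Set.Ioc a b) = ∫ x in a..b, f x := by
      rw [hf.law, intervalIntegral.integral_of_le hab, measureReal_def,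
        withDensity_apply _ measurableSet_Ioc,
        ← ofReal_integral_eq_lintegral_ofReal hi (Eventually.of_forall hf.nonneg),
        ENNReal.toReal_ofReal (integral_nonneg hf.nonneg)]
    rw [cdfOf_eq_map hX, cdfOf_eq_map hX, ← e, ← Set.Iic_union_Ioc_eq_Iic hab,
      measureReal_union (Set.Iic_disjoint_Ioc le_rfl) measurableSet_Ioc]
    ring
  rcases le_total a b with h | h
  · exact key a b h
  · rw [intervalIntegral.integral_symm, ← key b a h]
    ring

lemma IsContinuousPdf.continuous_cdfOf (hX : Measurable X) (hf : IsContinuousPdf P X f) :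
    Continuous (cdfOf P X) := by
  have e : cdfOf P X = fun ξ => cdfOf P X 0 + ∫ x in (0 : ℝ)..ξ, f x := by
    ext ξ
    rw [← hf.cdfOf_sub hX]
    ring
  rw [e]
  exact continuous_const.add
    (intervalIntegral.continuous_primitive (fun a b => hf.continuous.intervalIntegrable a b) 0)

/-- The value-at-risk is a quantile when the distribution function is continuous. -/
lemma IsContinuousPdf.cdfOf_valueAtRisk (hX : Measurable X) (hf : IsContinuousPdf P X f)
    (hα : α ∈ Set.Ioo (0 : ℝ) 1) : cdfOf P X (valueAtRisk P α X) = α := by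
  have := Measure.isProbabilityMeasure_map hX.aemeasurable (μ := P)
  have hcont := hf.continuous_cdfOf hX
  have e : cdfOf P X = cdf (P.map X) := by
    ext ξ
    rw [cdfOf_eq_map hX, cdf_eq_real]
  have hbot : Tendsto (cdfOf P X) atBot (𝓝 0) := e ▸ tendsto_cdf_atBot _
  have htop : Tendsto (cdfOf P X) atTop (𝓝 1) := e ▸ tendsto_cdf_atTop _
  have hmono : Monotone (cdfOf P X) := e ▸ monotone_cdf _
  obtain ⟨l, hl⟩ := (hbot.eventually_lt_const hα.1).exists
  obtain ⟨u, hu⟩ := (htop.eventually_const_lt hα.2).exists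
  have hbdd : BddBelow {ξ | α ≤ cdfOf P X ξ} := ⟨l, fun ξ hξ => by
    by_contra h
    have := hmono (not_le.1 h).le
    exact absurd (le_trans hξ this) (not_le.2 hl)⟩
  obtain ⟨p, hp⟩ := mem_range_of_exists_le_of_exists_ge hcont ⟨l, hl.le⟩ ⟨u, hu.le⟩
  refine le_antisymm ?_ ?_
  · have hle : valueAtRisk P α X ≤ p := csInf_le hbdd hp.ge
    exact (hmono hle).trans_eq hp
  · exact (isClosed_le continuous_const hcont).csInf_mem ⟨u, hu.le⟩ hbdd

/-- The closed half-line in `H₁` may be replaced by the open one because a law with a density has no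
atoms; the mean field is then an affine function of the distribution function. -/
lemma IsContinuousPdf.drift_eq (hX : Measurable X) (hf : IsContinuousPdf P X f)
    (hα : α ∈ Set.Ioo (0 : ℝ) 1) (ξ : ℝ) :
    drift (P.map X) α ξ = 1 / (1 - α) * (cdfOf P X ξ - α) := by
  have := Measure.isProbabilityMeasure_map hX.aemeasurable (μ := P)
  have hα1 : 1 - α ≠ 0 := by linarith [hα.2]
  have hatom : (P.map X) {ξ} = 0 := by
    rw [hf.law]
    exact withDensity_absolutelyContinuous _ _ (by simp)
  have h1 : (P.map X).real (Set.Ici ξ) = 1 - cdfOf P X ξ := by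
    rw [cdfOf_eq_map hX, ← probReal_compl_eq_one_sub measurableSet_Iic, Set.compl_Iic,
      measureReal_def, measureReal_def]
    congr 1
    exact measure_congr (Ioi_ae_eq_Ici' hatom).symm
  have e : H₁ α ξ = fun x => 1 - 1 / (1 - α) * (Set.Ici ξ).indicator (fun _ => (1 : ℝ)) x := by
    ext x
    simp [H₁, Set.indicator]
  have hi : Integrable (fun x => (Set.Ici ξ).indicator (fun _ => (1 : ℝ)) x) (P.map X) :=
    (integrable_const 1).indicator measurableSet_Ici
  rw [drift, e, integral_sub (integrable_const _) (hi.const_mul _), integral_const_mul,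
    integral_indicator_const _ measurableSet_Ici, h1]
  simp only [integral_const, probReal_univ, smul_eq_mul, mul_one]
  field_simp
  ring

/-- For `θ ≤ ξ` the difference is `1 / (1 - α)` times an indicator. Its second moment is therefore a
multiple of an increment of the mean field. -/
lemma sq_H₁_sub {θ ξ : ℝ} (h : θ ≤ ξ) (x : ℝ) :
    (H₁ α ξ x - H₁ α θ x) ^ 2 = 1 / (1 - α) * (H₁ α ξ x - H₁ α θ x) := by
  unfold H₁
  split_ifs
  · ring
  · linarith
  · ring
  · ring

lemma integral_sq_H₁_sub (hα : α ∈ Set.Ioo (0 : ℝ) 1) (μ : Measure ℝ) [IsFiniteMeasure μ]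
    (θ ξ : ℝ) : ∫ x, (H₁ α ξ x - H₁ α θ x) ^ 2 ∂μ
      = 1 / (1 - α) * |drift μ α ξ - drift μ α θ| := by
  have key : ∀ θ ξ, θ ≤ ξ → ∫ x, (H₁ α ξ x - H₁ α θ x) ^ 2 ∂μ
      = 1 / (1 - α) * |drift μ α ξ - drift μ α θ| := by
    intro θ ξ h
    have hB : 0 < 1 / (1 - α) := one_div_pos.2 (by linarith [hα.2])
    have e : ∫ x, (H₁ α ξ x - H₁ α θ x) ^ 2 ∂μ
        = 1 / (1 - α) * (drift μ α ξ - drift μ α θ) := by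
      simp_rw [sq_H₁_sub h]
      rw [integral_const_mul, integral_sub (integrable_H₁ hα μ ξ) (integrable_H₁ hα μ θ)]
      rfl
    have hnn : 0 ≤ ∫ x, (H₁ α ξ x - H₁ α θ x) ^ 2 ∂μ := integral_nonneg fun x => sq_nonneg _
    rw [e] at hnn ⊢
    rw [abs_of_nonneg (nonneg_of_mul_nonneg_right hnn hB)]
  rcases le_total θ ξ with h | h
  · exact key θ ξ h
  · rw [abs_sub_comm, ← key ξ θ h]
    congr 1
    ext x
    ring

/-- Regularity of a quantile from bounds on the density. -/
lemma IsContinuousPdf.regularQuantile (hX : Measurable X) (hX1 : Integrable X P)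
    (hf : IsContinuousPdf P X f) (hα : α ∈ Set.Ioo (0 : ℝ) 1) {θ c C : ℝ} {L : ℝ≥0}
    (hθ : cdfOf P X θ = α) (hc : ∀ x, |x - θ| ≤ 1 → c ≤ f x) (hC : ∀ x, f x ≤ C)
    (hL : LipschitzWith L f) :
    RegularQuantile (P.map X) α θ (f θ / (1 - α)) (c / (1 - α)) ((1 / (1 - α)) ^ 2 * C)
      (L / (1 - α)) := by
  have := Measure.isProbabilityMeasure_map hX.aemeasurable (μ := P)
  have hα1 : 0 < 1 - α := by linarith [hα.2]
  have hB1 : 1 ≤ 1 / (1 - α) := by rw [le_div_iff₀ hα1]; linarith [hα.1]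
  have hd : ∀ ξ, drift (P.map X) α ξ = 1 / (1 - α) * ∫ x in θ..ξ, f x := fun ξ => by
    rw [hf.drift_eq hX hα, ← hf.cdfOf_sub hX, hθ]
  have hd0 : drift (P.map X) α θ = 0 := by rw [hd]; simp
  have hC0 : 0 ≤ C := (hf.nonneg 0).trans (hC 0)
  have hi : ∀ a b, IntervalIntegrable f volume a b := fun a b => hf.continuous.intervalIntegrable a b
  have hint : ∀ ξ, |∫ x in θ..ξ, f x| ≤ C * |ξ - θ| := fun ξ =>
    intervalIntegral.norm_integral_le_of_norm_le_const fun x _ => by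
      rw [Real.norm_of_nonneg (hf.nonneg x)]
      exact hC x
  have habs : ∀ ξ, |drift (P.map X) α ξ| ≤ 1 / (1 - α) * (C * |ξ - θ|) := fun ξ => by
    rw [hd, abs_mul, abs_of_pos (by positivity)]
    exact mul_le_mul_of_nonneg_left (hint ξ) (by positivity)
  refine ⟨(integrable_map_measure aestronglyMeasurable_id hX.aemeasurable).2 hX1, fun d => ?_,
    fun ξ => ?_, fun ξ => ?_, fun ξ => ?_⟩
  · rw [hd]
    have := mul_le_mul_of_nonneg_left (mul_min_abs_le_mul_integral hf.continuous hf.nonneg hc d)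
      (by positivity : 0 ≤ 1 / (1 - α))
    calc c / (1 - α) * min |d| 1 * |d| = 1 / (1 - α) * (c * min |d| 1 * |d|) := by ring
      _ ≤ _ := this
      _ = _ := by ring
  -- The Taylor error of the mean field is the integral of `f x - f θ`, which the Lipschitz bound
  -- makes quadratic.
  · have e : drift (P.map X) α ξ - f θ / (1 - α) * (ξ - θ)
        = 1 / (1 - α) * ∫ x in θ..ξ, (f x - f θ) := by
      rw [hd, intervalIntegral.integral_sub (hi _ _) intervalIntegrable_const,
        intervalIntegral.integral_const, smul_eq_mul]
      ring
    have hb : |∫ x in θ..ξ, (f x - f θ)| ≤ L * |ξ - θ| * |ξ - θ| :=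
      intervalIntegral.norm_integral_le_of_norm_le_const (C := L * |ξ - θ|)
        (f := fun x => f x - f θ) fun x hx => by
        have h1 := hL.dist_le_mul x θ
        rw [Real.dist_eq, Real.dist_eq] at h1
        refine h1.trans (mul_le_mul_of_nonneg_left ?_ L.2)
        exact Set.abs_sub_left_of_mem_uIcc (Set.uIoc_subset_uIcc hx)
    rw [e, abs_mul, abs_of_pos (by positivity), ← sq_abs]
    calc 1 / (1 - α) * |∫ x in θ..ξ, (f x - f θ)| ≤ 1 / (1 - α) * (L * |ξ - θ| * |ξ - θ|) := by
          gcongr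
      _ = _ := by ring
  · rw [integral_sq_H₁_sub hα, hd0, sub_zero]
    calc 1 / (1 - α) * |drift (P.map X) α ξ| ≤ 1 / (1 - α) * (1 / (1 - α) * (C * |ξ - θ|)) := by
          gcongr
          exact habs ξ
      _ = _ := by ring
  -- One constant serves both this bound and the previous one; the additional factor `1 / (1 - α)`
  -- is at least `1`.
  · refine (habs ξ).trans ?_
    rw [mul_assoc ((1 / (1 - α)) ^ 2)]
    refine mul_le_mul_of_nonneg_right ?_ (by positivity)
    nlinarith

lemma objective_eq_integral (hX : Measurable X) (hX1 : Integrable X P) (ξ : ℝ) :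
    objective P α X ξ = ∫ x, shortfallLoss α ξ x ∂(P.map X) := by
  have hm : Measurable (shortfallLoss α ξ) :=
    (measurable_shortfallLoss α).comp measurable_prodMk_left
  rw [integral_map hX.aemeasurable hm.aestronglyMeasurable]
  have hi : Integrable (fun ω => max (X ω - ξ) 0) P := (hX1.sub (integrable_const ξ)).pos_part
  simp only [shortfallLoss, objective]
  rw [integral_add (integrable_const _) (hi.const_mul _), integral_const_mul]
  simp

variable {θ a c C L : ℝ}

lemma RegularQuantile.objective_le (hα : α ∈ Set.Ioo (0 : ℝ) 1) (hX : Measurable X)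
    (hX1 : Integrable X P) (h : RegularQuantile (P.map X) α θ a c C L) (η : ℝ) :
    objective P α X θ ≤ objective P α X η := by
  have := Measure.isProbabilityMeasure_map hX.aemeasurable (μ := P)
  have h1 := drift_mul_le hα h.integrable_id θ η
  rw [h.drift_eq_zero, zero_mul] at h1
  rw [objective_eq_integral hX hX1, objective_eq_integral hX hX1]
  linarith

/-- For a second minimizer `η`, the restoring force at the midpoint of `θ` and `η` is nonzero and
points away from `θ` as a subgradient, so the objective at `η` strictly exceeds its value at the
midpoint, which is at least the minimum. -/
lemma RegularQuantile.argminSet_eq (hα : α ∈ Set.Ioo (0 : ℝ) 1) (hX : Measurable X)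
    (hX1 : Integrable X P) (h : RegularQuantile (P.map X) α θ a c C L) (hc : 0 < c) :
    argminSet P α X = {θ} := by
  have := Measure.isProbabilityMeasure_map hX.aemeasurable (μ := P)
  refine Set.eq_singleton_iff_unique_mem.2 ⟨fun η => h.objective_le hα hX hX1 η, fun η hη => ?_⟩
  by_contra hne
  have hd : 0 < |(η - θ) / 2| := abs_pos.2 (div_ne_zero (sub_ne_zero.2 hne) two_ne_zero)
  have h1 := h.restoring ((η - θ) / 2)
  have hpos : 0 < c * min |(η - θ) / 2| 1 * |(η - θ) / 2| := by positivity
  have h2 := drift_mul_le hα h.integrable_id (θ + (η - θ) / 2) η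
  have h3 := hη θ
  have h4 := h.objective_le hα hX hX1 (θ + (η - θ) / 2)
  rw [objective_eq_integral hX hX1, objective_eq_integral hX hX1] at h3 h4
  have e : η - (θ + (η - θ) / 2) = (η - θ) / 2 := by ring
  rw [e] at h2
  linarith

lemma RegularQuantile.minimizer_eq (hα : α ∈ Set.Ioo (0 : ℝ) 1) (hX : Measurable X)
    (hX1 : Integrable X P) (h : RegularQuantile (P.map X) α θ a c C L) (hc : 0 < c) :
    minimizer P α X = θ := by
  rw [minimizer, h.argminSet_eq hα hX hX1 hc, csInf_singleton]

lemma RegularQuantile.minValue_eq (hα : α ∈ Set.Ioo (0 : ℝ) 1) (hX : Measurable X)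
    (hX1 : Integrable X P) (h : RegularQuantile (P.map X) α θ a c C L) :
    minValue P α X = objective P α X θ :=
  le_antisymm (ciInf_le ⟨objective P α X θ, by
    rintro _ ⟨η, rfl⟩
    exact h.objective_le hα hX hX1 η⟩ θ) (le_ciInf fun η => h.objective_le hα hX hX1 η)

end Pdf

/-! ### Convergence of the values-at-risk. -/

section Quantiles

variable {Ω : Type*} [MeasurableSpace Ω] {P : Measure Ω} [IsProbabilityMeasure P]
  {α : ℝ} {X₀ : Ω → ℝ} {X : ℕ+ → Ω → ℝ} {f₀ : ℝ → ℝ} {f : ℕ+ → ℝ → ℝ}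

lemma tendsto_bias : Tendsto bias atTop (𝓝 0) := by
  unfold bias
  exact tendsto_const_nhds.div_atTop (tendsto_natCast_atTop_atTop.comp tendsto_PNat_val_atTop_atTop)

/-- The value-at-risk of the exact loss minimizes the objective. -/
lemma RegularLaws.regularQuantile_exact (hreg : RegularLaws P α X₀ X f₀ f)
    (hα : α ∈ Set.Ioo (0 : ℝ) 1) (hX₀ : Measurable X₀) (hX₀1 : Integrable X₀ P) :
    ∃ c C L, 0 < c ∧
      RegularQuantile (P.map X₀) α (valueAtRisk P α X₀) (f₀ (valueAtRisk P α X₀) / (1 - α)) c C L := by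
  -- Radius `2` because the closed unit neighbourhood must fit into an open ball.
  obtain ⟨c, hc, hcf⟩ := hreg.pdf_lower 2 two_pos
  obtain ⟨C, hC⟩ := hreg.pdf_upper
  obtain ⟨L, hL, -⟩ := hreg.pdf_lipschitz
  have hα1 : 0 < 1 - α := by linarith [hα.2]
  exact ⟨_, _, _, by positivity, hreg.pdf_exact.regularQuantile hX₀ hX₀1 hα
    (hreg.pdf_exact.cdfOf_valueAtRisk hX₀ hα)
    (fun x hx => (hcf x (by rw [Metric.mem_ball, Real.dist_eq]; linarith)).1)
    (fun x => (hC x).1) hL⟩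

/-- Convergence of the values-at-risk of the nested losses. -/
lemma RegularLaws.tendsto_valueAtRisk (hreg : RegularLaws P α X₀ X f₀ f)
    (hα : α ∈ Set.Ioo (0 : ℝ) 1) (hX₀ : Measurable X₀) (hX₀1 : Integrable X₀ P)
    (hX : ∀ K, Measurable (X K)) :
    Tendsto (fun K => valueAtRisk P α (X K)) atTop (𝓝 (valueAtRisk P α X₀)) := by
  set q := valueAtRisk P α X₀ with hq
  obtain ⟨c, hc, hcf⟩ := hreg.pdf_lower 2 two_pos
  obtain ⟨c', C', L', hc', hRQ⟩ := hreg.regularQuantile_exact hα hX₀ hX₀1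
  -- The expansion of the distribution functions is available at `q` because `q` minimizes the
  -- limiting objective. A uniform lower bound on the densities then converts the gap in probability
  -- into a gap between quantiles, truncated at `1`.
  have hcdf : Tendsto (fun K => |cdfOf P (X K) q - α|) atTop (𝓝 0) := by
    obtain ⟨v, w, hexp, hlim⟩ := hreg.expansion
    obtain ⟨-, hw, -⟩ := hlim q (by rw [hRQ.argminSet_eq hα hX₀ hX₀1 hc']; rfl)
    have h := ((tendsto_bias.const_mul (v q)).add (hw.mul tendsto_bias)).abs
    simp only [mul_zero, add_zero, abs_zero] at h
    refine h.congr fun K => ?_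
    rw [← hexp K q, hreg.pdf_exact.cdfOf_valueAtRisk hX₀ hα]
  have hmin : ∀ K, c * min |valueAtRisk P α (X K) - q| 1 ≤ |cdfOf P (X K) q - α| := by
    intro K
    set d := valueAtRisk P α (X K) - q with hd
    have h := mul_min_abs_le_mul_integral (hreg.pdf_nested K).continuous (hreg.pdf_nested K).nonneg
      (c := c) (p := q)
      (fun x hx => (hcf x (by rw [Metric.mem_ball, Real.dist_eq]; linarith)).2 K) d
    rw [← (hreg.pdf_nested K).cdfOf_sub (hX K), hd, add_sub_cancel,
      (hreg.pdf_nested K).cdfOf_valueAtRisk (hX K) hα, ← hd] at h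
    rcases eq_or_ne d 0 with h0 | h0
    · simp [h0]
    · have hdp : 0 < |d| := abs_pos.2 h0
      have h2 : d * (α - cdfOf P (X K) q) ≤ |cdfOf P (X K) q - α| * |d| := by
        rw [abs_sub_comm, ← abs_mul, mul_comm]
        exact le_abs_self _
      exact le_of_mul_le_mul_right (h.trans h2) hdp
  have hmin0 : Tendsto (fun K => min |valueAtRisk P α (X K) - q| 1) atTop (𝓝 0) := by
    have h := hcdf.const_mul c⁻¹
    rw [mul_zero] at h
    refine squeeze_zero (fun K => by positivity) (fun K => ?_) h
    rw [← div_eq_inv_mul, le_div_iff₀ hc, mul_comm]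
    exact hmin K
  rw [tendsto_iff_dist_tendsto_zero]
  refine hmin0.congr' ?_
  filter_upwards [hmin0.eventually_lt_const one_pos] with K hK
  rw [Real.dist_eq]
  exact min_eq_left (not_lt.1 fun h => by rw [min_eq_right h.le] at hK; exact lt_irrefl _ hK)

end Quantiles

/-! ### Characteristic functions of rows of i.i.d. variables. -/

section CharFun

/-- The derivative of `exp (i t) - i t` has modulus at most `|t|`; apply the mean value inequality
on the interval of radius `|x| + |y|`. Subtracting the linear term costs nothing for centered
variables and gains a second power of the frequency. -/
lemma norm_exp_mul_I_sub_sub_le (x y : ℝ) :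
    ‖(Complex.exp (x * Complex.I) - x * Complex.I) - (Complex.exp (y * Complex.I) - y * Complex.I)‖
      ≤ (|x| + |y|) * |x - y| := by
  have hd : ∀ t : ℝ, HasDerivAt (fun t : ℝ => Complex.exp (t * Complex.I) - t * Complex.I)
      (Complex.exp (t * Complex.I) * Complex.I - Complex.I) t := by
    intro t
    have h1 : HasDerivAt (fun t : ℝ => (t : ℂ) * Complex.I) Complex.I t := by
      simpa using (Complex.ofRealCLM.hasDerivAt (x := t)).mul_const Complex.I
    exact h1.cexp.sub h1
  have hb : ∀ t ∈ Set.Icc (-(|x| + |y|)) (|x| + |y|),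
      ‖Complex.exp (t * Complex.I) * Complex.I - Complex.I‖ ≤ |x| + |y| := by
    intro t ht
    have e : Complex.exp (t * Complex.I) * Complex.I - Complex.I
        = (Complex.exp (Complex.I * t) - 1) * Complex.I := by
      rw [mul_comm (t : ℂ)]; ring
    rw [e, norm_mul, Complex.norm_I, mul_one]
    exact Real.norm_exp_I_mul_ofReal_sub_one_le.trans (abs_le.2 ht)
  have hx : x ∈ Set.Icc (-(|x| + |y|)) (|x| + |y|) :=
    abs_le.1 (by linarith [abs_nonneg y])
  have hy : y ∈ Set.Icc (-(|x| + |y|)) (|x| + |y|) :=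
    abs_le.1 (by linarith [abs_nonneg x])
  exact (convex_Icc _ _).norm_image_sub_le_of_norm_hasDerivWithin_le
    (fun t _ => (hd t).hasDerivWithinAt) hb hy hx

lemma norm_pow_sub_pow_le_mul {a b : ℂ} (ha : ‖a‖ ≤ 1) (hb : ‖b‖ ≤ 1) (n : ℕ) :
    ‖a ^ n - b ^ n‖ ≤ n * ‖a - b‖ := by
  induction n with
  | zero => simp
  | succ n ih =>
    have e : a ^ (n + 1) - b ^ (n + 1) = (a ^ n - b ^ n) * a + b ^ n * (a - b) := by ring
    have hbn : ‖b ^ n‖ ≤ 1 := by rw [norm_pow]; exact pow_le_one₀ (norm_nonneg _) hb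
    rw [e]
    refine (norm_add_le _ _).trans ?_
    rw [norm_mul, norm_mul]
    push_cast
    have h1 := mul_le_mul_of_nonneg_left ha (norm_nonneg (a ^ n - b ^ n))
    have h2 := mul_le_mul_of_nonneg_right hbn (norm_nonneg (a - b))
    linarith

variable {Ω : Type*} [MeasurableSpace Ω] {P : Measure Ω} [IsProbabilityMeasure P]

omit [IsProbabilityMeasure P] in
lemma integral_mul_abs_le_sqrt_mul_sqrt {f g : Ω → ℝ} (hf : MemLp f 2 P) (hg : MemLp g 2 P) :
    ∫ ω, |f ω| * |g ω| ∂P ≤ √(∫ ω, f ω ^ 2 ∂P) * √(∫ ω, g ω ^ 2 ∂P) := by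
  have h := integral_mul_le_Lp_mul_Lq_of_nonneg (μ := P) Real.HolderConjugate.two_two
    (f := fun ω => |f ω|) (g := fun ω => |g ω|) (Eventually.of_forall fun ω => abs_nonneg _)
    (Eventually.of_forall fun ω => abs_nonneg _) (by rw [ENNReal.ofReal_ofNat]; exact hf.abs)
    (by rw [ENNReal.ofReal_ofNat]; exact hg.abs)
  simpa only [Real.rpow_two, sq_abs, ← Real.sqrt_eq_rpow] using h

/-- Comparison of the characteristic functions of two coupled centered random variables. -/
lemma norm_charFun_sub_le {S T : Ω → ℝ} (hS : MemLp S 2 P) (hT : MemLp T 2 P)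
    (hS0 : ∫ ω, S ω ∂P = 0) (hT0 : ∫ ω, T ω ∂P = 0) (s : ℝ) :
    ‖charFun (P.map S) s - charFun (P.map T) s‖
      ≤ s ^ 2 * ((√(∫ ω, S ω ^ 2 ∂P) + √(∫ ω, T ω ^ 2 ∂P)) * √(∫ ω, (S ω - T ω) ^ 2 ∂P)) := by
  have key : ∀ {R : Ω → ℝ}, MemLp R 2 P → ∫ ω, R ω ∂P = 0 →
      Integrable (fun ω => Complex.exp ((s * R ω : ℝ) * Complex.I)
        - ((s * R ω : ℝ) : ℂ) * Complex.I) P ∧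
      charFun (P.map R) s = ∫ ω, (Complex.exp ((s * R ω : ℝ) * Complex.I)
        - ((s * R ω : ℝ) : ℂ) * Complex.I) ∂P := by
    intro R hR hR0
    have hm := hR.aestronglyMeasurable.aemeasurable
    have h1 : Integrable (fun ω => Complex.exp ((s * R ω : ℝ) * Complex.I)) P := by
      refine Integrable.of_bound ?_ 1 (Eventually.of_forall fun ω => ?_)
      · exact (Complex.measurable_exp.comp_aemeasurable
          ((Complex.measurable_ofReal.comp_aemeasurable (hm.const_mul s)).mul_const
            _)).aestronglyMeasurable
      · rw [Complex.norm_exp_ofReal_mul_I]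
    have h2 : Integrable (fun ω => ((s * R ω : ℝ) : ℂ) * Complex.I) P :=
      ((hR.integrable one_le_two).const_mul s).ofReal.mul_const _
    refine ⟨h1.sub h2, ?_⟩
    rw [integral_sub h1 h2, integral_mul_const, integral_complex_ofReal, integral_const_mul, hR0,
      charFun_apply_real, integral_map hm]
    · simp
    · exact (Continuous.aestronglyMeasurable (by fun_prop))
  obtain ⟨iS, eS⟩ := key hS hS0
  obtain ⟨iT, eT⟩ := key hT hT0
  rw [eS, eT, ← integral_sub iS iT]
  have hST := hS.sub hT
  have i1 : Integrable (fun ω => |S ω| * |(S - T) ω|) P := hS.abs.integrable_mul hST.abs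
  have i2 : Integrable (fun ω => |T ω| * |(S - T) ω|) P := hT.abs.integrable_mul hST.abs
  have i3 : Integrable (fun ω => s ^ 2 * (|S ω| * |(S - T) ω| + |T ω| * |(S - T) ω|)) P :=
    (i1.add i2).const_mul _
  refine (norm_integral_le_of_norm_le i3 (Eventually.of_forall fun ω => ?_)).trans ?_
  · refine (norm_exp_mul_I_sub_sub_le _ _).trans_eq ?_
    rw [← mul_sub, abs_mul, abs_mul, abs_mul, Pi.sub_apply, ← sq_abs s]
    ring
  · rw [integral_const_mul, integral_add i1 i2, add_mul]
    refine mul_le_mul_of_nonneg_left (add_le_add ?_ ?_) (sq_nonneg s)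
    · exact integral_mul_abs_le_sqrt_mul_sqrt hS hST
    · exact integral_mul_abs_le_sqrt_mul_sqrt hT hST

/-- The classical central limit theorem after normalizing by the standard deviation. A vanishing
variance is treated separately: the variable is then almost surely zero. -/
lemma tendsto_charFun_inv_sqrt_pow_exp {T : Ω → ℝ} (hT : MemLp T 2 P) (hT0 : ∫ ω, T ω ∂P = 0) :
    Tendsto (fun n : ℕ => (charFun (P.map T) (√(n : ℝ))⁻¹) ^ n) atTop
      (𝓝 (Complex.exp (-((∫ ω, T ω ^ 2 ∂P : ℝ) : ℂ) / 2))) := by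
  have hm := hT.aestronglyMeasurable.aemeasurable
  set v := ∫ ω, T ω ^ 2 ∂P with hv
  have hv0 : 0 ≤ v := integral_nonneg fun ω => sq_nonneg _
  rcases hv0.eq_or_lt with h0 | hpos
  · have hae : T =ᵐ[P] fun _ => 0 := by
      have h := (integral_eq_zero_iff_of_nonneg (fun ω => sq_nonneg (T ω)) hT.integrable_sq).1
        (hv.symm.trans h0.symm)
      filter_upwards [h] with ω hω
      simpa using hω
    rw [← h0, Measure.map_congr hae]
    simp
  · set σ := √v with hσ
    have hσ0 : σ ≠ 0 := (Real.sqrt_pos.2 hpos).ne'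
    have hσ2 : σ ^ 2 = v := Real.sq_sqrt hv0
    have h := tendsto_charFun_inv_sqrt_mul_pow (P := P) (X := fun ω => σ⁻¹ * T ω)
      (hm.const_mul _) (by rw [integral_const_mul, hT0, mul_zero]) (by
        have e : ∀ ω, ((fun ω => σ⁻¹ * T ω) ^ 2) ω = (σ ^ 2)⁻¹ * T ω ^ 2 := fun ω => by
          simp only [Pi.pow_apply]; rw [mul_pow, inv_pow]
        simp_rw [e]
        rw [integral_const_mul, ← hv, hσ2, inv_mul_cancel₀ hpos.ne']) σ
    have e : -((v : ℝ) : ℂ) / 2 = -((σ : ℝ) : ℂ) ^ 2 / 2 := by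
      rw [← hσ2]; push_cast; ring
    rw [e]
    refine h.congr fun n => ?_
    rw [charFun_map_mul_comp hm]
    congr 2
    field_simp

/-- Characteristic functions of normalized row sums, for rows whose laws converge in `L²`. -/
lemma tendsto_charFun_row {T : ℕ+ → Ω → ℝ} {T₀ : Ω → ℝ} (hT : ∀ K, MemLp (T K) 2 P)
    (hT0 : MemLp T₀ 2 P) (hTm : ∀ K, ∫ ω, T K ω ∂P = 0) (hT0m : ∫ ω, T₀ ω ∂P = 0)
    (hlim : Tendsto (fun K => ∫ ω, (T K ω - T₀ ω) ^ 2 ∂P) atTop (𝓝 0)) :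
    Tendsto (fun K : ℕ+ => (charFun (P.map (T K)) (√((((K : ℕ) ^ 2 : ℕ)) : ℝ))⁻¹) ^ ((K : ℕ) ^ 2))
      atTop (𝓝 (Complex.exp (-((∫ ω, T₀ ω ^ 2 ∂P : ℝ) : ℂ) / 2))) := by
  have hsq : Tendsto (fun K : ℕ+ => (K : ℕ) ^ 2) atTop atTop :=
    (tendsto_pow_atTop two_ne_zero).comp tendsto_PNat_val_atTop_atTop
  have h0 := (tendsto_charFun_inv_sqrt_pow_exp hT0 hT0m).comp hsq
  have hd : Tendsto (fun K => √(∫ ω, (T K ω - T₀ ω) ^ 2 ∂P)) atTop (𝓝 0) := by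
    have := (Real.continuous_sqrt.tendsto 0).comp hlim
    rwa [Real.sqrt_zero] at this
  set v := ∫ ω, T₀ ω ^ 2 ∂P with hv
  have hbound : ∀ K, ∫ ω, T K ω ^ 2 ∂P ≤ 2 * ∫ ω, (T K ω - T₀ ω) ^ 2 ∂P + 2 * v := fun K => by
    have i1 : Integrable (fun ω => 2 * (T K ω - T₀ ω) ^ 2) P :=
      ((hT K).sub hT0).integrable_sq.const_mul 2
    have i2 : Integrable (fun ω => 2 * T₀ ω ^ 2) P := hT0.integrable_sq.const_mul 2
    rw [hv, ← integral_const_mul, ← integral_const_mul, ← integral_add i1 i2]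
    refine integral_mono (hT K).integrable_sq (i1.add i2) fun ω => ?_
    nlinarith [sq_nonneg (T K ω - 2 * T₀ ω)]
  have hfin : Tendsto (fun K => (√(2 * ∫ ω, (T K ω - T₀ ω) ^ 2 ∂P + 2 * v) + √v)
      * √(∫ ω, (T K ω - T₀ ω) ^ 2 ∂P)) atTop (𝓝 0) := by
    have h1 := (Real.continuous_sqrt.tendsto _).comp ((hlim.const_mul 2).add_const (2 * v))
    have h2 := (h1.add_const (√v)).mul hd
    rwa [mul_zero] at h2
  -- Raising to the power `n = K²` multiplies the distance by at most `n`, exactly offset by the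
  -- squared frequency `1 / n`. What remains is the `L²` distance times bounded norms, so no
  -- Lindeberg condition has to be checked.
  have hdiff : Tendsto (fun K : ℕ+ =>
      (charFun (P.map (T K)) (√((((K : ℕ) ^ 2 : ℕ)) : ℝ))⁻¹) ^ ((K : ℕ) ^ 2)
        - (charFun (P.map T₀) (√((((K : ℕ) ^ 2 : ℕ)) : ℝ))⁻¹) ^ ((K : ℕ) ^ 2)) atTop (𝓝 0) := by
    refine squeeze_zero_norm (fun K => ?_) hfin
    have := Measure.isProbabilityMeasure_map (μ := P) (hT K).aestronglyMeasurable.aemeasurable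
    have := Measure.isProbabilityMeasure_map (μ := P) hT0.aestronglyMeasurable.aemeasurable
    refine (norm_pow_sub_pow_le_mul (norm_charFun_le_one _) (norm_charFun_le_one _) _).trans ?_
    have hK : (0 : ℝ) < (((K : ℕ) ^ 2 : ℕ) : ℝ) := by
      have := K.pos
      positivity
    refine (mul_le_mul_of_nonneg_left (norm_charFun_sub_le (hT K) hT0 (hTm K) hT0m _)
      hK.le).trans ?_
    rw [inv_pow, Real.sq_sqrt hK.le, ← mul_assoc, mul_inv_cancel₀ hK.ne', one_mul]
    have := hbound K
    gcongr
  have := hdiff.add h0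
  rw [zero_add] at this
  refine this.congr fun K => ?_
  simp only [Function.comp_apply]
  ring

end CharFun

/-! ### Stability of mean square convergence. -/

section MeanSquare

variable {Ω : Type*} [MeasurableSpace Ω] {P : Measure Ω} [IsProbabilityMeasure P]
  {F G : ℕ+ → Ω → ℝ} {F₀ G₀ : Ω → ℝ}

omit [IsProbabilityMeasure P] in
lemma tendsto_integral_sq_sub_linear (hF : ∀ K, MemLp (F K) 2 P) (hF₀ : MemLp F₀ 2 P)
    (hG : ∀ K, MemLp (G K) 2 P) (hG₀ : MemLp G₀ 2 P)
    (hFl : Tendsto (fun K => ∫ ω, (F K ω - F₀ ω) ^ 2 ∂P) atTop (𝓝 0))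
    (hGl : Tendsto (fun K => ∫ ω, (G K ω - G₀ ω) ^ 2 ∂P) atTop (𝓝 0)) (a b : ℝ) :
    Tendsto (fun K => ∫ ω, ((a * F K ω + b * G K ω) - (a * F₀ ω + b * G₀ ω)) ^ 2 ∂P) atTop
      (𝓝 0) := by
  have h := (hFl.const_mul (2 * a ^ 2)).add (hGl.const_mul (2 * b ^ 2))
  simp only [mul_zero, add_zero] at h
  refine squeeze_zero (fun K => integral_nonneg fun ω => sq_nonneg _) (fun K => ?_) h
  have i1 : Integrable (fun ω => 2 * a ^ 2 * (F K ω - F₀ ω) ^ 2) P :=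
    ((hF K).sub hF₀).integrable_sq.const_mul _
  have i2 : Integrable (fun ω => 2 * b ^ 2 * (G K ω - G₀ ω) ^ 2) P :=
    ((hG K).sub hG₀).integrable_sq.const_mul _
  rw [← integral_const_mul, ← integral_const_mul, ← integral_add i1 i2]
  refine integral_mono_of_nonneg (Eventually.of_forall fun ω => sq_nonneg _) (i1.add i2)
    (Eventually.of_forall fun ω => ?_)
  nlinarith [sq_nonneg (a * (F K ω - F₀ ω) - b * (G K ω - G₀ ω))]

omit [IsProbabilityMeasure P] in
lemma tendsto_integral_sq_sub_mul (hF : ∀ K, MemLp (F K) 2 P) (hF₀ : MemLp F₀ 2 P)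
    (hFl : Tendsto (fun K => ∫ ω, (F K ω - F₀ ω) ^ 2 ∂P) atTop (𝓝 0))
    {a : ℕ+ → ℝ} {a₀ : ℝ} (ha : Tendsto a atTop (𝓝 a₀)) :
    Tendsto (fun K => ∫ ω, (a K * F K ω - a₀ * F₀ ω) ^ 2 ∂P) atTop (𝓝 0) := by
  have h1 := ((ha.pow 2).const_mul 2).mul hFl
  have h2 := (((ha.sub_const a₀).pow 2).const_mul 2).mul_const (∫ ω, F₀ ω ^ 2 ∂P)
  have h := h1.add h2
  simp only [sub_self, mul_zero, zero_mul, add_zero, ne_eq, OfNat.ofNat_ne_zero,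
    not_false_eq_true, zero_pow] at h
  refine squeeze_zero (fun K => integral_nonneg fun ω => sq_nonneg _) (fun K => ?_) h
  have i1 : Integrable (fun ω => 2 * a K ^ 2 * (F K ω - F₀ ω) ^ 2) P :=
    ((hF K).sub hF₀).integrable_sq.const_mul _
  have i2 : Integrable (fun ω => 2 * (a K - a₀) ^ 2 * F₀ ω ^ 2) P := hF₀.integrable_sq.const_mul _
  rw [← integral_const_mul, ← integral_const_mul, ← integral_add i1 i2]
  refine integral_mono_of_nonneg (Eventually.of_forall fun ω => sq_nonneg _) (i1.add i2)
    (Eventually.of_forall fun ω => ?_)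
  nlinarith [sq_nonneg (a K * (F K ω - F₀ ω) - (a K - a₀) * F₀ ω)]

/-- Centering a difference replaces its second moment by its variance, which is smaller. -/
lemma tendsto_integral_sq_sub_center (hF : ∀ K, MemLp (F K) 2 P) (hF₀ : MemLp F₀ 2 P)
    (hFl : Tendsto (fun K => ∫ ω, (F K ω - F₀ ω) ^ 2 ∂P) atTop (𝓝 0)) :
    Tendsto (fun K => ∫ ω, ((F K ω - ∫ ω', F K ω' ∂P) - (F₀ ω - ∫ ω', F₀ ω' ∂P)) ^ 2 ∂P) atTop
      (𝓝 0) := by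
  refine squeeze_zero (fun K => integral_nonneg fun ω => sq_nonneg _) (fun K => ?_) hFl
  have hm : AEMeasurable (fun ω => F K ω - F₀ ω) P :=
    ((hF K).sub hF₀).aestronglyMeasurable.aemeasurable
  have h := variance_le_expectation_sq hm.aestronglyMeasurable
  rw [variance_eq_integral hm, integral_sub ((hF K).integrable one_le_two) (hF₀.integrable one_le_two)] at h
  refine le_trans (le_of_eq ?_) h
  congr 1
  ext ω
  ring

end MeanSquare

/-! ### A planar central limit theorem for triangular arrays. -/

section RowCLT

variable {Ω : Type*} [MeasurableSpace Ω] {P : Measure Ω} [IsProbabilityMeasure P]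

/-- Central limit theorem for triangular arrays in the plane whose rows are independent and
identically distributed, with laws converging in mean square along some coupling. -/
lemma tendstoInDistribution_row_sums {Xi : ℕ+ → ℕ → Ω → ℝ} (hXi : ∀ K n, Measurable (Xi K n))
    (hind : ∀ K, iIndepFun (Xi K) P) {X : ℕ+ → Ω → ℝ}
    (hlaw : ∀ K n, IdentDistrib (Xi K n) (X K) P P)
    {g₁ g₂ : ℕ+ → ℝ → ℝ} (hg₁ : ∀ K, Measurable (g₁ K)) (hg₂ : ∀ K, Measurable (g₂ K))
    {U₁ U₂ : Ω → ℝ} (hU₁ : MemLp U₁ 2 P) (hU₂ : MemLp U₂ 2 P)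
    (h₁ : ∀ K, MemLp (fun ω => g₁ K (X K ω)) 2 P) (h₂ : ∀ K, MemLp (fun ω => g₂ K (X K ω)) 2 P)
    (hU₁m : ∫ ω, U₁ ω ∂P = 0) (hU₂m : ∫ ω, U₂ ω ∂P = 0)
    (h₁m : ∀ K, ∫ ω, g₁ K (X K ω) ∂P = 0) (h₂m : ∀ K, ∫ ω, g₂ K (X K ω) ∂P = 0)
    (hl₁ : Tendsto (fun K => ∫ ω, (g₁ K (X K ω) - U₁ ω) ^ 2 ∂P) atTop (𝓝 0))
    (hl₂ : Tendsto (fun K => ∫ ω, (g₂ K (X K ω) - U₂ ω) ^ 2 ∂P) atTop (𝓝 0))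
    {S : Matrix (Fin 2) (Fin 2) ℝ} (hS : S.PosSemidef)
    (hcov : ∀ x y : ℝ, ∫ ω, (x * U₁ ω + y * U₂ ω) ^ 2 ∂P = ![x, y] ⬝ᵥ S.mulVec ![x, y]) :
    TendstoInDistribution
      (fun (K : ℕ+) (ω : Ω) => (!₂[
          ((K : ℕ) : ℝ)⁻¹ * ∑ n ∈ Finset.range ((K : ℕ) ^ 2), g₁ K (Xi K n ω),
          ((K : ℕ) : ℝ)⁻¹ * ∑ n ∈ Finset.range ((K : ℕ) ^ 2), g₂ K (Xi K n ω)] :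
        EuclideanSpace ℝ (Fin 2)))
      atTop (id : EuclideanSpace ℝ (Fin 2) → EuclideanSpace ℝ (Fin 2)) (fun _ => P)
      (multivariateGaussian 0 S) := by
  have hm₁ : ∀ K : ℕ+, Measurable fun ω =>
      ((K : ℕ) : ℝ)⁻¹ * ∑ n ∈ Finset.range ((K : ℕ) ^ 2), g₁ K (Xi K n ω) := fun K =>
    (Finset.measurable_sum _ fun n _ => (hg₁ K).comp (hXi K n)).const_mul _
  have hm₂ : ∀ K : ℕ+, Measurable fun ω =>
      ((K : ℕ) : ℝ)⁻¹ * ∑ n ∈ Finset.range ((K : ℕ) ^ 2), g₂ K (Xi K n ω) := fun K =>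
    (Finset.measurable_sum _ fun n _ => (hg₂ K).comp (hXi K n)).const_mul _
  have hm : ∀ K : ℕ+, Measurable fun ω => (!₂[
      ((K : ℕ) : ℝ)⁻¹ * ∑ n ∈ Finset.range ((K : ℕ) ^ 2), g₁ K (Xi K n ω),
      ((K : ℕ) : ℝ)⁻¹ * ∑ n ∈ Finset.range ((K : ℕ) ^ 2), g₂ K (Xi K n ω)] :
        EuclideanSpace ℝ (Fin 2)) := fun K => by
    refine (MeasurableEquiv.toLp 2 (Fin 2 → ℝ)).measurable.comp (measurable_pi_lambda _ fun i => ?_)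
    fin_cases i
    · exact hm₁ K
    · exact hm₂ K
  have hchar : ∀ t : EuclideanSpace ℝ (Fin 2), Tendsto (fun K : ℕ+ => charFun (P.map fun ω => (!₂[
      ((K : ℕ) : ℝ)⁻¹ * ∑ n ∈ Finset.range ((K : ℕ) ^ 2), g₁ K (Xi K n ω),
      ((K : ℕ) : ℝ)⁻¹ * ∑ n ∈ Finset.range ((K : ℕ) ^ 2), g₂ K (Xi K n ω)] :
        EuclideanSpace ℝ (Fin 2))) t) atTop (𝓝 (charFun (multivariateGaussian 0 S) t)) := by
    intro t
    -- The Cramér–Wold device: a fixed frequency vector `t` reduces the claim to the scalar row `t 0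
    -- * g₁ + t 1 * g₂`, whose limiting variance is the quadratic form of `S`.
    have hrow := tendsto_charFun_row (P := P)
      (T := fun K ω => t 0 * g₁ K (X K ω) + t 1 * g₂ K (X K ω))
      (T₀ := fun ω => t 0 * U₁ ω + t 1 * U₂ ω)
      (fun K => ((h₁ K).const_mul _).add ((h₂ K).const_mul _))
      ((hU₁.const_mul _).add (hU₂.const_mul _))
      (fun K => by
        rw [integral_add (((h₁ K).integrable one_le_two).const_mul _)
          (((h₂ K).integrable one_le_two).const_mul _), integral_const_mul, integral_const_mul,
          h₁m, h₂m]
        simp)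
      (by
        rw [integral_add ((hU₁.integrable one_le_two).const_mul _)
          ((hU₂.integrable one_le_two).const_mul _), integral_const_mul, integral_const_mul,
          hU₁m, hU₂m]
        simp)
      (tendsto_integral_sq_sub_linear h₁ hU₁ h₂ hU₂ hl₁ hl₂ (t 0) (t 1))
    have ht : (![t 0, t 1] : Fin 2 → ℝ) = t.ofLp := by
      ext i; fin_cases i <;> rfl
    rw [hcov, ht] at hrow
    have e : charFun (multivariateGaussian 0 S) t
        = Complex.exp (-((t.ofLp ⬝ᵥ S.mulVec t.ofLp : ℝ) : ℂ) / 2) := by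
      rw [charFun_multivariateGaussian hS, inner_zero_right, Complex.ofReal_zero, zero_mul,
        zero_sub, neg_div]
    rw [e]
    refine hrow.congr fun K => ?_
    have hKs : √(((K : ℕ) ^ 2 : ℕ) : ℝ) = ((K : ℕ) : ℝ) := by
      push_cast
      exact Real.sqrt_sq (Nat.cast_nonneg _)
    set V : ℕ → Ω → ℝ := fun n ω => t 0 * g₁ K (Xi K n ω) + t 1 * g₂ K (Xi K n ω) with hV
    have hgm : Measurable fun x => t 0 * g₁ K x + t 1 * g₂ K x :=
      ((hg₁ K).const_mul _).add ((hg₂ K).const_mul _)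
    have hVind : iIndepFun V P := (hind K).comp (fun _ x => t 0 * g₁ K x + t 1 * g₂ K x)
      fun _ => hgm
    have hVid : ∀ n, IdentDistrib (V n) (V 0) P P := fun n =>
      ((hlaw K n).trans (hlaw K 0).symm).comp hgm
    have hV0 : P.map (V 0) = P.map fun ω => t 0 * g₁ K (X K ω) + t 1 * g₂ K (X K ω) :=
      ((hlaw K 0).comp hgm).map_eq
    have h := charFun_inv_sqrt_mul_sum hVind hVid (n := (K : ℕ) ^ 2) (t := 1)
    rw [hV0, mul_one] at h
    rw [← h, charFun_apply_real, charFun_apply, integral_map (hm K).aemeasurable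
      (Continuous.aestronglyMeasurable (by fun_prop)), integral_map]
    · congr 1
      ext ω
      congr 2
      rw [hKs, PiLp.inner_apply, Fin.sum_univ_two]
      simp only [hV, Finset.sum_add_distrib, ← Finset.mul_sum]
      simp
      ring
    · refine Measurable.aemeasurable ?_
      exact (Finset.measurable_sum _ fun n _ => hgm.comp (hXi K n)).const_mul _
    · exact Continuous.aestronglyMeasurable (by fun_prop)
  refine ⟨fun K => (hm K).aemeasurable, aemeasurable_id, ?_⟩
  -- Lévy's continuity theorem is applied along `ℕ`, and the result is carried back to `ℕ+` by the
  -- shift by one.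
  have hpred : Tendsto PNat.natPred atTop atTop :=
    tendsto_atTop_atTop_of_monotone (fun a b h => Nat.sub_le_sub_right h 1)
      fun b => ⟨Nat.succPNat b, by simp⟩
  have hsucc : Tendsto Nat.succPNat atTop atTop :=
    tendsto_atTop_atTop_of_monotone (fun a b h => Nat.succPNat_le_succPNat.2 h)
      fun b => ⟨PNat.natPred b, by simp⟩
  set ν : ℕ+ → ProbabilityMeasure (EuclideanSpace ℝ (Fin 2)) := fun K =>
    ⟨P.map fun ω => (!₂[
      ((K : ℕ) : ℝ)⁻¹ * ∑ n ∈ Finset.range ((K : ℕ) ^ 2), g₁ K (Xi K n ω),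
      ((K : ℕ) : ℝ)⁻¹ * ∑ n ∈ Finset.range ((K : ℕ) ^ 2), g₂ K (Xi K n ω)] :
        EuclideanSpace ℝ (Fin 2)), Measure.isProbabilityMeasure_map (hm K).aemeasurable⟩ with hν
  have hlim := ProbabilityMeasure.tendsto_of_tendsto_charFun (μ := fun n => ν n.succPNat)
    (μ₀ := ⟨(multivariateGaussian 0 S).map id,
      Measure.isProbabilityMeasure_map aemeasurable_id⟩) (fun t => by
        simp only [ProbabilityMeasure.coe_mk, Measure.map_id]
        exact (hchar t).comp hsucc)
  refine (hlim.comp hpred).congr fun K => ?_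
  simp only [Function.comp_apply, PNat.succPNat_natPred]

end RowCLT

/-! ### Mean square limits of the innovations and the limiting covariance. -/

section Limits

variable {Ω : Type*} [MeasurableSpace Ω] {P : Measure Ω} [IsProbabilityMeasure P] {α : ℝ}

/-- The two indicators disagree only when `x - q` and `x₀ - q₀` lie on different sides of the
threshold. Then either `x₀` is within `ε` of `q₀`, or the two differences are at least `ε` apart and
the quotient in the bound is at least `1`. -/
lemma sq_H₁_sub_le (hα : α ∈ Set.Ioo (0 : ℝ) 1) {ε : ℝ} (hε : 0 < ε) (q q₀ x x₀ : ℝ) :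
    (H₁ α q x - H₁ α q₀ x₀) ^ 2 ≤ (1 / (1 - α)) ^ 2 *
      ((if |x₀ - q₀| ≤ ε then 1 else 0) + ((x - q) - (x₀ - q₀)) ^ 2 / ε ^ 2) := by
  have hB : 0 < 1 / (1 - α) := one_div_pos.2 (by linarith [hα.2])
  have hle : (H₁ α q x - H₁ α q₀ x₀) ^ 2 ≤ (1 / (1 - α)) ^ 2 * 1 := by
    rw [mul_one]
    unfold H₁
    split_ifs <;> nlinarith
  have hs : 0 ≤ ((x - q) - (x₀ - q₀)) ^ 2 / ε ^ 2 := by positivity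
  split_ifs with h
  · refine hle.trans (mul_le_mul_of_nonneg_left ?_ (sq_nonneg _))
    linarith
  · rcases le_or_gt ε |(x - q) - (x₀ - q₀)| with h1 | h1
    · refine hle.trans (mul_le_mul_of_nonneg_left ?_ (sq_nonneg _))
      rw [zero_add, le_div_iff₀ (by positivity), one_mul, ← sq_abs ((x - q) - (x₀ - q₀))]
      gcongr
    · have e : H₁ α q x - H₁ α q₀ x₀ = 0 := by
        have h2 := abs_lt.1 h1
        rcases lt_abs.1 (not_le.1 h) with h3 | h3
        · have a1 : q₀ ≤ x₀ := by linarith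
          have a2 : q ≤ x := by linarith [h2.1]
          simp [H₁, a1, a2]
        · have a1 : ¬ q₀ ≤ x₀ := by linarith
          have a2 : ¬ q ≤ x := by linarith [h2.2]
          simp [H₁, a1, a2]
      rw [e, zero_add, zero_pow two_ne_zero]
      exact mul_nonneg (sq_nonneg _) hs

lemma IsContinuousPdf.measureReal_abs_sub_le {X : Ω → ℝ} {f : ℝ → ℝ} (hX : Measurable X)
    (hf : IsContinuousPdf P X f) {C : ℝ} (hC : ∀ x, f x ≤ C) (q : ℝ) {ε : ℝ} (hε : 0 < ε) :
    P.real {ω | |X ω - q| ≤ ε} ≤ 3 * C * ε := by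
  -- The closed interval is enlarged on the left to a half-open interval of length `3 ε`, whose
  -- probability is a difference of values of the distribution function.
  have hsub : {ω | |X ω - q| ≤ ε} ⊆ {ω | X ω ≤ q + ε} \ {ω | X ω ≤ q - 2 * ε} := fun ω hω => by
    have h := abs_le.1 (show |X ω - q| ≤ ε from hω)
    exact ⟨show X ω ≤ q + ε by linarith [h.2],
      fun h' => by linarith [h.1, show X ω ≤ q - 2 * ε from h']⟩
  have hd : P.real ({ω | X ω ≤ q + ε} \ {ω | X ω ≤ q - 2 * ε})
      = cdfOf P X (q + ε) - cdfOf P X (q - 2 * ε) := by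
    refine measureReal_sdiff (fun ω hω => ?_) (measurableSet_le hX measurable_const)
    exact le_trans (show X ω ≤ q - 2 * ε from hω) (by linarith)
  refine (measureReal_mono hsub).trans ?_
  rw [hd, hf.cdfOf_sub hX]
  have hle : ∫ x in (q - 2 * ε)..(q + ε), f x ≤ ∫ _ in (q - 2 * ε)..(q + ε), C :=
    intervalIntegral.integral_mono_on (by linarith) (hf.continuous.intervalIntegrable _ _)
      intervalIntegrable_const fun x _ => hC x
  rw [intervalIntegral.integral_const, smul_eq_mul] at hle
  linarith

variable {X : ℕ+ → Ω → ℝ} {X₀ : Ω → ℝ} {q : ℕ+ → ℝ} {q₀ : ℝ}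

lemma tendsto_integral_sq_sub_shift (hX : ∀ K, MemLp (X K) 2 P) (hX₀ : MemLp X₀ 2 P)
    (hlim : Tendsto (fun K => ∫ ω, (X K ω - X₀ ω) ^ 2 ∂P) atTop (𝓝 0))
    (hq : Tendsto q atTop (𝓝 q₀)) :
    Tendsto (fun K => ∫ ω, ((X K ω - q K) - (X₀ ω - q₀)) ^ 2 ∂P) atTop (𝓝 0) := by
  have h := (hlim.const_mul 2).add (((hq.sub_const q₀).pow 2).const_mul 2)
  simp only [sub_self, mul_zero, add_zero, ne_eq, OfNat.ofNat_ne_zero, not_false_eq_true,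
    zero_pow] at h
  refine squeeze_zero (fun K => integral_nonneg fun ω => sq_nonneg _) (fun K => ?_) h
  have i1 : Integrable (fun ω => 2 * (X K ω - X₀ ω) ^ 2) P :=
    ((hX K).sub hX₀).integrable_sq.const_mul _
  have e : ∫ ω, (2 * (X K ω - X₀ ω) ^ 2 + 2 * (q K - q₀) ^ 2) ∂P
      = 2 * ∫ ω, (X K ω - X₀ ω) ^ 2 ∂P + 2 * (q K - q₀) ^ 2 := by
    rw [integral_add i1 (integrable_const _), integral_const_mul]
    simp
  rw [← e]
  refine integral_mono_of_nonneg (Eventually.of_forall fun ω => sq_nonneg _)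
    (i1.add (integrable_const _)) (Eventually.of_forall fun ω => ?_)
  nlinarith [sq_nonneg ((X K ω - X₀ ω) + (q K - q₀))]

/-- The indicator is discontinuous, so mean square convergence of the arguments is not enough by
itself. The bounded density of `X₀` makes the region near the threshold of probability `O(ε)`;
elsewhere a Chebyshev-type bound tends to zero for fixed `ε`. -/
lemma tendsto_integral_sq_H₁_sub (hα : α ∈ Set.Ioo (0 : ℝ) 1) {f₀ : ℝ → ℝ} (hX₀m : Measurable X₀)
    (hf₀ : IsContinuousPdf P X₀ f₀) {C : ℝ} (hC : ∀ x, f₀ x ≤ C)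
    (hX : ∀ K, MemLp (X K) 2 P) (hX₀ : MemLp X₀ 2 P)
    (hlim : Tendsto (fun K => ∫ ω, (X K ω - X₀ ω) ^ 2 ∂P) atTop (𝓝 0))
    (hq : Tendsto q atTop (𝓝 q₀)) :
    Tendsto (fun K => ∫ ω, (H₁ α (q K) (X K ω) - H₁ α q₀ (X₀ ω)) ^ 2 ∂P) atTop (𝓝 0) := by
  set B : ℝ := 1 / (1 - α) with hB
  have hB0 : 0 < B := one_div_pos.2 (by linarith [hα.2])
  have hC0 : 0 ≤ C := (hf₀.nonneg 0).trans (hC 0)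
  have hsh := tendsto_integral_sq_sub_shift hX hX₀ hlim hq
  have hbound : ∀ ε > 0, ∀ K, ∫ ω, (H₁ α (q K) (X K ω) - H₁ α q₀ (X₀ ω)) ^ 2 ∂P
      ≤ B ^ 2 * (3 * C * ε + (∫ ω, ((X K ω - q K) - (X₀ ω - q₀)) ^ 2 ∂P) / ε ^ 2) := by
    intro ε hε K
    have hms : MeasurableSet {ω | |X₀ ω - q₀| ≤ ε} :=
      measurableSet_le (hX₀m.sub_const q₀).abs measurable_const
    have i1 : Integrable (fun ω => {ω | |X₀ ω - q₀| ≤ ε}.indicator (fun _ => (1 : ℝ)) ω) P :=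
      (integrable_const 1).indicator hms
    have i2 : Integrable (fun ω => ((X K ω - q K) - (X₀ ω - q₀)) ^ 2 / ε ^ 2) P :=
      (((hX K).sub (memLp_const _)).sub (hX₀.sub (memLp_const _))).integrable_sq.div_const _
    refine (integral_mono_of_nonneg (Eventually.of_forall fun ω => sq_nonneg _)
      ((i1.add i2).const_mul (B ^ 2)) (Eventually.of_forall fun ω => ?_)).trans ?_
    · refine (sq_H₁_sub_le hα hε (q K) q₀ (X K ω) (X₀ ω)).trans_eq ?_
      simp [Set.indicator, hB]
    · rw [integral_const_mul, integral_add' i1 i2, integral_indicator_const _ hms, integral_div,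
        smul_eq_mul, mul_one]
      have := hf₀.measureReal_abs_sub_le hX₀m hC q₀ hε
      gcongr
  refine tendsto_order.2 ⟨fun a ha => Eventually.of_forall fun K =>
    ha.trans_le (integral_nonneg fun ω => sq_nonneg _), fun η hη => ?_⟩
  -- Chosen so that the probability near the threshold costs at most `η / 2`; `3 * C + 1` instead of
  -- `3 * C` keeps the denominator positive.
  set ε : ℝ := η / (2 * (B ^ 2 * (3 * C + 1))) with hε
  have hε0 : 0 < ε := by positivity
  have h1 : Tendsto (fun K => B ^ 2 * ((∫ ω, ((X K ω - q K) - (X₀ ω - q₀)) ^ 2 ∂P) / ε ^ 2)) atTop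
      (𝓝 0) := by
    have := (hsh.div_const (ε ^ 2)).const_mul (B ^ 2)
    simpa using this
  filter_upwards [h1.eventually_lt_const (half_pos hη)] with K hK
  refine (hbound ε hε0 K).trans_lt ?_
  have h2 : B ^ 2 * (3 * C * ε) ≤ η / 2 := by
    have e : B ^ 2 * ((3 * C + 1) * ε) = η / 2 := by
      rw [hε]
      field_simp
    rw [← e]
    gcongr
    linarith
  linarith

lemma tendsto_integral_sq_shortfallLoss_sub (hX : ∀ K, MemLp (X K) 2 P) (hX₀ : MemLp X₀ 2 P)
    (hlim : Tendsto (fun K => ∫ ω, (X K ω - X₀ ω) ^ 2 ∂P) atTop (𝓝 0))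
    (hq : Tendsto q atTop (𝓝 q₀)) :
    Tendsto (fun K => ∫ ω, (shortfallLoss α (q K) (X K ω) - shortfallLoss α q₀ (X₀ ω)) ^ 2 ∂P)
      atTop (𝓝 0) := by
  have hsh := tendsto_integral_sq_sub_shift hX hX₀ hlim hq
  have h := (hsh.const_mul (2 * (1 / (1 - α)) ^ 2)).add (((hq.sub_const q₀).pow 2).const_mul 2)
  simp only [sub_self, mul_zero, add_zero, ne_eq, OfNat.ofNat_ne_zero, not_false_eq_true,
    zero_pow] at h
  refine squeeze_zero (fun K => integral_nonneg fun ω => sq_nonneg _) (fun K => ?_) h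
  have i1 : Integrable (fun ω => 2 * (1 / (1 - α)) ^ 2 * ((X K ω - q K) - (X₀ ω - q₀)) ^ 2) P :=
    (((hX K).sub (memLp_const _)).sub (hX₀.sub (memLp_const _))).integrable_sq.const_mul _
  have e : ∫ ω, (2 * (1 / (1 - α)) ^ 2 * ((X K ω - q K) - (X₀ ω - q₀)) ^ 2
        + 2 * (q K - q₀) ^ 2) ∂P
      = 2 * (1 / (1 - α)) ^ 2 * ∫ ω, ((X K ω - q K) - (X₀ ω - q₀)) ^ 2 ∂P
        + 2 * (q K - q₀) ^ 2 := by
    rw [integral_add i1 (integrable_const _), integral_const_mul]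
    simp
  rw [← e]
  refine integral_mono_of_nonneg (Eventually.of_forall fun ω => sq_nonneg _)
    (i1.add (integrable_const _)) (Eventually.of_forall fun ω => ?_)
  have hm : (max (X K ω - q K) 0 - max (X₀ ω - q₀) 0) ^ 2
      ≤ ((X K ω - q K) - (X₀ ω - q₀)) ^ 2 := by
    exact sq_le_sq.2 (abs_max_sub_max_le_abs (X K ω - q K) (X₀ ω - q₀) 0)
  simp only [shortfallLoss]
  set B := 1 / (1 - α)
  set p := max (X K ω - q K) 0
  set p₀ := max (X₀ ω - q₀) 0
  have hm' := mul_le_mul_of_nonneg_left hm (by positivity : 0 ≤ 2 * B ^ 2)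
  nlinarith [sq_nonneg (B * (p - p₀) - (q K - q₀))]

lemma memLp_shortfallLoss {Y : Ω → ℝ} (hY : MemLp Y 2 P) (ξ : ℝ) :
    MemLp (fun ω => shortfallLoss α ξ (Y ω)) 2 P := by
  have h : MemLp (fun ω => max (Y ω - ξ) 0) 2 P := (hY.sub (memLp_const ξ)).pos_part
  exact (memLp_const ξ).add (h.const_mul _)

lemma memLp_H₁ (hα : α ∈ Set.Ioo (0 : ℝ) 1) {Y : Ω → ℝ} (hY : Measurable Y) (ξ : ℝ) :
    MemLp (fun ω => H₁ α ξ (Y ω)) 2 P :=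
  MemLp.of_bound ((measurable_H₁_right α ξ).comp hY).aestronglyMeasurable (1 / (1 - α))
    (Eventually.of_forall fun ω => abs_H₁_le hα ξ (Y ω))

/-- The limiting covariance matrix is the covariance matrix of the linearized innovations. -/
lemma integral_sq_linear_eq_limitCov (hα : α ∈ Set.Ioo (0 : ℝ) 1) (hX₀m : Measurable X₀)
    (hX₀ : MemLp X₀ 2 P) (hq₀ : ∫ ω, H₁ α q₀ (X₀ ω) ∂P = 0) {f₀ : ℝ → ℝ} (hf₀ : f₀ q₀ ≠ 0)
    (x y : ℝ) :
    ∫ ω, (x * (-((f₀ q₀ / (1 - α))⁻¹) * H₁ α q₀ (X₀ ω)) + y * (shortfallLoss α q₀ (X₀ ω)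
        - ∫ ω', shortfallLoss α q₀ (X₀ ω') ∂P)) ^ 2 ∂P
      = ![x, y] ⬝ᵥ (limitCov P α X₀ f₀ q₀).mulVec ![x, y] := by
  have hα1 : 1 - α ≠ 0 := by linarith [hα.2]
  set p : Ω → ℝ := fun ω => max (X₀ ω - q₀) 0 with hp
  have hp2 : MemLp p 2 P := (hX₀.sub (memLp_const q₀)).pos_part
  have hp1 : Integrable p P := hp2.integrable one_le_two
  set m := ∫ ω, p ω ∂P with hm
  set B : ℝ := 1 / (1 - α) with hB
  set b : ℝ := (f₀ q₀ / (1 - α))⁻¹ with hb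
  have hH1 : Integrable (fun ω => H₁ α q₀ (X₀ ω)) P := (memLp_H₁ hα hX₀m q₀).integrable one_le_two
  have hχ : ∫ ω', shortfallLoss α q₀ (X₀ ω') ∂P = q₀ + B * m := by
    simp only [shortfallLoss]
    rw [integral_add (integrable_const _) (hp1.const_mul _), integral_const_mul]
    simp only [integral_const, probReal_univ, one_smul]
    rfl
  -- `H₁` takes only the values `1` and `1 - B`, so its square is affine in it. As `H₁` is centered,
  -- its variance is `B - 1 = α / (1 - α)`. The excess `p` vanishes where `H₁ = 1`, so the product
  -- of the two is `(1 - B) p`.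
  have hsqH : ∀ ω, H₁ α q₀ (X₀ ω) ^ 2 = (2 - B) * H₁ α q₀ (X₀ ω) + (B - 1) := fun ω => by
    simp only [H₁]
    split_ifs <;> ring
  have hHp : ∀ ω, H₁ α q₀ (X₀ ω) * p ω = (1 - B) * p ω := fun ω => by
    simp only [H₁, hp]
    split_ifs with h
    · ring
    · rw [max_eq_right (by linarith)]
      ring
  have hpt : ∀ ω, (x * (-b * H₁ α q₀ (X₀ ω)) + y * (shortfallLoss α q₀ (X₀ ω)
        - (q₀ + B * m))) ^ 2
      = ((x * b) ^ 2 * (2 - B) + 2 * (x * b) * (y * B) * m) * H₁ α q₀ (X₀ ω)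
        + (x * b) ^ 2 * (B - 1) + (-2 * (x * b) * (y * B) * (1 - B)) * p ω
        + (y * B) ^ 2 * (p ω - m) ^ 2 := fun ω => by
    have e : shortfallLoss α q₀ (X₀ ω) - (q₀ + B * m) = B * (p ω - m) := by
      simp only [shortfallLoss, hp]
      ring
    rw [e]
    have h1 := hsqH ω
    have h2 := hHp ω
    linear_combination (x * b) ^ 2 * h1 - 2 * (x * b) * (y * B) * h2
  have hvar : Var[p; P] = ∫ ω, (p ω - m) ^ 2 ∂P :=
    variance_eq_integral hp2.aestronglyMeasurable.aemeasurable
  rw [hχ]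
  simp_rw [hpt]
  have i4 : Integrable (fun ω => (y * B) ^ 2 * (p ω - m) ^ 2) P :=
    (hp2.sub (memLp_const m)).integrable_sq.const_mul _
  have i1 := hH1.const_mul ((x * b) ^ 2 * (2 - B) + 2 * (x * b) * (y * B) * m)
  have i2 : Integrable (fun ω => ((x * b) ^ 2 * (2 - B) + 2 * (x * b) * (y * B) * m)
      * H₁ α q₀ (X₀ ω) + (x * b) ^ 2 * (B - 1)) P := i1.add (integrable_const _)
  have i3 : Integrable (fun ω => ((x * b) ^ 2 * (2 - B) + 2 * (x * b) * (y * B) * m)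
      * H₁ α q₀ (X₀ ω) + (x * b) ^ 2 * (B - 1)
      + (-2 * (x * b) * (y * B) * (1 - B)) * p ω) P := i2.add (hp1.const_mul _)
  rw [integral_add i3 i4, integral_add i2 (hp1.const_mul _), integral_add i1 (integrable_const _),
    integral_const_mul, integral_const_mul, integral_const_mul, integral_const_mul, hq₀, ← hm,
    ← hvar]
  simp only [integral_const, probReal_univ, smul_eq_mul, limitCov, Matrix.mulVec,
    dotProduct, Fin.sum_univ_two, Matrix.cons_val_zero, Matrix.cons_val_one, Matrix.of_apply,
    Matrix.cons_val', Matrix.cons_val_fin_one]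
  rw [← hm, ← hp, hb, hB]
  field_simp
  ring

end Limits

/-! ### Uniform mean square rate and initial moments. -/

section Uniform

variable {Ω : Type*} [MeasurableSpace Ω] {P : Measure Ω} [IsProbabilityMeasure P] {α : ℝ}

/-- Uniform mean square rate for the value-at-risk iterates. -/
lemma exists_integral_sq_varIterate_le (hα : α ∈ Set.Ioo (0 : ℝ) 1) {c lam γ₁ β M₀ : ℝ}
    {γ : ℕ → ℝ} (hc : 0 < c) (hlam0 : 0 < lam) (hlam1 : lam ≤ 1) (hγ₁ : 0 < γ₁)
    (hβ0 : 0 < β) (hβ1 : β < 1) (hγ : ∀ n : ℕ, γ (n + 1) = γ₁ * ((n : ℝ) + 1) ^ (-β)) :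
    -- `M` precedes the law, the quantile and the remaining regularity constants, since the
    -- recursion sees only `c`, `lam`, the step sizes and the initial bound `M₀`. This is what makes
    -- the rate uniform in the bias parameter.
    ∃ M : ℝ, 0 ≤ M ∧ ∀ (μ : Measure ℝ) (θ a C L : ℝ) (ξ₀ : Ω → ℝ) (X : ℕ → Ω → ℝ),
      IsProbabilityMeasure μ → RegularQuantile μ α θ a c C L → Measurable ξ₀ →
      (∀ n, Measurable (X n)) → (∀ n, P.map (X n) = μ) →
      (∀ n, IndepFun (past ξ₀ X n) (X n) P) →
      Integrable (fun ω => Real.cosh (lam * (ξ₀ ω - θ))) P →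
      ∫ ω, Real.cosh (lam * (ξ₀ ω - θ)) ∂P ≤ M₀ →
      ∀ n : ℕ, MemLp (fun ω => varIterate α γ ξ₀ X n ω - θ) 2 P ∧
        ∫ ω, (varIterate α γ ξ₀ X n ω - θ) ^ 2 ∂P ≤ M * ((n : ℝ) + 1) ^ (-β) := by
  obtain ⟨M, hM, hrec⟩ := exists_rate_of_recursion hβ0 hβ1 (κ := lam * c)
    (L := (lam * (1 / (1 - α))) ^ 2 * Real.exp (lam * γ₁ * (1 / (1 - α)))) (γ₁ := γ₁) (M₀ := M₀)
    (by positivity) (by positivity) hγ₁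
  refine ⟨2 / lam ^ 2 * M, by positivity,
    fun μ θ a C L ξ₀ X hμp hμ hξ₀ hX hlaw hind h0 hM0 n => ?_⟩
  have hg : ∀ n : ℕ, 0 ≤ γ (n + 1) := fun n => by rw [hγ]; positivity
  have hg1 : ∀ n : ℕ, γ (n + 1) ≤ γ₁ := fun n => by
    rw [hγ]
    exact mul_le_of_le_one_right hγ₁.le
      (Real.rpow_le_one_of_one_le_of_nonpos (by simp) (by linarith))
  have hu := hrec (fun n => ∫ ω, (Real.cosh (lam * (varIterate α γ ξ₀ X n ω - θ)) - 1) ∂P)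
    (fun n => integral_nonneg fun ω => sub_nonneg.2 (Real.one_le_cosh _))
    (by
      simp only [varIterate]
      rw [integral_sub h0 (integrable_const 1)]
      simp only [integral_const, probReal_univ, smul_eq_mul]
      linarith)
    (fun n => by
      have h := integral_cosh_sub_one_succ_le hα hμ hc.le hξ₀ hX hlaw hind hlam0 hlam1 hg hg1 h0 n
      rwa [hγ n] at h) n
  have hD := integrable_sq_of_integrable_cosh (P := P) hlam0
    ((measurable_varIterate hξ₀ hX n).sub_const θ)
    (integrable_cosh_varIterate (γ := γ) hα hξ₀ hX h0 n)
  refine ⟨hD.1, hD.2.trans ?_⟩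
  rw [mul_assoc]
  exact mul_le_mul_of_nonneg_left hu (by positivity)

/-- Exponential moments of the initial values from the integrability assumption. -/
lemma integrable_cosh_initial {ξ₀ : Ω → ℝ} (hξ₀ : Measurable ξ₀) {lam E S R θ : ℝ}
    (hlam0 : 0 ≤ lam) (hlam1 : lam ≤ 1) (hE : lam ≤ E) (hS0 : 0 ≤ S)
    (hS : ∫⁻ ω, ENNReal.ofReal (|ξ₀ ω| ^ 2 * Real.exp (E * |ξ₀ ω|)) ∂P ≤ ENNReal.ofReal S)
    (hθ : |θ| ≤ R) :
    Integrable (fun ω => Real.cosh (lam * (ξ₀ ω - θ))) P ∧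
      ∫ ω, Real.cosh (lam * (ξ₀ ω - θ)) ∂P ≤ Real.exp R * (Real.exp E + S) := by
  have hm : Measurable fun ω => |ξ₀ ω| ^ 2 * Real.exp (E * |ξ₀ ω|) :=
    (hξ₀.abs.pow_const 2).mul (Real.measurable_exp.comp (hξ₀.abs.const_mul E))
  have hnn : ∀ ω, 0 ≤ |ξ₀ ω| ^ 2 * Real.exp (E * |ξ₀ ω|) := fun ω => by positivity
  have hi : Integrable (fun ω => |ξ₀ ω| ^ 2 * Real.exp (E * |ξ₀ ω|)) P := by
    refine ⟨hm.aestronglyMeasurable, ?_⟩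
    rw [hasFiniteIntegral_iff_ofReal (Eventually.of_forall hnn)]
    exact hS.trans_lt ENNReal.ofReal_lt_top
  have hiS : ∫ ω, |ξ₀ ω| ^ 2 * Real.exp (E * |ξ₀ ω|) ∂P ≤ S := by
    rw [integral_eq_lintegral_of_nonneg_ae (Eventually.of_forall hnn) hm.aestronglyMeasurable]
    exact ENNReal.toReal_le_of_le_ofReal hS0 hS
  have hpt : ∀ ω, Real.cosh (lam * (ξ₀ ω - θ))
      ≤ Real.exp R * (Real.exp E + |ξ₀ ω| ^ 2 * Real.exp (E * |ξ₀ ω|)) := by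
    intro ω
    have h1 : Real.cosh (lam * (ξ₀ ω - θ)) ≤ Real.exp (E * |ξ₀ ω|) * Real.exp R := by
      rw [← Real.exp_add]
      have hc : ∀ z : ℝ, Real.cosh z ≤ Real.exp |z| := fun z => by
        have h := cosh_add_le_mul_exp 0 z
        simpa using h
      refine (hc _).trans (Real.exp_le_exp.2 ?_)
      rw [abs_mul, abs_of_nonneg hlam0]
      have h2 : |ξ₀ ω - θ| ≤ |ξ₀ ω| + |θ| := abs_sub _ _
      nlinarith [abs_nonneg (ξ₀ ω), abs_nonneg θ]
    -- The factor `|ξ₀|²` of the moment assumption is useless near the origin, where the exponential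
    -- is at most `exp E`, and is at least `1` elsewhere.
    have h2 : Real.exp (E * |ξ₀ ω|) ≤ Real.exp E + |ξ₀ ω| ^ 2 * Real.exp (E * |ξ₀ ω|) := by
      rcases le_total |ξ₀ ω| 1 with h | h
      · have : Real.exp (E * |ξ₀ ω|) ≤ Real.exp E :=
          Real.exp_le_exp.2 (by nlinarith [abs_nonneg (ξ₀ ω)])
        linarith [hnn ω]
      · have h3 : 1 ≤ |ξ₀ ω| ^ 2 := one_le_pow₀ h
        have := Real.exp_pos E
        nlinarith [Real.exp_pos (E * |ξ₀ ω|)]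
    have := mul_le_mul_of_nonneg_right h2 (Real.exp_pos R).le
    linarith
  have hib : Integrable (fun ω => Real.exp R * (Real.exp E + |ξ₀ ω| ^ 2 * Real.exp (E * |ξ₀ ω|)))
      P := ((integrable_const _).add hi).const_mul _
  have hic : Integrable (fun ω => Real.cosh (lam * (ξ₀ ω - θ))) P :=
    hib.mono' (Real.measurable_cosh.comp ((hξ₀.sub_const θ).const_mul lam)).aestronglyMeasurable
      (Eventually.of_forall fun ω => by
        rw [Real.norm_of_nonneg (Real.cosh_pos _).le]
        exact hpt ω)
  refine ⟨hic, (integral_mono hic hib hpt).trans ?_⟩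
  rw [integral_const_mul, integral_add (integrable_const _) hi]
  simp only [integral_const, probReal_univ, smul_eq_mul, one_mul]
  gcongr

end Uniform

/-! ### Convergence in measure and measurability of the estimators. -/

section Convergence

variable {Ω : Type*} [MeasurableSpace Ω] {P : Measure Ω} [IsProbabilityMeasure P]

omit [IsProbabilityMeasure P] in
lemma tendstoInMeasure_zero_of_integral {E ι : Type*} [NormedAddCommGroup E] {l : Filter ι}
    {r : ι → Ω → E} {s : ι → Ω → ℝ} (hr : ∀ i, AEStronglyMeasurable (r i) P)
    (hrs : ∀ i ω, ‖r i ω‖ ≤ s i ω) (hi : ∀ᶠ i in l, Integrable (s i) P)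
    (hs : Tendsto (fun i => ∫ ω, s i ω ∂P) l (𝓝 0)) :
    TendstoInMeasure P r l 0 := by
  refine tendstoInMeasure_of_tendsto_eLpNorm one_ne_zero hr aestronglyMeasurable_zero ?_
  have h := ENNReal.tendsto_ofReal hs
  rw [ENNReal.ofReal_zero] at h
  refine tendsto_of_tendsto_of_tendsto_of_le_of_le' tendsto_const_nhds h
    (Eventually.of_forall fun i => zero_le) ?_
  filter_upwards [hi] with i hii
  rw [sub_zero, eLpNorm_one_eq_lintegral_enorm, ofReal_integral_eq_lintegral_ofReal hii
    (Eventually.of_forall fun ω => (norm_nonneg _).trans (hrs i ω))]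
  refine lintegral_mono fun ω => ?_
  rw [← ofReal_norm]
  exact ENNReal.ofReal_le_ofReal (hrs i ω)

lemma norm_vec_two_le (a b : ℝ) : ‖(!₂[a, b] : EuclideanSpace ℝ (Fin 2))‖ ≤ |a| + |b| := by
  rw [EuclideanSpace.norm_eq, Fin.sum_univ_two]
  refine Real.sqrt_le_iff.2 ⟨by positivity, ?_⟩
  simp only [Matrix.cons_val_zero, Matrix.cons_val_one, Real.norm_eq_abs]
  nlinarith [abs_nonneg a, abs_nonneg b, mul_nonneg (abs_nonneg a) (abs_nonneg b)]

omit [IsProbabilityMeasure P] in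
lemma measurable_vec_two {g h : Ω → ℝ} (hg : Measurable g) (hh : Measurable h) :
    Measurable fun ω => (!₂[g ω, h ω] : EuclideanSpace ℝ (Fin 2)) := by
  refine (WithLp.measurable_toLp 2 (Fin 2 → ℝ)).comp (measurable_pi_iff.2 fun i => ?_)
  fin_cases i
  · exact hg
  · exact hh

lemma measurable_esIterate {α : ℝ} {γ : ℕ → ℝ} {ξ₀ : Ω → ℝ} {X : ℕ → Ω → ℝ} (hξ₀ : Measurable ξ₀)
    (hX : ∀ n, Measurable (X n)) (n : ℕ) : Measurable (esIterate α γ ξ₀ X n) := by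
  induction n with
  | zero => exact measurable_const
  | succ n ih =>
    have hv := measurable_varIterate (α := α) (γ := γ) hξ₀ hX n
    exact ih.sub ((ih.sub (hv.add ((((hX n).sub hv).max measurable_const).const_mul _))).const_mul _)

lemma sum_Icc_one_eq_sum_range_succ (g : ℕ → ℝ) (N : ℕ) :
    ∑ k ∈ Finset.Icc 1 N, g k = ∑ n ∈ Finset.range N, g (n + 1) := by
  rw [← Finset.Ico_succ_right_eq_Icc, Finset.sum_Ico_eq_sum_range]
  simp [add_comm]

end Convergence

/-! ### The nested scheme: uniform constants, remainder, and central limit theorem. -/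

section Nested

variable {Ω : Type*} [MeasurableSpace Ω] {P : Measure Ω} [IsProbabilityMeasure P]
  {α : ℝ} {X₀ : Ω → ℝ} {X : ℕ+ → Ω → ℝ} {f₀ : ℝ → ℝ} {f : ℕ+ → ℝ → ℝ}

omit [IsProbabilityMeasure P] in
lemma RegularLaws.pdf_pos (hreg : RegularLaws P α X₀ X f₀ f) (x : ℝ) :
    0 < f₀ x ∧ ∀ K, 0 < f K x := by
  obtain ⟨c, hc, h⟩ := hreg.pdf_lower (|x - valueAtRisk P α X₀| + 1) (by positivity)
  obtain ⟨h1, h2⟩ := h x (by rw [Metric.mem_ball, Real.dist_eq]; linarith)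
  exact ⟨hc.trans_le h1, fun K => hc.trans_le (h2 K)⟩

/-- The value-at-risk of a nested loss is a regular quantile. -/
lemma RegularLaws.regularQuantile_nested (hreg : RegularLaws P α X₀ X f₀ f)
    (hα : α ∈ Set.Ioo (0 : ℝ) 1) {K : ℕ+} (hX : Measurable (X K)) (hX1 : Integrable (X K) P) :
    ∃ c C L, 0 < c ∧ RegularQuantile (P.map (X K)) α (valueAtRisk P α (X K))
      (f K (valueAtRisk P α (X K)) / (1 - α)) c C L := by
  set q := valueAtRisk P α (X K) with hq
  -- This statement is for every `K`, so the ball has to reach the unit neighbourhood of a quantile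
  -- that may be far from the limit, and `c` depends on `K`.
  obtain ⟨c, hc, hcf⟩ := hreg.pdf_lower (|q - valueAtRisk P α X₀| + 2) (by positivity)
  obtain ⟨C, hC⟩ := hreg.pdf_upper
  obtain ⟨L, -, hL⟩ := hreg.pdf_lipschitz
  have hα1 : 0 < 1 - α := by linarith [hα.2]
  refine ⟨_, _, _, by positivity, (hreg.pdf_nested K).regularQuantile hX hX1 hα
    ((hreg.pdf_nested K).cdfOf_valueAtRisk hX hα) (fun x hx => (hcf x ?_).2 K)
    (fun x => (hC x).2 K) (hL K)⟩
  rw [Metric.mem_ball, Real.dist_eq]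
  have := abs_sub_le x q (valueAtRisk P α X₀)
  linarith

/-- Uniform regularity of the values-at-risk of the nested losses. -/
lemma RegularLaws.exists_eventually_regularQuantile (hreg : RegularLaws P α X₀ X f₀ f)
    (hα : α ∈ Set.Ioo (0 : ℝ) 1) (hX₀ : Measurable X₀) (hX₀1 : Integrable X₀ P)
    (hX : ∀ K, Measurable (X K)) (hX1 : ∀ K, Integrable (X K) P) :
    ∃ c C L A R : ℝ, 0 < c ∧ 0 ≤ C ∧ 0 ≤ L ∧ ∀ᶠ K in atTop,
      |valueAtRisk P α (X K)| ≤ R ∧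
      c ≤ f K (valueAtRisk P α (X K)) / (1 - α) ∧ |f K (valueAtRisk P α (X K)) / (1 - α)| ≤ A ∧
      RegularQuantile (P.map (X K)) α (valueAtRisk P α (X K))
        (f K (valueAtRisk P α (X K)) / (1 - α)) c C L := by
  -- Eventually the quantile is within `1` of its limit, its unit neighbourhood adds another `1`,
  -- and the ball is open: radius `3` is enough for all large `K`.
  obtain ⟨c, hc, hcf⟩ := hreg.pdf_lower 3 three_pos
  obtain ⟨C, hC⟩ := hreg.pdf_upper
  obtain ⟨L, -, hL⟩ := hreg.pdf_lipschitz
  have hα1 : 0 < 1 - α := by linarith [hα.2]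
  have hC0 : 0 ≤ C := (hreg.pdf_exact.nonneg 0).trans (hC 0).1
  have hlim := hreg.tendsto_valueAtRisk hα hX₀ hX₀1 hX
  refine ⟨c / (1 - α), (1 / (1 - α)) ^ 2 * C, L / (1 - α), C / (1 - α),
    |valueAtRisk P α X₀| + 1, by positivity, by positivity, by positivity, ?_⟩
  filter_upwards [hlim.eventually (Metric.ball_mem_nhds _ one_pos)] with K hK
  rw [Real.dist_eq] at hK
  set q := valueAtRisk P α (X K) with hq
  have hcq : ∀ x, |x - q| ≤ 1 → c ≤ f K x := fun x hx => (hcf x (by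
    rw [Metric.mem_ball, Real.dist_eq]
    have := abs_sub_le x q (valueAtRisk P α X₀)
    linarith)).2 K
  refine ⟨?_, ?_, ?_, (hreg.pdf_nested K).regularQuantile (hX K) (hX1 K) hα
    ((hreg.pdf_nested K).cdfOf_valueAtRisk (hX K) hα) hcq (fun x => (hC x).2 K) (hL K)⟩
  · have := abs_sub_abs_le_abs_sub q (valueAtRisk P α X₀)
    linarith
  · have := hcq q (by simp)
    gcongr
  · rw [abs_of_nonneg (div_nonneg ((hreg.pdf_nested K).nonneg q) hα1.le)]
    have := (hC q).2 K
    gcongr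

-- This makes the exponent in the moment assumption strictly positive, so that a positive Lyapunov
-- parameter can be chosen. The uniform bound on the densities is needed for the real suprema to
-- dominate their terms.
omit [IsProbabilityMeasure P] in
lemma RegularLaws.iSup_pdf_pos (hreg : RegularLaws P α X₀ X f₀ f) :
    0 < ⨆ (K : ℕ+), ⨆ (x : ℝ), |f K x| := by
  obtain ⟨C, hC⟩ := hreg.pdf_upper
  have hb : ∀ K x, |f K x| ≤ C := fun K x => by
    rw [abs_of_nonneg ((hreg.pdf_nested K).nonneg x)]
    exact (hC x).2 K
  have h1 : |f 1 0| ≤ ⨆ x, |f 1 x| :=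
    le_ciSup (f := fun x => |f 1 x|) ⟨C, by rintro _ ⟨x, rfl⟩; exact hb 1 x⟩ 0
  have h2 : ⨆ x, |f 1 x| ≤ ⨆ (K : ℕ+), ⨆ (x : ℝ), |f K x| :=
    le_ciSup (f := fun K => ⨆ x, |f K x|)
      ⟨C, by rintro _ ⟨K, rfl⟩; exact ciSup_le fun x => hb K x⟩ 1
  exact (abs_pos.2 ((hreg.pdf_pos 0).2 1).ne').trans_le (h1.trans h2)

variable {ξ₀ : ℕ+ → Ω → ℝ} {Xi : ℕ+ → ℕ → Ω → ℝ} {γ₁ β : ℝ} {γ : ℕ → ℝ}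

/-- Uniform bounds for the linearization errors of both estimators. -/
lemma RegularLaws.exists_eventually_error_le (hreg : RegularLaws P α X₀ X f₀ f)
    (hα : α ∈ Set.Ioo (0 : ℝ) 1) (hX₀ : Measurable X₀) (hX₀1 : Integrable X₀ P)
    (hX : ∀ K, Measurable (X K)) (hX1 : ∀ K, Integrable (X K) P)
    (hξ₀ : ∀ K, Measurable (ξ₀ K)) (hmom : InitialMoments P α f ξ₀)
    (hXi : ∀ K n, Measurable (Xi K n)) (hind : ∀ K, iIndepFun (Xi K) P)
    (hlaw : ∀ K n, IdentDistrib (Xi K n) (X K) P P)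
    (hξ₀Xi : ∀ K, IndepFun (ξ₀ K) (fun ω n => Xi K n ω) P)
    (hγ₁ : 0 < γ₁) (hβ : β ∈ Set.Ioo (1 / 2 : ℝ) 1)
    (hγ : ∀ n : ℕ, γ (n + 1) = γ₁ * ((n : ℝ) + 1) ^ (-β)) :
    ∃ c A C L M : ℝ, 0 < c ∧ ∀ᶠ K in atTop,
      c ≤ f K (valueAtRisk P α (X K)) / (1 - α) ∧
      (∀ n, MemLp (fun ω => varIterate α γ (ξ₀ K) (Xi K) n ω - valueAtRisk P α (X K)) 2 P) ∧
      (∀ N, ∫ ω, |f K (valueAtRisk P α (X K)) / (1 - α) * ∑ n ∈ Finset.range N,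
          (varIterate α γ (ξ₀ K) (Xi K) (n + 1) ω - valueAtRisk P α (X K))
          + ∑ n ∈ Finset.range N, H₁ α (valueAtRisk P α (X K)) (Xi K n ω)| ∂P
        ≤ varErrorBound A C L M γ₁ β N) ∧
      (∀ N, ∫ ω, |∑ n ∈ Finset.range N,
          (shortfallLoss α (varIterate α γ (ξ₀ K) (Xi K) n ω) (Xi K n ω)
            - shortfallLoss α (valueAtRisk P α (X K)) (Xi K n ω))| ∂P
        ≤ esErrorBound (1 / (1 - α)) C M β N) := by
  obtain ⟨c, C, L, A, R, hc, hC, hL, hev⟩ :=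
    hreg.exists_eventually_regularQuantile hα hX₀ hX₀1 hX hX1
  have hα1 : 0 < 1 - α := by linarith [hα.2]
  have hβ0 : 0 < β := by linarith [hβ.1]
  set E : ℝ := 4 / (1 - α) * max 1 (α / (1 - α)) * ⨆ (K : ℕ+), ⨆ (x : ℝ), |f K x| with hE
  have hE0 : 0 < E := mul_pos (mul_pos (by positivity) (lt_max_of_lt_left one_pos))
    hreg.iSup_pdf_pos
  set S : ℝ := (⨆ K : ℕ+, ∫⁻ ω, ENNReal.ofReal (|ξ₀ K ω| ^ 2 * Real.exp (E * |ξ₀ K ω|)) ∂P).toReal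
    with hS
  have hSle : ∀ K, ∫⁻ ω, ENNReal.ofReal (|ξ₀ K ω| ^ 2 * Real.exp (E * |ξ₀ K ω|)) ∂P
      ≤ ENNReal.ofReal S := fun K => by
    rw [hS, ENNReal.ofReal_toReal (ne_of_lt hmom)]
    exact le_iSup (fun K => ∫⁻ ω, ENNReal.ofReal (|ξ₀ K ω| ^ 2 * Real.exp (E * |ξ₀ K ω|)) ∂P) K
  -- `lam = min 1 E`: the bound `1` is required by the Lyapunov inequality, the bound `E` by the
  -- available exponential moment.
  obtain ⟨M, hM, hrate⟩ := exists_integral_sq_varIterate_le (P := P) hα (c := c) (lam := min 1 E)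
    (M₀ := Real.exp R * (Real.exp E + S)) hc (lt_min one_pos hE0) (min_le_left _ _) hγ₁ hβ0 hβ.2 hγ
  refine ⟨c, A, C, L, M, hc, ?_⟩
  filter_upwards [hev] with K ⟨hR, hcK, hAK, hRQ⟩
  have hpm := Measure.isProbabilityMeasure_map (hX K).aemeasurable (μ := P)
  have hmap : ∀ n, P.map (Xi K n) = P.map (X K) := fun n => (hlaw K n).map_eq
  have hpast := indepFun_past (hξ₀ K) (hXi K) (hind K) (hξ₀Xi K)
  have hinit := integrable_cosh_initial (hξ₀ K) (lt_min one_pos hE0).le (min_le_left _ _)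
    (min_le_right _ _) ENNReal.toReal_nonneg (hSle K) hR
  have hD := hrate (P.map (X K)) _ _ _ _ (ξ₀ K) (Xi K) hpm hRQ (hξ₀ K) (hXi K) hmap hpast
    hinit.1 hinit.2
  exact ⟨hcK, fun n => (hD n).1,
    integral_abs_varError_le hα hRQ hC hL (hξ₀ K) (hXi K) hmap hpast hγ₁ hβ0 hγ hM
      (fun n => (hD n).1) (fun n => (hD n).2) hAK,
    integral_abs_esError_le hα hRQ hC (hξ₀ K) (hXi K) hmap hpast (fun n => (hD n).1)
      (fun n => (hD n).2)⟩

lemma RegularLaws.tendsto_pdf_valueAtRisk (hreg : RegularLaws P α X₀ X f₀ f)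
    (hα : α ∈ Set.Ioo (0 : ℝ) 1) (hX₀ : Measurable X₀) (hX₀1 : Integrable X₀ P)
    (hX : ∀ K, Measurable (X K)) :
    Tendsto (fun K => f K (valueAtRisk P α (X K))) atTop (𝓝 (f₀ (valueAtRisk P α X₀))) :=
  hreg.pdf_tendsto.tendsto_comp hreg.pdf_exact.continuous.continuousAt
    (hreg.tendsto_valueAtRisk hα hX₀ hX₀1 hX)

lemma RegularLaws.integral_H₁_exact (hreg : RegularLaws P α X₀ X f₀ f)
    (hα : α ∈ Set.Ioo (0 : ℝ) 1) (hX₀ : Measurable X₀) (hX₀1 : Integrable X₀ P) :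
    ∫ ω, H₁ α (valueAtRisk P α X₀) (X₀ ω) ∂P = 0 := by
  obtain ⟨c, C, L, -, hRQ⟩ := hreg.regularQuantile_exact hα hX₀ hX₀1
  rw [← hRQ.drift_eq_zero, drift,
    integral_map hX₀.aemeasurable (measurable_H₁_right α _).aestronglyMeasurable]

lemma RegularLaws.integral_H₁_nested (hreg : RegularLaws P α X₀ X f₀ f)
    (hα : α ∈ Set.Ioo (0 : ℝ) 1) {K : ℕ+} (hX : Measurable (X K)) (hX1 : Integrable (X K) P) :
    ∫ ω, H₁ α (valueAtRisk P α (X K)) (X K ω) ∂P = 0 := by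
  obtain ⟨c, C, L, -, hRQ⟩ := hreg.regularQuantile_nested hα hX hX1
  rw [← hRQ.drift_eq_zero, drift,
    integral_map hX.aemeasurable (measurable_H₁_right α _).aestronglyMeasurable]

/-- The quadratic form of the matrix is the second moment of a linear combination of the limiting
innovations. -/
lemma RegularLaws.posSemidef_limitCov (hreg : RegularLaws P α X₀ X f₀ f)
    (hα : α ∈ Set.Ioo (0 : ℝ) 1) (hX₀ : Measurable X₀) (hX₀2 : MemLp X₀ 2 P) :
    (limitCov P α X₀ f₀ (valueAtRisk P α X₀)).PosSemidef := by
  refine Matrix.PosSemidef.of_dotProduct_mulVec_nonneg ?_ fun z => ?_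
  · ext i j
    fin_cases i <;> fin_cases j <;> simp [limitCov]
  · have h := integral_sq_linear_eq_limitCov hα hX₀ hX₀2
      (hreg.integral_H₁_exact hα hX₀ (hX₀2.integrable one_le_two))
      (hreg.pdf_pos (valueAtRisk P α X₀)).1.ne' (z 0) (z 1)
    have hz : z = ![z 0, z 1] := by
      ext i
      fin_cases i <;> rfl
    rw [star_trivial, hz, ← h]
    exact integral_nonneg fun ω => sq_nonneg _

/-- Central limit theorem for the linearized estimators. -/
lemma RegularLaws.tendstoInDistribution_linearized (hreg : RegularLaws P α X₀ X f₀ f)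
    (hα : α ∈ Set.Ioo (0 : ℝ) 1) (hX₀ : Measurable X₀) (hX₀2 : MemLp X₀ 2 P)
    (hX : ∀ K, Measurable (X K)) (hX2 : ∀ K, MemLp (X K) 2 P)
    (hlim : Tendsto (fun K => ∫ ω, (X K ω - X₀ ω) ^ 2 ∂P) atTop (𝓝 0))
    (hXi : ∀ K n, Measurable (Xi K n)) (hind : ∀ K, iIndepFun (Xi K) P)
    (hlaw : ∀ K n, IdentDistrib (Xi K n) (X K) P P) :
    TendstoInDistribution
      (fun (K : ℕ+) (ω : Ω) => (!₂[
          ((K : ℕ) : ℝ)⁻¹ * ∑ n ∈ Finset.range ((K : ℕ) ^ 2),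
            (-((f K (valueAtRisk P α (X K)) / (1 - α))⁻¹)
              * H₁ α (valueAtRisk P α (X K)) (Xi K n ω)),
          ((K : ℕ) : ℝ)⁻¹ * ∑ n ∈ Finset.range ((K : ℕ) ^ 2),
            (shortfallLoss α (valueAtRisk P α (X K)) (Xi K n ω)
              - ∫ ω', shortfallLoss α (valueAtRisk P α (X K)) (X K ω') ∂P)] :
        EuclideanSpace ℝ (Fin 2)))
      atTop (id : EuclideanSpace ℝ (Fin 2) → EuclideanSpace ℝ (Fin 2)) (fun _ => P)
      (multivariateGaussian 0 (limitCov P α X₀ f₀ (valueAtRisk P α X₀))) := by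
  have hX₀1 := hX₀2.integrable one_le_two
  have hq := hreg.tendsto_valueAtRisk hα hX₀ hX₀1 hX
  have hα1 : 1 - α ≠ 0 := by linarith [hα.2]
  have ha : Tendsto (fun K => -((f K (valueAtRisk P α (X K)) / (1 - α))⁻¹)) atTop
      (𝓝 (-((f₀ (valueAtRisk P α X₀) / (1 - α))⁻¹))) :=
    (((hreg.tendsto_pdf_valueAtRisk hα hX₀ hX₀1 hX).div_const _).inv₀
      (div_ne_zero (hreg.pdf_pos _).1.ne' hα1)).neg
  obtain ⟨C, hC⟩ := hreg.pdf_upper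
  have hH : ∀ K, MemLp (fun ω => H₁ α (valueAtRisk P α (X K)) (X K ω)) 2 P :=
    fun K => memLp_H₁ hα (hX K) _
  have hH₀ := memLp_H₁ hα hX₀ (valueAtRisk P α X₀) (P := P)
  have hs : ∀ K, MemLp (fun ω => shortfallLoss α (valueAtRisk P α (X K)) (X K ω)) 2 P :=
    fun K => memLp_shortfallLoss (hX2 K) _
  have hs₀ := memLp_shortfallLoss (α := α) hX₀2 (valueAtRisk P α X₀)
  have hcenter : ∀ {F : Ω → ℝ}, MemLp F 2 P → ∫ ω, (F ω - ∫ ω', F ω' ∂P) ∂P = 0 := fun hF => by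
    rw [integral_sub (hF.integrable one_le_two) (integrable_const _)]
    simp
  refine tendstoInDistribution_row_sums (X := X)
    (g₁ := fun K x => -((f K (valueAtRisk P α (X K)) / (1 - α))⁻¹)
      * H₁ α (valueAtRisk P α (X K)) x)
    (g₂ := fun K x => shortfallLoss α (valueAtRisk P α (X K)) x
      - ∫ ω', shortfallLoss α (valueAtRisk P α (X K)) (X K ω') ∂P)
    (U₁ := fun ω => -((f₀ (valueAtRisk P α X₀) / (1 - α))⁻¹) * H₁ α (valueAtRisk P α X₀) (X₀ ω))
    (U₂ := fun ω => shortfallLoss α (valueAtRisk P α X₀) (X₀ ω)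
      - ∫ ω', shortfallLoss α (valueAtRisk P α X₀) (X₀ ω') ∂P)
    hXi hind hlaw (fun K => (measurable_H₁_right α _).const_mul _)
    (fun K => ((measurable_shortfallLoss α).comp measurable_prodMk_left).sub_const _)
    (hH₀.const_mul _) (hs₀.sub (memLp_const _)) (fun K => (hH K).const_mul _)
    (fun K => (hs K).sub (memLp_const _)) ?_ (hcenter hs₀) (fun K => ?_) (fun K => hcenter (hs K))
    ?_ ?_ (hreg.posSemidef_limitCov hα hX₀ hX₀2) ?_
  · rw [integral_const_mul, hreg.integral_H₁_exact hα hX₀ hX₀1, mul_zero]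
  · rw [integral_const_mul,
      hreg.integral_H₁_nested hα (hX K) ((hX2 K).integrable one_le_two), mul_zero]
  · exact tendsto_integral_sq_sub_mul hH hH₀
      (tendsto_integral_sq_H₁_sub hα hX₀ hreg.pdf_exact (fun x => (hC x).1) hX2 hX₀2 hlim hq) ha
  · exact tendsto_integral_sq_sub_center hs hs₀
      (tendsto_integral_sq_shortfallLoss_sub hX2 hX₀2 hlim hq)
  · exact integral_sq_linear_eq_limitCov hα hX₀ hX₀2 (hreg.integral_H₁_exact hα hX₀ hX₀1)
      (hreg.pdf_pos _).1.ne'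

lemma bias_inv (K : ℕ+) : (bias K)⁻¹ = ((K : ℕ) : ℝ) := by
  rw [bias, one_div, inv_inv]

lemma ceil_bias_zpow (K : ℕ+) : ⌈(bias K) ^ (-2 : ℤ)⌉₊ = (K : ℕ) ^ 2 := by
  have h : (bias K) ^ (-2 : ℤ) = (((K : ℕ) ^ 2 : ℕ) : ℝ) := by
    rw [zpow_neg, ← inv_zpow, bias_inv]
    push_cast
    norm_cast
  rw [h, Nat.ceil_natCast]

/-- Central limit theorem for the averaged nested stochastic approximation scheme. -/
theorem RegularLaws.tendstoInDistribution_estimators (hreg : RegularLaws P α X₀ X f₀ f)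
    (hα : α ∈ Set.Ioo (0 : ℝ) 1) (hX₀ : Measurable X₀) (hX₀2 : MemLp X₀ 2 P)
    (hX : ∀ K, Measurable (X K)) (hX2 : ∀ K, MemLp (X K) 2 P)
    (hlim : Tendsto (fun K => ∫ ω, (X K ω - X₀ ω) ^ 2 ∂P) atTop (𝓝 0))
    (hξ₀ : ∀ K, Measurable (ξ₀ K)) (hmom : InitialMoments P α f ξ₀)
    (hXi : ∀ K n, Measurable (Xi K n)) (hind : ∀ K, iIndepFun (Xi K) P)
    (hlaw : ∀ K n, IdentDistrib (Xi K n) (X K) P P)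
    (hξ₀Xi : ∀ K, IndepFun (ξ₀ K) (fun ω n => Xi K n ω) P)
    (hγ₁ : 0 < γ₁) (hβ : β ∈ Set.Ioo (1 / 2 : ℝ) 1)
    (hγ : ∀ n : ℕ, γ (n + 1) = γ₁ * ((n : ℝ) + 1) ^ (-β)) :
    TendstoInDistribution
      (fun (K : ℕ+) (ω : Ω) =>
        (bias K)⁻¹ • (!₂[
          avgVarIterate α γ (ξ₀ K) (Xi K) ⌈(bias K) ^ (-2 : ℤ)⌉₊ ω - minimizer P α (X K),
          esIterate α γ (ξ₀ K) (Xi K) ⌈(bias K) ^ (-2 : ℤ)⌉₊ ω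
            - minValue P α (X K)] : EuclideanSpace ℝ (Fin 2)))
      atTop (id : EuclideanSpace ℝ (Fin 2) → EuclideanSpace ℝ (Fin 2)) (fun _ => P)
      (multivariateGaussian 0 (limitCov P α X₀ f₀ (valueAtRisk P α X₀))) := by
  have hα1 : 0 < 1 - α := by linarith [hα.2]
  have hX1 : ∀ K, Integrable (X K) P := fun K => (hX2 K).integrable one_le_two
  have hX₀1 := hX₀2.integrable one_le_two
  set q : ℕ+ → ℝ := fun K => valueAtRisk P α (X K) with hq
  set a : ℕ+ → ℝ := fun K => f K (q K) / (1 - α) with ha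
  have ha0 : ∀ K, 0 < a K := fun K => div_pos ((hreg.pdf_pos _).2 K) hα1
  have hmin : ∀ K, minimizer P α (X K) = q K ∧
      minValue P α (X K) = ∫ ω, shortfallLoss α (q K) (X K ω) ∂P := fun K => by
    obtain ⟨c, C, L, hc, hRQ⟩ := hreg.regularQuantile_nested hα (hX K) (hX1 K)
    refine ⟨hRQ.minimizer_eq hα (hX K) (hX1 K) hc, ?_⟩
    have hm : Measurable (shortfallLoss α (q K)) :=
      (measurable_shortfallLoss α).comp measurable_prodMk_left
    rw [hRQ.minValue_eq hα (hX K) (hX1 K), objective_eq_integral (hX K) (hX1 K),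
      ← integral_map (hX K).aemeasurable hm.aestronglyMeasurable]
  obtain ⟨c, A, C, L, M, hc, hev⟩ := hreg.exists_eventually_error_le hα hX₀ hX₀1 hX hX1 hξ₀ hmom
    hXi hind hlaw hξ₀Xi hγ₁ hβ hγ
  -- `R₁` and `R₂` are the unnormalized differences between the estimators and their linearizations.
  -- Since `√(K²) = K`, the bounds divided by `√N` show that the normalized differences vanish in
  -- `L¹`; `a K` is eventually at least `c`.
  set R₁ : ℕ+ → Ω → ℝ := fun K ω => a K * ∑ n ∈ Finset.range ((K : ℕ) ^ 2),
      (varIterate α γ (ξ₀ K) (Xi K) (n + 1) ω - q K)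
      + ∑ n ∈ Finset.range ((K : ℕ) ^ 2), H₁ α (q K) (Xi K n ω) with hR₁
  set R₂ : ℕ+ → Ω → ℝ := fun K ω => ∑ n ∈ Finset.range ((K : ℕ) ^ 2),
      (shortfallLoss α (varIterate α γ (ξ₀ K) (Xi K) n ω) (Xi K n ω)
        - shortfallLoss α (q K) (Xi K n ω)) with hR₂
  have hvm : ∀ K n, Measurable (varIterate α γ (ξ₀ K) (Xi K) n) := fun K =>
    measurable_varIterate (hξ₀ K) (hXi K)
  have hsm : ∀ K {ξ : Ω → ℝ} (n : ℕ), Measurable ξ →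
      Measurable fun ω => shortfallLoss α (ξ ω) (Xi K n ω) := fun K ξ n hξ =>
    (measurable_shortfallLoss α).comp (hξ.prodMk (hXi K n))
  have hHm : ∀ K n, Measurable fun ω => H₁ α (q K) (Xi K n ω) := fun K n =>
    (measurable_H₁_right α _).comp (hXi K n)
  have hR₁m : ∀ K, Measurable (R₁ K) := fun K =>
    ((Finset.measurable_sum _ fun n _ => (hvm K (n + 1)).sub_const _).const_mul _).add
      (Finset.measurable_sum _ fun n _ => hHm K n)
  have hR₂m : ∀ K, Measurable (R₂ K) := fun K =>
    Finset.measurable_sum _ fun n _ => (hsm K n (hvm K n)).sub (hsm K n measurable_const)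
  have hsq : Tendsto (fun K : ℕ+ => (K : ℕ) ^ 2) atTop atTop :=
    (tendsto_pow_atTop two_ne_zero).comp tendsto_PNat_val_atTop_atTop
  have hsqrt : ∀ K : ℕ+, √((((K : ℕ) ^ 2 : ℕ)) : ℝ) = ((K : ℕ) : ℝ) := fun K => by
    push_cast
    exact Real.sqrt_sq (Nat.cast_nonneg _)
  have hdiff : TendstoInMeasure P (fun (K : ℕ+) (ω : Ω) => (!₂[
      (((K : ℕ) : ℝ) * a K)⁻¹ * R₁ K ω, ((K : ℕ) : ℝ)⁻¹ * R₂ K ω] : EuclideanSpace ℝ (Fin 2)))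
      atTop 0 := by
    refine tendstoInMeasure_zero_of_integral
      (s := fun K ω => (((K : ℕ) : ℝ) * a K)⁻¹ * |R₁ K ω| + ((K : ℕ) : ℝ)⁻¹ * |R₂ K ω|)
      (fun K => (measurable_vec_two ((hR₁m K).const_mul _)
        ((hR₂m K).const_mul _)).aestronglyMeasurable) (fun K ω => ?_) ?_ ?_
    · refine (norm_vec_two_le _ _).trans_eq ?_
      have h1 := ha0 K
      rw [abs_mul, abs_mul, abs_of_nonneg (by positivity : 0 ≤ (((K : ℕ) : ℝ) * a K)⁻¹),
        abs_of_nonneg (by positivity : 0 ≤ ((K : ℕ) : ℝ)⁻¹)]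
    all_goals
      have hint : ∀ᶠ K in atTop, Integrable (R₁ K) P ∧ Integrable (R₂ K) P := by
        filter_upwards [hev] with K ⟨_, hD, _, _⟩
        have hD1 := fun n => (hD n).integrable one_le_two
        have hpm := Measure.isProbabilityMeasure_map (hX K).aemeasurable (μ := P)
        refine ⟨((integrable_finsetSum _ fun n _ => hD1 (n + 1)).const_mul _).add
          (integrable_finsetSum _ fun n _ => ?_), integrable_finsetSum _ fun n _ => ?_⟩
        · exact (memLp_H₁ hα (hXi K n) (q K)).integrable one_le_two
        · refine ((hD1 n).abs.const_mul (1 / (1 - α))).mono'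
            ((hsm K n (hvm K n)).sub (hsm K n measurable_const)).aestronglyMeasurable
            (Eventually.of_forall fun ω => abs_shortfallLoss_sub_le hα _ _ _)
    · filter_upwards [hint] with K hK
      exact (hK.1.abs.const_mul _).add (hK.2.abs.const_mul _)
    · have hlim1 := ((tendsto_varErrorBound_div_sqrt hβ A C L M γ₁).comp hsq).const_mul c⁻¹
      have hlim2 := (tendsto_esErrorBound_div_sqrt hβ (1 / (1 - α)) C M).comp hsq
      have hlim3 := hlim1.add hlim2
      simp only [mul_zero, add_zero, Function.comp_apply, hsqrt] at hlim3
      refine squeeze_zero' (Eventually.of_forall fun K => integral_nonneg fun ω => ?_) ?_ hlim3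
      · have h1 := ha0 K
        positivity
      · filter_upwards [hint, hev] with K hK ⟨hcK, _, h1, h2⟩
        have hKp : (0 : ℝ) < ((K : ℕ) : ℝ) := by exact_mod_cast K.pos
        have h1' := h1 ((K : ℕ) ^ 2)
        have h2' := h2 ((K : ℕ) ^ 2)
        rw [integral_add (hK.1.abs.const_mul _) (hK.2.abs.const_mul _), integral_const_mul,
          integral_const_mul]
        refine add_le_add ?_ ?_
        · have hi : 0 ≤ ∫ ω, |R₁ K ω| ∂P := integral_nonneg fun ω => abs_nonneg _
          calc (((K : ℕ) : ℝ) * a K)⁻¹ * ∫ ω, |R₁ K ω| ∂P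
              ≤ (((K : ℕ) : ℝ) * c)⁻¹ * varErrorBound A C L M γ₁ β ((K : ℕ) ^ 2) := by
                gcongr
            _ = _ := by
                rw [mul_inv]
                ring
        · rw [div_eq_inv_mul]
          exact mul_le_mul_of_nonneg_left h2' (by positivity)
  -- Slutsky's lemma: the linearized estimators converge in law and the remainder vanishes in
  -- measure. The identities below use that the sample size is `K²`, so that `K / K² = K⁻¹`.
  refine tendstoInDistribution_of_tendstoInMeasure_sub _ _
    (hreg.tendstoInDistribution_linearized hα hX₀ hX₀2 hX hX2 hlim hXi hind hlaw) ?_ fun K => ?_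
  · refine hdiff.congr_left fun K => Eventually.of_forall fun ω => ?_
    have hK : ((K : ℕ) : ℝ) ≠ 0 := by exact_mod_cast K.pos.ne'
    have haK := (ha0 K).ne'
    have hes := mul_esIterate α γ (ξ₀ K) (Xi K) ((K : ℕ) ^ 2) ω
    push_cast at hes
    have e₁ : (((K : ℕ) : ℝ) * a K)⁻¹ * R₁ K ω
        = ((K : ℕ) : ℝ) * (avgVarIterate α γ (ξ₀ K) (Xi K) ((K : ℕ) ^ 2) ω - q K)
          - ((K : ℕ) : ℝ)⁻¹ * ∑ n ∈ Finset.range ((K : ℕ) ^ 2),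
            (-((a K)⁻¹) * H₁ α (q K) (Xi K n ω)) := by
      simp only [hR₁, avgVarIterate, sum_Icc_one_eq_sum_range_succ, Finset.sum_sub_distrib,
        ← Finset.mul_sum, Finset.sum_const, Finset.card_range, nsmul_eq_mul]
      push_cast
      field_simp
      ring
    have e₂ : ((K : ℕ) : ℝ)⁻¹ * R₂ K ω
        = ((K : ℕ) : ℝ) * (esIterate α γ (ξ₀ K) (Xi K) ((K : ℕ) ^ 2) ω
            - ∫ ω', shortfallLoss α (q K) (X K ω') ∂P)
          - ((K : ℕ) : ℝ)⁻¹ * ∑ n ∈ Finset.range ((K : ℕ) ^ 2),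
            (shortfallLoss α (q K) (Xi K n ω) - ∫ ω', shortfallLoss α (q K) (X K ω') ∂P) := by
      simp only [hR₂, Finset.sum_sub_distrib, ← hes, Finset.sum_const, Finset.card_range,
        nsmul_eq_mul]
      push_cast
      field_simp
      ring
    ext i
    fin_cases i
    · change _ = (bias K)⁻¹ * (avgVarIterate α γ (ξ₀ K) (Xi K) ⌈(bias K) ^ (-2 : ℤ)⌉₊ ω
        - minimizer P α (X K)) - _
      rw [bias_inv, ceil_bias_zpow, (hmin K).1]
      exact e₁
    · change _ = (bias K)⁻¹ * (esIterate α γ (ξ₀ K) (Xi K) ⌈(bias K) ^ (-2 : ℤ)⌉₊ ω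
        - minValue P α (X K)) - _
      rw [bias_inv, ceil_bias_zpow, (hmin K).2]
      exact e₂
  · refine ((measurable_vec_two (Measurable.sub_const ?_ _)
      (Measurable.sub_const ?_ _)).const_smul (bias K)⁻¹).aemeasurable
    · exact (Finset.measurable_sum _ fun n _ => hvm K n).const_mul _
    · exact measurable_esIterate (hξ₀ K) (hXi K) _

end Nested

/-- The iterates are pathwise functions of the innovations, so they are unchanged almost surely when
the innovations are replaced by measurable modifications. -/
lemma varIterate_congr {Ω : Type*} (α : ℝ) (γ : ℕ → ℝ) (ξ₀ : Ω → ℝ) {X X' : ℕ → Ω → ℝ} {ω : Ω}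
    (h : ∀ n, X n ω = X' n ω) (n : ℕ) : varIterate α γ ξ₀ X n ω = varIterate α γ ξ₀ X' n ω := by
  induction n with
  | zero => rfl
  | succ n ih => simp only [varIterate, ih, h n]

lemma esIterate_congr {Ω : Type*} (α : ℝ) (γ : ℕ → ℝ) (ξ₀ : Ω → ℝ) {X X' : ℕ → Ω → ℝ} {ω : Ω}
    (h : ∀ n, X n ω = X' n ω) (n : ℕ) : esIterate α γ ξ₀ X n ω = esIterate α γ ξ₀ X' n ω := by
  induction n with
  | zero => rfl
  | succ n ih => simp only [esIterate, varIterate_congr α γ ξ₀ h n, ih, h n]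

end NestedSA

end

theorem theorem2p2 {Ω : Type*} [MeasurableSpace Ω] (P : Measure Ω) [IsProbabilityMeasure P]
    (α : ℝ) (hα : α ∈ Set.Ioo (0 : ℝ) 1)
    -- the model: risk factors, cash flows, exact and nested losses
    {d q : ℕ} (φ : EuclideanSpace ℝ (Fin d) → EuclideanSpace ℝ (Fin q) → ℝ)
    (hφ : Measurable (fun p : EuclideanSpace ℝ (Fin d) × EuclideanSpace ℝ (Fin q) => φ p.1 p.2))
    (Y : Ω → EuclideanSpace ℝ (Fin d)) (hY : Measurable Y)
    (Z : Ω → EuclideanSpace ℝ (Fin q)) (hZ : Measurable Z) (hYZ : IndepFun Y Z P)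
    (Zs : ℕ → Ω → EuclideanSpace ℝ (Fin q)) (hZs : ∀ k, Measurable (Zs k))
    (hZs_indep : iIndepFun Zs P) (hZs_law : ∀ k, IdentDistrib (Zs k) Z P P)
    (hYZs : IndepFun Y (fun ω k => Zs k ω) P)
    (δ : ℝ) (hδ : 0 < δ) (hmom : Integrable (fun ω => |φ (Y ω) (Z ω)| ^ (2 + δ)) P)
    -- the densities and the assumptions on the laws of the losses
    (f₀ : ℝ → ℝ) (f : ℕ+ → ℝ → ℝ)
    (hreg : RegularLaws P α (exactLoss P φ Y Z) (nestedLoss φ Y Zs) f₀ f)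
    -- initial values and innovations: `Xi K n` stands for `X_h^{(n+1)}`, `h = 1 / K`
    (ξ₀ : ℕ+ → Ω → ℝ) (hξ₀ : ∀ K, Measurable (ξ₀ K)) (hξ₀_mom : InitialMoments P α f ξ₀)
    (Xi : ℕ+ → ℕ → Ω → ℝ) (hXi_indep : ∀ K, iIndepFun (Xi K) P)
    (hXi_law : ∀ K n, IdentDistrib (Xi K n) (nestedLoss φ Y Zs K) P P)
    (hξ₀Xi : ∀ K, IndepFun (ξ₀ K) (fun ω n => Xi K n ω) P)
    -- the learning rate
    (γ₁ : ℝ) (hγ₁ : 0 < γ₁) (β : ℝ) (hβ : β ∈ Set.Ioo (1 / 2 : ℝ) 1)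
    (γ : ℕ → ℝ) (hγ : ∀ n, 1 ≤ n → γ n = γ₁ * (n : ℝ) ^ (-β)) :
    -- the minimizers are well defined, and the limiting covariance matrix is a covariance matrix
    (∀ K, argminSet P α (nestedLoss φ Y Zs K) = {minimizer P α (nestedLoss φ Y Zs K)}) ∧
    (limitCov P α (exactLoss P φ Y Z) f₀ (valueAtRisk P α (exactLoss P φ Y Z))).PosSemidef ∧
    -- the central limit theorem
    TendstoInDistribution
      (fun (K : ℕ+) (ω : Ω) =>
        (bias K)⁻¹ • (!₂[
          avgVarIterate α γ (ξ₀ K) (Xi K) ⌈(bias K) ^ (-2 : ℤ)⌉₊ ω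
            - minimizer P α (nestedLoss φ Y Zs K),
          esIterate α γ (ξ₀ K) (Xi K) ⌈(bias K) ^ (-2 : ℤ)⌉₊ ω
            - minValue P α (nestedLoss φ Y Zs K)] : EuclideanSpace ℝ (Fin 2)))
      atTop
      (id : EuclideanSpace ℝ (Fin 2) → EuclideanSpace ℝ (Fin 2))
      (fun _ => P)
      (multivariateGaussian 0
        (limitCov P α (exactLoss P φ Y Z) f₀ (valueAtRisk P α (exactLoss P φ Y Z)))) := by
  have h2 := memLp_two_of_integrable_rpow
    (hφ.comp (hY.prodMk hZ)) hδ hmom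
  obtain ⟨hX₀2, hX2, hlim⟩ :=
    tendsto_integral_sq_nestedLoss_sub hφ hY hZ hYZ hZs hZs_indep hZs_law hYZs h2
  have hX₀ := measurable_exactLoss (P := P) (φ := φ) (Z := Z) hY
  have hX := measurable_nestedLoss hφ hY hZs
  refine ⟨fun K => ?_, hreg.posSemidef_limitCov hα hX₀ hX₀2, ?_⟩
  · have hX1 := (hX2 K).integrable one_le_two
    obtain ⟨c, C, L, hc, hRQ⟩ := hreg.regularQuantile_nested hα (hX K) hX1
    rw [hRQ.minimizer_eq hα (hX K) hX1 hc, hRQ.argminSet_eq hα (hX K) hX1 hc]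
  -- Equality in law provides the innovations only with almost everywhere measurability. The
  -- argument is run on measurable modifications, which agree with the innovations simultaneously
  -- for all `n` outside one null set.
  have hm : ∀ K n, AEMeasurable (Xi K n) P := fun K n => (hXi_law K n).aemeasurable_fst
  have hae : ∀ K n, Xi K n =ᵐ[P] (hm K n).mk (Xi K n) := fun K n => (hm K n).ae_eq_mk
  have hae' : ∀ K, ∀ᵐ ω ∂P, ∀ n, Xi K n ω = (hm K n).mk (Xi K n) ω := fun K => ae_all_iff.2 (hae K)
  have hclt := hreg.tendstoInDistribution_estimators (ξ₀ := ξ₀)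
    (Xi := fun K n => (hm K n).mk (Xi K n)) (γ := γ) hα hX₀ hX₀2 hX hX2 hlim hξ₀ hξ₀_mom
    (fun K n => (hm K n).measurable_mk) (fun K => (hXi_indep K).congr (hae K))
    (fun K n => (IdentDistrib.of_ae_eq (hm K n) (hae K n)).symm.trans (hXi_law K n))
    (fun K => (hξ₀Xi K).congr EventuallyEq.rfl (by
      filter_upwards [hae' K] with ω hω
      exact funext hω))
    hγ₁ hβ (fun n => by
      rw [hγ (n + 1) n.succ_pos]
      push_cast
      rfl)
  refine hclt.congr (fun K => ?_) EventuallyEq.rfl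
  filter_upwards [hae' K] with ω hω
  simp only [avgVarIterate, varIterate_congr α γ (ξ₀ K) hω, esIterate_congr α γ (ξ₀ K) hω]
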